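/- **Setting.** Let $n\ge 2$. A spherical code is a finite set $C$ of unit vectors in $\mathbb R^n$; $C(n,M,s)$ is the set of spherical codes with $|C|=M$ whose maximal inner product of two distinct points exists and equals $s$. Let $P_i^{(n)}$ be the Gegenbauer polynomials normalized by $P_i^{(n)}(1)=1$: $P_0^{(n)}=1$, $P_1^{(n)}=t$, $(i+n-2)P_{i+1}^{(n)}=(2i+n-2)tP_i^{(n)}-iP_{i-1}^{(n)}$. The Gegenbauer coefficients $f_i$ of a polynomial $f$ are given by $f=\sum_i f_iP_i^{(n)}$. Put $M_i(C)=\sum_{x,y\in C}P_i^{(n)}(\langle x,y\rangle)$ and $A_t(x)=|\{y\in C:\langle x,y\rangle=t\}|$ for $x\in C$. For $h$ real-valued on $[-1,1)$ put $E_h(C)=\sum_{x\ne y\in C}h(\langle x,y\rangle)$. **Levenshtein parameters.** Let $m=2k-1+\varepsilon$ with $k\ge1$, $\varepsilon\in\{0,1\}$. Let $P_i^{(a,b)}$ be the Jacobi polynomials, $t_i^{a,b}$ the greatest zero of $P_i^{(a+\frac{n-3}2,\,b+\frac{n-3}2)}$ for $i\ge 1$, and $t_0^{1,1}=-1$. Let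 $I_m=[t_{k-1}^{1,1},t_k^{1,0}]$ if $\varepsilon=0$ and $I_m=[t_k^{1,0},t_k^{1,1}]$ if $\varepsilon=1$, and let $s\in I_m$. Put $$L_{2k-1}(n,s)=\binom{k+n-3}{k-1}\left[\frac{2k+n-3}{n-1}-\frac{P_{k-1}^{(n)}(s)-P_k^{(n)}(s)}{(1-s)P_k^{(n)}(s)}\right],$$ $$L_{2k}(n,s)=\binom{k+n-2}{k}\left[\frac{2k+n-1}{n-1}-\frac{(1+s)(P_k^{(n)}(s)-P_{k+1}^{(n)}(s))}{(1-s)(P_k^{(n)}(s)+P_{k+1}^{(n)}(s))}\right].$$ With $Q_i(t)=P_i^{(\frac{n-1}2,\,\varepsilon+\frac{n-3}2)}(t)$, let $\alpha_0<\dots<\alpha_{k-1+\varepsilon}=s$ be the roots of $(t+1)^\varepsilon\bigl(Q_k(t)Q_{k-1}(s)-Q_k(s)Q_{k-1}(t)\bigr)$, and let $\rho_j$ be the weights of the interpolatory quadrature $f_0=\frac{f(1)}{L_m(n,s)}+\sum_j\rho_jf(\alpha_j)$ (exact for polynomials $f$ of degree at most $m$). Let $T$ be the multiset of size $m$ in which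 every $\alpha_j$ is double, except that $s$ is simple and, if $\varepsilon=1$, that $\alpha_0=-1$ is simple. Put $f_m^{(n,s)}(t)=\prod_{\alpha\in T}(t-\alpha)=\sum_i\ell_iP_i^{(n)}(t)$. **The universal upper bound.** Let $h$ be absolutely monotone on $[-1,1)$ (all derivatives of order $\ge 0$ exist and are nonnegative there) and not constant. Let $g_T=\sum_i g_iP_i^{(n)}$ be the Hermite interpolation polynomial of $h$ at $T$, let $\lambda=\max\{g_i/\ell_i:1\le i\le\deg g_T\}$ (with $\lambda=0$ if $\deg g_T=0$), and $f_m^{(h)}=-\lambda f_m^{(n,s)}+g_T$. The code $C\in C(n,M,s)$ is said to attain the universal upper bound (UUB) if $$E_h(C)=M\left(\frac{M}{L_m(n,s)}-1\right)f_m^{(h)}(1)+M^2\sum_{j=0}^{k-1+\varepsilon}\rho_jh(\alpha_j).$$ **Theorem.** Suppose that $C\in C(n,M,s)$ attains the UUB for such an $h$. Then for every integer $i\ge 0$, $M_i(C)=0$ if and only if the distance distribution of $C$ with respect to $x$ satisfies $$1+\sum_{j=0}^{k-1+\varepsilon}A_{\alpha_j}(x)\,P_i^{(n)}(\alpha_j)=0\qquad\text{for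 every }x\in C.$$ -/

import Mathlib

namespace SphericalCodes

open Polynomial

noncomputable section

/-! ## Gegenbauer and Jacobi polynomials -/

/-- The Gegenbauer polynomials `P_i^{(n)}` normalized by `P_i^{(n)}(1) = 1`, given by
`(i + n - 2) P_{i+1} = (2i + n - 2) t P_i - i P_{i-1}`, `P_0 = 1`, `P_1 = t`. -/
def gegenbauer (n : ℕ) : ℕ → ℝ[X]
  | 0 => 1
  | 1 => X
  | i + 2 =>
      C (((i : ℝ) + 1 + n - 2)⁻¹) *
        (C (2 * ((i : ℝ) + 1) + n - 2) * X * gegenbauer n (i + 1)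
          - C ((i : ℝ) + 1) * gegenbauer n i)

/-- The weight `(1 - t^2)^{(n-3)/2}`. -/
def weight (n : ℕ) (t : ℝ) : ℝ := (1 - t ^ 2) ^ (((n : ℝ) - 3) / 2)

/-- The `i`-th coefficient `f_i` in the Gegenbauer expansion `f = ∑ f_i P_i^{(n)}` of a polynomial
(orthogonal projection with respect to the weight `(1 - t^2)^{(n-3)/2}` on `[-1,1]`). For `i = 0`
this is the mean value `γ_n ∫ f(t) (1 - t^2)^{(n-3)/2} dt` with `γ_n⁻¹ = ∫ (1 - t^2)^{(n-3)/2}`. -/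
def gegenbauerCoeff (n i : ℕ) (f : ℝ[X]) : ℝ :=
  (∫ t in (-1 : ℝ)..1, f.eval t * (gegenbauer n i).eval t * weight n t) /
    ∫ t in (-1 : ℝ)..1, (gegenbauer n i).eval t ^ 2 * weight n t

/-- The Jacobi polynomial `P_i^{(a,b)}` for real parameters `a, b`:
`∑_j (i+a choose i-j) (i+b choose j) ((t-1)/2)^j ((t+1)/2)^{i-j}`. -/
def jacobi (i : ℕ) (a b : ℝ) : ℝ[X] :=
  ∑ j ∈ Finset.range (i + 1),
    C (Ring.choose ((i : ℝ) + a) (i - j) * Ring.choose ((i : ℝ) + b) j) *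
      (C (1 / 2) * (X - 1)) ^ j * (C (1 / 2) * (X + 1)) ^ (i - j)

/-! ## The Levenshtein framework

The index `m = 2k - 1 + ε` is encoded by `k ≥ 1` and `ε ∈ {0, 1}`. -/

/-- `t_i^{a,b}`: the greatest zero of the Jacobi polynomial `P_i^{(a + (n-3)/2, b + (n-3)/2)}` for
`i ≥ 1`, and `-1` for `i = 0` (this value is used for `a = b = 1` only). -/
def greatestZero (n i a b : ℕ) : ℝ :=
  if i = 0 then -1
  else sSup {t : ℝ | (jacobi i (a + ((n : ℝ) - 3) / 2) (b + ((n : ℝ) - 3) / 2)).IsRoot t}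

/-- The Levenshtein interval `I_m`, `m = 2k - 1 + ε`: it is `[t_{k-1}^{1,1}, t_k^{1,0}]` for
`ε = 0` and `[t_k^{1,0}, t_k^{1,1}]` for `ε = 1`. -/
def levenshteinInterval (n k ε : ℕ) : Set ℝ :=
  if ε = 0 then Set.Icc (greatestZero n (k - 1) 1 1) (greatestZero n k 1 0)
  else Set.Icc (greatestZero n k 1 0) (greatestZero n k 1 1)

/-- The Levenshtein function `L_m(n, s)`, `m = 2k - 1 + ε`, for `s ∈ I_m`. -/
def levenshteinBound (n k ε : ℕ) (s : ℝ) : ℝ :=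
  if ε = 0 then
    ((k + n - 3).choose (k - 1) : ℝ) *
      ((2 * (k : ℝ) + n - 3) / ((n : ℝ) - 1)
        - ((gegenbauer n (k - 1)).eval s - (gegenbauer n k).eval s) /
            ((1 - s) * (gegenbauer n k).eval s))
  else
    ((k + n - 2).choose k : ℝ) *
      ((2 * (k : ℝ) + n - 1) / ((n : ℝ) - 1)
        - ((1 + s) * ((gegenbauer n k).eval s - (gegenbauer n (k + 1)).eval s)) /
            ((1 - s) * ((gegenbauer n k).eval s + (gegenbauer n (k + 1)).eval s)))

/-- `Q_i^ε = P_i^{((n-1)/2, ε + (n-3)/2)}`. -/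
def adjacentJacobi (n ε i : ℕ) : ℝ[X] :=
  jacobi i (((n : ℝ) - 1) / 2) ((ε : ℝ) + ((n : ℝ) - 3) / 2)

/-- The set `{α_0, …, α_{k-1+ε}}` of Levenshtein nodes, i.e. of roots of
`(t + 1)^ε (Q_k^ε(t) Q_{k-1}^ε(s) - Q_k^ε(s) Q_{k-1}^ε(t))`. -/
def nodes (n k ε : ℕ) (s : ℝ) : Finset ℝ :=
  ((X + 1) ^ ε *
    (adjacentJacobi n ε k * C ((adjacentJacobi n ε (k - 1)).eval s)
      - C ((adjacentJacobi n ε k).eval s) * adjacentJacobi n ε (k - 1))).roots.toFinset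

/-- The weight `ρ` of the Levenshtein quadrature
`f_0 = f(1) / L_m(n,s) + ∑_i ρ_i f(α_i)` at the node `α`. The quadrature is interpolatory with nodes
`α_0, …, α_{k-1+ε}, 1`, so `ρ` is the mean value of the Lagrange basis polynomial of `α`. -/
def quadratureWeight (n k ε : ℕ) (s α : ℝ) : ℝ :=
  gegenbauerCoeff n 0 (Lagrange.basis (insert 1 (nodes n k ε s)) id α)

/-- The multiset `T` of cardinality `m`: every node is double, except that `s` is simple, and, if
`ε = 1`, that `-1` is simple. -/
def nodeMultiset (n k ε : ℕ) (s : ℝ) : Multiset ℝ :=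
  2 • (nodes n k ε s).val - {s} - if ε = 0 then 0 else {-1}

/-- `∏_{α ∈ T} (t - α)`. -/
def nodalPoly (T : Multiset ℝ) : ℝ[X] := (T.map fun a => X - C a).prod

/-- The Levenshtein polynomial `f_m^{(n,s)}`. -/
def levenshteinPoly (n k ε : ℕ) (s : ℝ) : ℝ[X] := nodalPoly (nodeMultiset n k ε s)

/-! ## Hermite interpolation with simple and double nodes -/

/-- `g` is the Hermite interpolation polynomial of `h` at the multiset `T` of points of `[-1,1)`. -/
def IsHermiteInterpolant (h : ℝ → ℝ) (T : Multiset ℝ) (g : ℝ[X]) : Prop :=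
  g.degree < T.card ∧ ∀ a ∈ T, ∀ j < T.count a,
    (derivative^[j] g).eval a = iteratedDerivWithin j h (Set.Ico (-1) 1) a

/-- The Hermite interpolation polynomial `H_{h,T}` for a multiset `T` of points of `[-1,1)` whose
multiplicities are at most `2`, in closed form; see `isHermiteInterpolant_hermiteInterp`. -/
def hermiteInterp (h : ℝ → ℝ) (T : Multiset ℝ) : ℝ[X] :=
  ∑ a ∈ T.toFinset,
    let u := nodalPoly (T.filter (· ≠ a))
    C ((u.eval a)⁻¹) * u *
      (C (h a) + if T.count a = 1 then 0 else
        C (derivWithin h (Set.Ico (-1) 1) a - h a * (derivative u).eval a / u.eval a) * (X - C a))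

/-! ## Spherical codes, energy, moments, distance distributions -/

/-- `C(n, M, s)`: the codes of cardinality `M` on the unit sphere of `ℝⁿ` whose maximal inner
product of distinct points is `s`. -/
def codes (n M : ℕ) (s : ℝ) : Set (Finset (EuclideanSpace ℝ (Fin n))) :=
  {K | (∀ x ∈ K, ‖x‖ = 1) ∧ K.card = M ∧
    IsGreatest {t : ℝ | ∃ x ∈ K, ∃ y ∈ K, x ≠ y ∧ inner ℝ x y = t} s}

/-- The energy `E_h(K) = ∑_{x ≠ y} h(⟨x, y⟩)` (over ordered pairs). -/
def energy {n : ℕ} (h : ℝ → ℝ) (K : Finset (EuclideanSpace ℝ (Fin n))) : ℝ :=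
  ∑ x ∈ K, ∑ y ∈ K with y ≠ x, h (inner ℝ x y)

/-- The moment `M_i(K) = ∑_{x, y} P_i^{(n)}(⟨x, y⟩)`. -/
def moment {n : ℕ} (i : ℕ) (K : Finset (EuclideanSpace ℝ (Fin n))) : ℝ :=
  ∑ x ∈ K, ∑ y ∈ K, (gegenbauer n i).eval (inner ℝ x y)

open scoped Classical in
/-- The distance distribution `A_t(x) = |{y ∈ K : ⟨x, y⟩ = t}|` of `K` with respect to `x`. -/
def distanceDistribution {n : ℕ} (K : Finset (EuclideanSpace ℝ (Fin n)))
    (x : EuclideanSpace ℝ (Fin n)) (t : ℝ) : ℕ :=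
  (K.filter fun y => inner ℝ x y = t).card

/-! ## The universal upper bound -/

/-- `g_T = H_{h,T}` for the multiset `T` of Levenshtein nodes. -/
def uubInterp (h : ℝ → ℝ) (n k ε : ℕ) (s : ℝ) : ℝ[X] := hermiteInterp h (nodeMultiset n k ε s)

/-- `λ = max {g_i / ℓ_i : 1 ≤ i ≤ deg g_T}`, where `g_i` and `ℓ_i` are the Gegenbauer coefficients
of `g_T` and of the Levenshtein polynomial. If `deg g_T = 0`, the set is empty and the value is `0`,
the smallest `λ ≥ 0` for which all `g_i - λ ℓ_i`, `i ≥ 1`, are nonpositive. -/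
def uubLambda (h : ℝ → ℝ) (n k ε : ℕ) (s : ℝ) : ℝ :=
  sSup ((fun i : ℕ => gegenbauerCoeff n i (uubInterp h n k ε s) /
      gegenbauerCoeff n i (levenshteinPoly n k ε s)) ''
    Set.Icc 1 (uubInterp h n k ε s).natDegree)

/-- The polynomial `f_m^{(h)} = -λ f_m^{(n,s)} + g_T`. -/
def uubPoly (h : ℝ → ℝ) (n k ε : ℕ) (s : ℝ) : ℝ[X] :=
  -C (uubLambda h n k ε s) * levenshteinPoly n k ε s + uubInterp h n k ε s

/-- The universal upper bound
`M (M / L_m(n,s) - 1) f_m^{(h)}(1) + M^2 ∑_i ρ_i h(α_i)`. -/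
def uub (h : ℝ → ℝ) (n M k ε : ℕ) (s : ℝ) : ℝ :=
  M * (M / levenshteinBound n k ε s - 1) * (uubPoly h n k ε s).eval 1
    + (M : ℝ) ^ 2 * ∑ α ∈ nodes n k ε s, quadratureWeight n k ε s α * h α

/-! ## The closed form of the Hermite interpolant is correct -/

theorem nodalPoly_filter_eval_ne (T : Multiset ℝ) (a : ℝ) :
    (nodalPoly (T.filter (· ≠ a))).eval a ≠ 0 := by
  unfold nodalPoly
  rw [eval_multiset_prod]
  intro h0
  rw [Multiset.prod_eq_zero_iff] at h0
  simp only [Multiset.map_map, Multiset.mem_map, Multiset.mem_filter] at h0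
  obtain ⟨b, ⟨_, hb⟩, hb0⟩ := h0
  simp only [Function.comp_apply, eval_sub, eval_X, eval_C, sub_eq_zero] at hb0
  exact hb hb0.symm

theorem pow_count_dvd_nodalPoly_filter (T : Multiset ℝ) {a b : ℝ} (hab : b ≠ a) :
    (X - C b) ^ T.count b ∣ nodalPoly (T.filter (· ≠ a)) := by
  unfold nodalPoly
  have h1 : Multiset.replicate (T.count b) b ≤ T.filter (· ≠ a) := by
    rw [← Multiset.le_count_iff_replicate_le, Multiset.count_filter_of_pos (p := fun x => x ≠ a) hab]
  have h3 := Multiset.prod_dvd_prod_of_le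
    (Multiset.map_le_map (f := fun c : ℝ => (X - C c : ℝ[X])) h1)
  rwa [Multiset.map_replicate, Multiset.prod_replicate] at h3

theorem isHermiteInterpolant_hermiteInterp (h : ℝ → ℝ) (T : Multiset ℝ)
    (h2 : ∀ a, T.count a ≤ 2) : IsHermiteInterpolant h T (hermiteInterp h T) := by
  refine ⟨?_, ?_⟩
  · unfold hermiteInterp
    refine lt_of_le_of_lt (degree_sum_le _ _) ?_
    rw [Finset.sup_lt_iff (WithBot.bot_lt_coe _)]
    intro a ha
    rw [Multiset.mem_toFinset] at ha
    have hpos := Multiset.count_pos.mpr ha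
    have hu : (nodalPoly (T.filter (· ≠ a))).degree = ((T.filter (· ≠ a)).card : WithBot ℕ) := by
      unfold nodalPoly
      rw [degree_eq_natDegree (monic_multiset_prod_of_monic _ _ fun a _ => monic_X_sub_C a).ne_zero,
        natDegree_multiset_prod_X_sub_C_eq_card]
    have hc : (T.filter (· ≠ a)).card + T.count a = T.card := by
      rw [Multiset.count_eq_card_filter_eq, add_comm, ← Multiset.card_add]
      congr 1
      convert Multiset.filter_add_not (fun b => a = b) T using 3
      exact ne_comm
    rw [mul_assoc]
    refine lt_of_le_of_lt ((degree_mul_le _ _).trans (add_le_add degree_C_le le_rfl)) ?_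
    rw [zero_add]
    refine lt_of_le_of_lt (degree_mul_le _ _) ?_
    rw [hu, ← hc]
    split_ifs with h1
    · rw [h1, add_zero]
      refine lt_of_le_of_lt (add_le_add le_rfl degree_C_le) ?_
      rw [add_zero]
      exact_mod_cast Nat.lt_succ_self _
    · have h22 : T.count a = 2 := by have := h2 a; omega
      rw [h22]
      have hd : (C (h a) + C (derivWithin h (Set.Ico (-1) 1) a -
          h a * (derivative (nodalPoly (T.filter (· ≠ a)))).eval a /
            (nodalPoly (T.filter (· ≠ a))).eval a) * (X - C a)).degree ≤ 1 := by
        refine (degree_add_le _ _).trans (max_le (degree_C_le.trans zero_le_one) ?_)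
        exact ((degree_mul_le _ _).trans (add_le_add degree_C_le (degree_X_sub_C_le a))).trans
          (by norm_num)
      refine lt_of_le_of_lt (add_le_add le_rfl hd) ?_
      exact_mod_cast Nat.lt_succ_self _
  · intro b hb j hj
    have hb' : b ∈ T.toFinset := Multiset.mem_toFinset.mpr hb
    have hub := nodalPoly_filter_eval_ne T b
    have hoff : ∀ a ∈ T.toFinset, a ≠ b → ∀ r : ℝ[X],
        (derivative^[j] (C (((nodalPoly (T.filter (· ≠ a))).eval a)⁻¹) *
          nodalPoly (T.filter (· ≠ a)) * r)).eval b = 0 := by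
      intro a _ hab r
      have hd : (X - C b) ^ T.count b ∣ C (((nodalPoly (T.filter (· ≠ a))).eval a)⁻¹) *
          nodalPoly (T.filter (· ≠ a)) * r :=
        ((pow_count_dvd_nodalPoly_filter T hab.symm).mul_left _).mul_right _
      have hd2 := pow_sub_dvd_iterate_derivative_of_pow_dvd j hd
      have hd3 : (X - C b) ∣ derivative^[j] (C (((nodalPoly (T.filter (· ≠ a))).eval a)⁻¹) *
          nodalPoly (T.filter (· ≠ a)) * r) := (dvd_pow_self _ (by omega)).trans hd2
      exact dvd_iff_isRoot.mp hd3
    unfold hermiteInterp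
    rw [iterate_derivative_sum, eval_finsetSum, Finset.sum_eq_single_of_mem b hb'
      (fun a ha hab => hoff a ha hab _)]
    have hj2 : j < 2 := lt_of_lt_of_le hj (h2 b)
    interval_cases j
    · simp only [Function.iterate_zero, id_eq, iteratedDerivWithin_zero]
      split_ifs with h1 <;> simp [hub]
    · have h22 : T.count b ≠ 1 := by omega
      simp only [Function.iterate_one, iteratedDerivWithin_one, if_neg h22]
      simp [derivative_mul]
      field_simp
      ring

end

end SphericalCodes

namespace SphericalCodes

open Polynomial

noncomputable section

/-! ## Algebra of Gegenbauer polynomials -/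

/-! On the sphere the kernel P_i(⟨x, y⟩) is a finite sum of products φ(x) φ(y). Hence M_i(C) is a
sum of squares (∑_y φ(y))², and it vanishes exactly when every row sum ∑_y P_i(⟨x, y⟩) vanishes
(`moment_eq_sum_sq`). It then suffices that all inner products of distinct code points are
Levenshtein nodes, since the row of x is then 1 + ∑ A_{α_j}(x) P_i(α_j) (`sum_eval_inner_eq`).

That the inner products are nodes is the equality case of a linear programming bound
(`inner_mem_nodes_of_energy_eq_uub`). The polynomial f = f_m^{(h)} satisfies h ≤ f on [-1, s] and
f_i ≤ 0 for i ≥ 1, so E_h(C) ≤ E_f(C) ≤ M² f_0 - M f(1), and the Levenshtein quadrature identifies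
the last expression with the UUB. If the bound is attained, f = h at every inner product t. The
Hermite remainder h(t) = g_T(t) + c f_m^{(n,s)}(t) with c ≥ 0 gives (c + λ) f_m^{(n,s)}(t) = 0.
Either t is a node, or λ = 0; in the second case g_T is constant, so h(t) = h(s) with t < s, which
forces an absolutely monotone h to be constant (`eq_of_eq_of_lt`).

The rest is the theory of the Levenshtein nodes. Let O_j be the orthogonal polynomials for the
weight (1 - t)(1 + t)^ε (1 - t²)^{(n-3)/2}; they are built from Gegenbauer polynomials and are
positive multiples of the Jacobi polynomials Q_j (`adjacentJacobi_eq`). The hypothesis s ∈ I_m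
yields a positive quadrature with nodes in [-1, s] (`LowerQuadrature`). From it follow O_j(s) > 0
for j < k, O_k(s) ≤ 0, and that O_{k-1}(s) O_k - O_k(s) O_{k-1} has k simple zeros in [-1, 1)
(`exists_levenshteinNodes`).

The inequality f_i ≤ 0 rests on ℓ_i > 0 for all i ≤ m (`gegenbauerCoeff_levenshteinPoly_pos`). Up to
a positive factor, f_m^{(n,s)} is (1 + t)^ε (O_{k-1}(s) O_k - O_k(s) O_{k-1}) times the nodal
polynomial of the zeros other than s, which is a Christoffel–Darboux kernel and so a positive
combination of O_0, …, O_{k-1}. All these factors have nonnegative Gegenbauer coefficients, and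
products preserve this property (`mean_triple_nonneg`). Finally, the quadrature weight at 1 is 1 /
L_m(n, s) (`LevenshteinNodes.mean_basis_one`). -/

theorem gegenbauer_rec {n : ℕ} (hn : 2 ≤ n) (i : ℕ) :
    ((i : ℝ[X]) + (n : ℝ[X]) - 1) * gegenbauer n (i + 2) =
      (2 * (i : ℝ[X]) + (n : ℝ[X])) * X * gegenbauer n (i + 1) - ((i : ℝ[X]) + 1) * gegenbauer n i := by
  have h2 : (2 : ℝ) ≤ n := by exact_mod_cast hn
  have h0 : (i : ℝ) + 1 + n - 2 ≠ 0 := by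
    have : (0 : ℝ) ≤ i := i.cast_nonneg
    linarith
  have h1 : ((i : ℝ[X]) + (n : ℝ[X]) - 1) = C ((i : ℝ) + 1 + n - 2) := by
    simp only [map_sub, map_add, map_natCast, map_one, map_ofNat]; ring
  have h3 : ((i : ℝ[X]) + (n : ℝ[X]) - 1) * C (((i : ℝ) + 1 + n - 2)⁻¹) = 1 := by
    rw [h1, ← C_mul, mul_inv_cancel₀ h0, C_1]
  rw [show gegenbauer n (i + 2) = C (((i : ℝ) + 1 + n - 2)⁻¹) *
        (C (2 * ((i : ℝ) + 1) + n - 2) * X * gegenbauer n (i + 1)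
          - C ((i : ℝ) + 1) * gegenbauer n i) from rfl, ← mul_assoc, h3]
  simp only [map_sub, map_add, map_mul, map_natCast, map_one, map_ofNat]
  ring

theorem natCast_add_sub_ne_zero {n : ℕ} (hn : 2 ≤ n) (i : ℕ) : ((i : ℝ[X]) + (n : ℝ[X]) - 1) ≠ 0 := by
  have h2 : (2 : ℝ) ≤ n := by exact_mod_cast hn
  have h1 : ((i : ℝ[X]) + (n : ℝ[X]) - 1) = C ((i : ℝ) + n - 1) := by
    simp only [map_sub, map_add, map_natCast, map_one]
  rw [h1, Ne, C_eq_zero]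
  have : (0 : ℝ) ≤ i := i.cast_nonneg
  intro h; linarith

/-- The two structure relations support each other: the first at i + 1 is the second at i rewritten
by the recurrence, and the second at i + 1 comes from differentiating the recurrence. -/
theorem derivative_gegenbauer_aux {n : ℕ} (hn : 2 ≤ n) (i : ℕ) :
    (1 - X ^ 2) * derivative (gegenbauer n i) =
        ((i : ℝ[X]) + (n : ℝ[X]) - 2) * (X * gegenbauer n i - gegenbauer n (i + 1)) ∧
      (1 - X ^ 2) * derivative (gegenbauer n (i + 1)) =
        ((i : ℝ[X]) + 1) * (gegenbauer n i - X * gegenbauer n (i + 1)) := by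
  induction i with
  | zero => simp [gegenbauer]; ring
  | succ i ih =>
    obtain ⟨ih1, ih2⟩ := ih
    have hr := gegenbauer_rec hn i
    have hd := congrArg derivative hr
    simp only [derivative_mul, derivative_sub, derivative_add, derivative_X, derivative_natCast,
      derivative_one, derivative_ofNat] at hd
    refine ⟨?_, ?_⟩
    · rw [ih2]; push_cast
      linear_combination hr
    · apply mul_left_cancel₀ (natCast_add_sub_ne_zero hn i)
      push_cast
      linear_combination (1 - X ^ 2) * hd + (2 * (i : ℝ[X]) + n) * X * ih2 - ((i : ℝ[X]) + 1) * ih1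
        + ((i : ℝ[X]) + 2) * X * hr

theorem one_sub_sq_mul_derivative {n : ℕ} (hn : 2 ≤ n) (i : ℕ) :
    (1 - X ^ 2) * derivative (gegenbauer n i) =
      ((i : ℝ[X]) + (n : ℝ[X]) - 2) * (X * gegenbauer n i - gegenbauer n (i + 1)) :=
  (derivative_gegenbauer_aux hn i).1

theorem one_sub_sq_mul_derivative_succ {n : ℕ} (hn : 2 ≤ n) (i : ℕ) :
    (1 - X ^ 2) * derivative (gegenbauer n (i + 1)) =
      ((i : ℝ[X]) + 1) * (gegenbauer n i - X * gegenbauer n (i + 1)) :=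
  (derivative_gegenbauer_aux hn i).2

theorem gegenbauer_eval_one {n : ℕ} (hn : 2 ≤ n) (i : ℕ) : (gegenbauer n i).eval 1 = 1 := by
  have key : ∀ i, (gegenbauer n i).eval 1 = 1 ∧ (gegenbauer n (i + 1)).eval 1 = 1 := by
    intro i
    induction i with
    | zero => simp [gegenbauer]
    | succ i ih =>
      refine ⟨ih.2, ?_⟩
      have h := congrArg (eval 1) (gegenbauer_rec hn i)
      simp only [eval_mul, eval_sub, eval_add, eval_natCast, eval_one, eval_X, eval_ofNat, ih.1,
        ih.2] at h
      have h2 : (2 : ℝ) ≤ n := by exact_mod_cast hn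
      have h0 : (i : ℝ) + n - 1 ≠ 0 := by
        have : (0 : ℝ) ≤ i := i.cast_nonneg
        intro h; linarith
      apply mul_left_cancel₀ h0
      linarith
  exact (key i).1

/-- `p` has degree at most `d` and its coefficient at `t^d` is positive. -/
def HasPosLead (p : ℝ[X]) (d : ℕ) : Prop := p.natDegree ≤ d ∧ 0 < p.coeff d

theorem HasPosLead.natDegree_eq {p : ℝ[X]} {d : ℕ} (h : HasPosLead p d) : p.natDegree = d :=
  le_antisymm h.1 (le_natDegree_of_ne_zero h.2.ne')

theorem HasPosLead.leadingCoeff_pos {p : ℝ[X]} {d : ℕ} (h : HasPosLead p d) :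
    0 < p.leadingCoeff := by
  rw [leadingCoeff, h.natDegree_eq]; exact h.2

theorem HasPosLead.ne_zero {p : ℝ[X]} {d : ℕ} (h : HasPosLead p d) : p ≠ 0 := by
  rintro rfl; simpa using h.2

theorem HasPosLead.C_mul {p : ℝ[X]} {d : ℕ} (h : HasPosLead p d) {c : ℝ} (hc : 0 < c) :
    HasPosLead (C c * p) d :=
  ⟨(natDegree_C_mul_le _ _).trans h.1, by rw [coeff_C_mul]; exact mul_pos hc h.2⟩

theorem HasPosLead.add_lower {p q : ℝ[X]} {d : ℕ} (h : HasPosLead p d) (hq : q.natDegree < d) :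
    HasPosLead (p + q) d :=
  ⟨natDegree_add_le_of_degree_le h.1 hq.le, by
    rw [coeff_add, coeff_eq_zero_of_natDegree_lt hq, add_zero]; exact h.2⟩

theorem HasPosLead.X_mul {p : ℝ[X]} {d : ℕ} (h : HasPosLead p d) : HasPosLead (X * p) (d + 1) :=
  ⟨by have := natDegree_mul_le (p := (X : ℝ[X])) (q := p)
      have := h.1
      have := natDegree_X_le (R := ℝ)
      omega, by rw [coeff_X_mul]; exact h.2⟩

theorem HasPosLead.derivative {p : ℝ[X]} {d : ℕ} (h : HasPosLead p (d + 1)) :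
    HasPosLead (derivative p) d :=
  ⟨by have := natDegree_derivative_le p
      have := h.1
      omega, by rw [coeff_derivative]; exact mul_pos h.2 (by positivity)⟩

theorem gegenbauer_hasPosLead {n : ℕ} (hn : 2 ≤ n) (i : ℕ) : HasPosLead (gegenbauer n i) i := by
  have h2 : (2 : ℝ) ≤ n := by exact_mod_cast hn
  have key : ∀ i, HasPosLead (gegenbauer n i) i ∧ HasPosLead (gegenbauer n (i + 1)) (i + 1) := by
    intro i
    induction i with
    | zero => simp [gegenbauer, HasPosLead]
    | succ i ih =>
      refine ⟨ih.2, ?_⟩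
      have hi : (0 : ℝ) ≤ i := i.cast_nonneg
      rw [gegenbauer]
      refine HasPosLead.C_mul ?_ (inv_pos.2 (by linarith))
      rw [sub_eq_add_neg]
      refine HasPosLead.add_lower ?_ ?_
      · rw [mul_assoc]
        exact ih.2.X_mul.C_mul (by linarith)
      · rw [natDegree_neg]
        have := natDegree_C_mul_le ((i : ℝ) + 1) (gegenbauer n i)
        have := ih.1.1
        omega
  exact (key i).1

theorem gegenbauer_ne_zero {n : ℕ} (hn : 2 ≤ n) (i : ℕ) : gegenbauer n i ≠ 0 :=
  (gegenbauer_hasPosLead hn i).ne_zero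

/-! ## Adjacent Gegenbauer polynomials -/

/-- The binomial coefficient `(k + n - 2 choose k)`. -/
def kap (n k : ℕ) : ℝ := ((k + n - 2).choose k : ℝ)

theorem kap_pos {n : ℕ} (hn : 2 ≤ n) (k : ℕ) : 0 < kap n k := by
  unfold kap
  exact_mod_cast Nat.choose_pos (by omega)

theorem kap_zero (n : ℕ) : kap n 0 = 1 := by simp [kap]

theorem kap_succ {n : ℕ} (hn : 2 ≤ n) (k : ℕ) :
    kap n (k + 1) * ((k : ℝ) + 1) = kap n k * ((k : ℝ) + n - 1) := by
  obtain ⟨m, rfl⟩ := Nat.exists_eq_add_of_le' hn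
  unfold kap
  have h := Nat.add_one_mul_choose_eq (k + m) k
  have e1 : k + 1 + (m + 2) - 2 = k + m + 1 := by omega
  have e2 : k + (m + 2) - 2 = k + m := by omega
  rw [e1, e2]
  have h' : ((k : ℝ) + m + 1) * ((k + m).choose k) = ((k + m + 1).choose (k + 1)) * (k + 1) := by
    exact_mod_cast h
  push_cast
  linarith

/-- A positive multiple of `(P_{j+1}^{(n)})'`; these are the orthogonal polynomials for the
weight `(1 - t^2)^{(n-1)/2}`. -/
def adjH (n j : ℕ) : ℝ[X] := C (kap n j / (j + 1)) * derivative (gegenbauer n (j + 1))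

/-- The orthogonal polynomials for the weight `(1 - t) (1 - t^2)^{(n-3)/2}`. -/
def adjJ (n : ℕ) : ℕ → ℝ[X]
  | 0 => adjH n 0
  | j + 1 => adjH n (j + 1) + adjH n j

theorem one_sub_sq_mul_adjH {n : ℕ} (hn : 2 ≤ n) (j : ℕ) :
    (1 - X ^ 2) * adjH n j = C (kap n j) * (gegenbauer n j - X * gegenbauer n (j + 1)) := by
  have h := one_sub_sq_mul_derivative_succ hn j
  have hc : C (kap n j / (j + 1)) * ((j : ℝ[X]) + 1) = C (kap n j) := by
    have : ((j : ℝ[X]) + 1) = C ((j : ℝ) + 1) := by simp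
    rw [this, ← C_mul, div_mul_cancel₀ _ (by positivity)]
  unfold adjH
  rw [← hc]
  linear_combination C (kap n j / (j + 1)) * h

theorem one_sub_sq_mul_adjH' {n : ℕ} (hn : 2 ≤ n) (j : ℕ) :
    (1 - X ^ 2) * adjH n j =
      C (kap n (j + 1)) * (X * gegenbauer n (j + 1) - gegenbauer n (j + 2)) := by
  have h := one_sub_sq_mul_derivative hn (j + 1)
  have hc : C (kap n j / (j + 1)) * ((j : ℝ[X]) + (n : ℝ[X]) - 1) = C (kap n (j + 1)) := by
    have : ((j : ℝ[X]) + (n : ℝ[X]) - 1) = C ((j : ℝ) + n - 1) := by simp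
    rw [this, ← C_mul, div_mul_eq_mul_div, ← kap_succ hn, mul_div_cancel_right₀ _ (by positivity)]
  unfold adjH
  rw [← hc]
  push_cast at h
  linear_combination C (kap n j / (j + 1)) * h

theorem one_sub_X_sq_ne_zero : (1 - X ^ 2 : ℝ[X]) ≠ 0 := by
  intro h
  have := congrArg (eval 0) h
  simp at this

theorem one_add_X_ne_zero : (1 + X : ℝ[X]) ≠ 0 := by
  intro h
  have := congrArg (eval 0) h
  simp at this

theorem one_sub_X_ne_zero : (1 - X : ℝ[X]) ≠ 0 := by
  intro h
  have := congrArg (eval 0) h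
  simp at this

theorem adjH_zero {n : ℕ} : adjH n 0 = 1 := by
  simp [adjH, gegenbauer, kap_zero]

/-- The Christoffel–Darboux formula with one argument at 1. It makes `adjJ n j` orthogonal to lower
degrees for the weight with the extra factor 1 - t. -/
theorem one_sub_mul_adjJ {n : ℕ} (hn : 2 ≤ n) (j : ℕ) :
    (1 - X) * adjJ n j = C (kap n j) * (gegenbauer n j - gegenbauer n (j + 1)) := by
  cases j with
  | zero => simp [adjJ, adjH_zero, kap_zero, gegenbauer]
  | succ j =>
    apply mul_left_cancel₀ one_add_X_ne_zero
    rw [adjJ]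
    linear_combination one_sub_sq_mul_adjH hn (j + 1) + one_sub_sq_mul_adjH' hn j

theorem one_add_mul_adjH_sub {n : ℕ} (hn : 2 ≤ n) (j : ℕ) :
    (1 + X) * (adjH n (j + 1) - adjH n j) =
      C (kap n (j + 1)) * (gegenbauer n (j + 1) + gegenbauer n (j + 2)) := by
  apply mul_left_cancel₀ one_sub_X_ne_zero
  linear_combination one_sub_sq_mul_adjH hn (j + 1) - one_sub_sq_mul_adjH' hn j

/-- The factor r_i = κ_i + κ_{i-1} is the dimension of the spherical harmonics of degree i. Thus
`adjH n j` is the partial sum of r_i P_i over the i ≤ j of the parity of j, and `adjJ n j` the full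
partial sum; in this form the Gegenbauer coefficients are visibly nonnegative. -/
theorem adjH_add_two {n : ℕ} (hn : 2 ≤ n) (j : ℕ) :
    adjH n (j + 2) =
      adjH n j + C (kap n (j + 2) + kap n (j + 1)) * gegenbauer n (j + 2) := by
  apply mul_left_cancel₀ one_sub_X_sq_ne_zero
  apply mul_left_cancel₀ (natCast_add_sub_ne_zero hn (j + 1))
  have hr := gegenbauer_rec hn (j + 1)
  have hk := congrArg C (kap_succ hn (j + 1))
  simp only [map_mul, map_add, map_sub, map_one, map_natCast, Nat.cast_add, Nat.cast_one] at hk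
  have h1 := one_sub_sq_mul_adjH hn (j + 2)
  have h2 := one_sub_sq_mul_adjH' hn j
  simp only [map_add]
  push_cast at hr ⊢
  linear_combination ((j : ℝ[X]) + n) * (h1 - h2) - C (kap n (j + 2)) * X * hr
    + (X * gegenbauer n (j + 1) - X ^ 2 * gegenbauer n (j + 2)) * hk

theorem adjH_one {n : ℕ} (hn : 2 ≤ n) : adjH n 1 = C (n : ℝ) * X := by
  have h := one_add_mul_adjH_sub hn 0
  have hr := gegenbauer_rec hn 0
  have hk := kap_succ hn 0
  rw [kap_zero] at hk
  have hk' : kap n 1 = (n : ℝ) - 1 := by simpa using hk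
  rw [zero_add, adjH_zero, hk'] at h
  simp only [zero_add, map_sub, map_natCast, map_one, Nat.cast_zero, mul_zero] at h hr ⊢
  rw [show gegenbauer n 0 = 1 from rfl, show gegenbauer n 1 = X from rfl] at hr
  rw [show gegenbauer n 1 = X from rfl] at h
  apply mul_left_cancel₀ one_add_X_ne_zero
  linear_combination h + hr

theorem kap_one {n : ℕ} (hn : 2 ≤ n) : kap n 1 = (n : ℝ) - 1 := by
  have hk := kap_succ hn 0
  rw [kap_zero] at hk
  simpa using hk

theorem adjH_eval_one {n : ℕ} (hn : 2 ≤ n) (j : ℕ) :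
    (adjH n j).eval 1 * ((n : ℝ) - 1) = kap n j * ((j : ℝ) + n - 1) := by
  have key : ∀ j, (adjH n j).eval 1 * ((n : ℝ) - 1) = kap n j * ((j : ℝ) + n - 1) ∧
      (adjH n (j + 1)).eval 1 * ((n : ℝ) - 1) = kap n (j + 1) * (((j + 1 : ℕ) : ℝ) + n - 1) := by
    intro j
    induction j with
    | zero => simp [adjH_zero, adjH_one hn, kap_zero, kap_one hn]; ring
    | succ j ih =>
      refine ⟨ih.2, ?_⟩
      have hk := kap_succ hn (j + 1)
      have hk0 := kap_succ hn j
      rw [adjH_add_two hn]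
      simp only [eval_add, eval_mul, eval_C, gegenbauer_eval_one hn]
      push_cast at *
      linear_combination ih.1 - hk - hk0
  exact (key j).1

theorem adjH_hasPosLead {n : ℕ} (hn : 2 ≤ n) (j : ℕ) : HasPosLead (adjH n j) j :=
  (gegenbauer_hasPosLead hn (j + 1)).derivative.C_mul (div_pos (kap_pos hn j) (by positivity))

theorem adjJ_hasPosLead {n : ℕ} (hn : 2 ≤ n) (j : ℕ) : HasPosLead (adjJ n j) j := by
  cases j with
  | zero => exact adjH_hasPosLead hn 0
  | succ j =>
    exact (adjH_hasPosLead hn (j + 1)).add_lower (by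
      have := (adjH_hasPosLead hn j).1; omega)

theorem adjJ_succ_sub {n : ℕ} (hn : 2 ≤ n) (j : ℕ) :
    adjJ n (j + 1) - adjJ n j = C (kap n (j + 1) + kap n j) * gegenbauer n (j + 1) := by
  cases j with
  | zero =>
    simp only [adjJ, adjH_zero, zero_add, adjH_one hn, kap_zero, kap_one hn, gegenbauer]
    simp
  | succ j =>
    rw [adjJ, adjJ, adjH_add_two hn]; ring

end

end SphericalCodes

namespace SphericalCodes

open Polynomial

noncomputable section

/-! ## Positive definiteness of Gegenbauer polynomials on the sphere -/

section Zonal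

variable {A : Type*} [CommRing A] [Algebra ℝ A]

/-- The homogenized Gegenbauer polynomials: `gegenbauer` is the case `U = t`, `w = 1`. -/
def zonal (n : ℕ) (U w : A) : ℕ → A
  | 0 => 1
  | 1 => U
  | i + 2 =>
      algebraMap ℝ A (((i : ℝ) + 1 + n - 2)⁻¹) *
        (algebraMap ℝ A (2 * ((i : ℝ) + 1) + n - 2) * U * zonal n U w (i + 1)
          - algebraMap ℝ A ((i : ℝ) + 1) * w * zonal n U w i)

theorem map_zonal {B : Type*} [CommRing B] [Algebra ℝ B] (f : A →ₐ[ℝ] B) (n : ℕ) (U w : A)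
    (i : ℕ) : f (zonal n U w i) = zonal n (f U) (f w) i := by
  have key : ∀ i, f (zonal n U w i) = zonal n (f U) (f w) i ∧
      f (zonal n U w (i + 1)) = zonal n (f U) (f w) (i + 1) := by
    intro i
    induction i with
    | zero => simp [zonal]
    | succ i ih => exact ⟨ih.2, by simp [zonal, ih.1, ih.2]⟩
  exact (key i).1

theorem zonal_X_one (n i : ℕ) : zonal n (X : ℝ[X]) 1 i = gegenbauer n i := by
  have key : ∀ i, zonal n (X : ℝ[X]) 1 i = gegenbauer n i ∧
      zonal n (X : ℝ[X]) 1 (i + 1) = gegenbauer n (i + 1) := by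
    intro i
    induction i with
    | zero => simp [zonal, gegenbauer]
    | succ i ih =>
      refine ⟨ih.2, ?_⟩
      rw [zonal, ih.1, ih.2, mul_one]
      rfl
  exact (key i).1

theorem zonal_real (n i : ℕ) (t : ℝ) : zonal n t 1 i = (gegenbauer n i).eval t := by
  rw [← zonal_X_one, ← coe_aeval_eq_eval, map_zonal]
  simp

theorem zonal_rec {n : ℕ} (hn : 2 ≤ n) (U w : A) (i : ℕ) :
    ((i : A) + (n : A) - 1) * zonal n U w (i + 2) =
      (2 * (i : A) + (n : A)) * U * zonal n U w (i + 1) - ((i : A) + 1) * w * zonal n U w i := by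
  have h2 : (2 : ℝ) ≤ n := by exact_mod_cast hn
  have h0 : (i : ℝ) + 1 + n - 2 ≠ 0 := by
    have : (0 : ℝ) ≤ i := i.cast_nonneg
    linarith
  have h1 : ((i : A) + (n : A) - 1) = algebraMap ℝ A ((i : ℝ) + 1 + n - 2) := by
    simp only [map_sub, map_add, map_natCast, map_one, map_ofNat]; ring
  have h3 : ((i : A) + (n : A) - 1) * algebraMap ℝ A (((i : ℝ) + 1 + n - 2)⁻¹) = 1 := by
    rw [h1, ← map_mul, mul_inv_cancel₀ h0, map_one]
  rw [zonal, ← mul_assoc, h3]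
  simp only [map_sub, map_add, map_mul, map_natCast, map_one, map_ofNat]
  ring

theorem zonal_cancel {n : ℕ} (hn : 2 ≤ n) (i : ℕ) {a b : A}
    (h : ((i : A) + (n : A) - 1) * a = ((i : A) + (n : A) - 1) * b) : a = b := by
  have h2 : (2 : ℝ) ≤ n := by exact_mod_cast hn
  have h0 : (i : ℝ) + n - 1 ≠ 0 := by
    have : (0 : ℝ) ≤ i := i.cast_nonneg
    intro h; linarith
  have h1 : ((i : A) + (n : A) - 1) = algebraMap ℝ A ((i : ℝ) + n - 1) := by
    simp only [map_sub, map_add, map_natCast, map_one]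
  have h3 : algebraMap ℝ A (((i : ℝ) + n - 1)⁻¹) * ((i : A) + (n : A) - 1) = 1 := by
    rw [h1, ← map_mul, inv_mul_cancel₀ h0, map_one]
  calc a = algebraMap ℝ A (((i : ℝ) + n - 1)⁻¹) * (((i : A) + (n : A) - 1) * a) := by
        rw [← mul_assoc, h3, one_mul]
    _ = b := by rw [h, ← mul_assoc, h3, one_mul]

/-- A derivation that kills neither radial factor (`δ U = U`, `δ w = 2 w` is the Euler field in
one of the two groups of variables). -/
theorem euler_zonal {n : ℕ} (hn : 2 ≤ n) (δ : Derivation ℝ A A) {U w : A} (hU : δ U = U)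
    (hw : δ w = 2 * w) (i : ℕ) : δ (zonal n U w i) = i * zonal n U w i := by
  have key : ∀ i : ℕ, δ (zonal n U w i) = i * zonal n U w i ∧
      δ (zonal n U w (i + 1)) = (i + 1 : ℕ) * zonal n U w (i + 1) := by
    intro i
    induction i with
    | zero => simp [zonal, hU]
    | succ i ih =>
      refine ⟨ih.2, ?_⟩
      have hr := zonal_rec hn U w i
      have hd := congrArg δ hr
      simp only [Derivation.leibniz, smul_eq_mul, map_sub, map_add, Derivation.map_natCast,
        Derivation.map_one_eq_zero, hU, hw, ih.1, ih.2] at hd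
      have h2 : δ (2 : A) = 0 := by exact_mod_cast Derivation.map_natCast δ 2
      rw [h2] at hd
      apply zonal_cancel hn i
      push_cast at hd ⊢
      linear_combination hd - ((i : A) + 2) * hr
  exact (key i).1

/-- Used for δ = ∑ y_a ∂_{x_a} with q = |y|², and for the same with x and y exchanged: such a field
trades one degree in one group of variables for one in the other. -/
theorem lowering_zonal {n : ℕ} (hn : 2 ≤ n) (δ : Derivation ℝ A A) {U w q : A} (hU : δ U = q)
    (hw : δ w = 2 * q * U) (i : ℕ) :
    δ (zonal n U w (i + 1)) = (i + 1) * q * zonal n U w i := by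
  have h2 : δ (2 : A) = 0 := by exact_mod_cast Derivation.map_natCast δ 2
  have key : ∀ i : ℕ, δ (zonal n U w (i + 1)) = (i + 1) * q * zonal n U w i ∧
      δ (zonal n U w (i + 2)) = (i + 2) * q * zonal n U w (i + 1) := by
    intro i
    induction i with
    | zero =>
      refine ⟨by simp [zonal, hU], ?_⟩
      have hr := zonal_rec hn U w 0
      have hd := congrArg δ hr
      have z0 : zonal n U w 0 = 1 := rfl
      have z1 : zonal n U w 1 = U := rfl
      rw [zero_add, zero_add, z0, z1] at hd
      simp only [Derivation.leibniz, smul_eq_mul, map_sub, map_add, Derivation.map_natCast,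
        Derivation.map_one_eq_zero, hU, hw, h2] at hd
      apply zonal_cancel hn 0
      rw [zero_add, zero_add, z1]
      push_cast at hd ⊢
      linear_combination hd
    | succ i ih =>
      refine ⟨by rw [ih.2]; push_cast; ring, ?_⟩
      have hr := zonal_rec hn U w (i + 1)
      have hr0 := zonal_rec hn U w i
      have hd := congrArg δ hr
      simp only [Derivation.leibniz, smul_eq_mul, map_sub, map_add, Derivation.map_natCast,
        Derivation.map_one_eq_zero, hU, hw, ih.1, ih.2, h2] at hd
      apply zonal_cancel hn (i + 1)
      push_cast at hd hr ⊢
      linear_combination hd - ((i : A) + 2) * q * hr0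
  exact (key i).1

end Zonal

theorem derivation_sum_smul_apply {ι A : Type*} [CommRing A] [Algebra ℝ A] (s : Finset ι)
    (f : ι → A) (D : ι → Derivation ℝ A A) (x : A) :
    (∑ a ∈ s, f a • D a) x = ∑ a ∈ s, f a * D a x := by
  classical
  induction s using Finset.induction_on with
  | empty => simp
  | insert a s ha ih => rw [Finset.sum_insert ha, Finset.sum_insert ha, Derivation.add_apply, ih,
      Derivation.smul_apply, smul_eq_mul]

section Features

open MvPolynomial

variable (n : ℕ)

abbrev PairPoly : Type := MvPolynomial (Fin n ⊕ Fin n) ℝ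

def xv (a : Fin n) : PairPoly n := X (Sum.inl a)
def yv (a : Fin n) : PairPoly n := X (Sum.inr a)
def dx (a : Fin n) : Derivation ℝ (PairPoly n) (PairPoly n) := pderiv (Sum.inl a)
def dy (a : Fin n) : Derivation ℝ (PairPoly n) (PairPoly n) := pderiv (Sum.inr a)
def pairU : PairPoly n := ∑ a, xv n a * yv n a
def pairR : PairPoly n := ∑ a, xv n a ^ 2
def pairQ : PairPoly n := ∑ a, yv n a ^ 2

theorem dx_pairU (a : Fin n) : dx n a (pairU n) = yv n a := by
  simp [dx, pairU, xv, yv, Derivation.leibniz, pderiv_X, Pi.single_apply]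

theorem dy_pairU (a : Fin n) : dy n a (pairU n) = xv n a := by
  simp [dy, pairU, xv, yv, Derivation.leibniz, pderiv_X, Pi.single_apply]

theorem dx_pairR (a : Fin n) : dx n a (pairR n) = 2 * xv n a := by
  simp [dx, pairR, xv, Derivation.leibniz_pow, pderiv_X, Pi.single_apply]

theorem dy_pairR (a : Fin n) : dy n a (pairR n) = 0 := by
  simp [dy, pairR, xv, Derivation.leibniz_pow, pderiv_X]

theorem dx_pairQ (a : Fin n) : dx n a (pairQ n) = 0 := by
  simp [dx, pairQ, yv, Derivation.leibniz_pow, pderiv_X]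

theorem dy_pairQ (a : Fin n) : dy n a (pairQ n) = 2 * yv n a := by
  simp [dy, pairQ, yv, Derivation.leibniz_pow, pderiv_X, Pi.single_apply]

theorem dx_xv (a : Fin n) : dx n a (xv n a) = 1 := by simp [dx, xv]

theorem dx_yv (a b : Fin n) : dx n a (yv n b) = 0 := by
  simp [dx, yv, pderiv_X]

theorem dx_norms (a : Fin n) : dx n a (pairR n * pairQ n) = 2 * xv n a * pairQ n := by
  simp only [Derivation.leibniz, smul_eq_mul, dx_pairR, dx_pairQ]; ring

theorem dy_norms (a : Fin n) : dy n a (pairR n * pairQ n) = 2 * yv n a * pairR n := by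
  simp only [Derivation.leibniz, smul_eq_mul, dy_pairR, dy_pairQ]; ring

/-- The zonal harmonic of degree `i`, as a polynomial in both arguments. -/
def zon (i : ℕ) : PairPoly n := zonal n (pairU n) (pairR n * pairQ n) i

theorem sum_xv_dx_zon (hn : 2 ≤ n) (i : ℕ) : ∑ a, xv n a * dx n a (zon n i) = i * zon n i := by
  have h := euler_zonal hn (∑ a, xv n a • dx n a) (U := pairU n) (w := pairR n * pairQ n)
    ?_ ?_ i
  · rwa [derivation_sum_smul_apply] at h
  · simp only [derivation_sum_smul_apply, dx_pairU]; rfl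
  · simp only [derivation_sum_smul_apply, dx_norms]
    rw [pairR, Finset.sum_mul, Finset.mul_sum]
    exact Finset.sum_congr rfl fun a _ => by ring

theorem sum_yv_dy_zon (hn : 2 ≤ n) (i : ℕ) : ∑ a, yv n a * dy n a (zon n i) = i * zon n i := by
  have h := euler_zonal hn (∑ a, yv n a • dy n a) (U := pairU n) (w := pairR n * pairQ n)
    ?_ ?_ i
  · rwa [derivation_sum_smul_apply] at h
  · simp only [derivation_sum_smul_apply, dy_pairU]
    exact Finset.sum_congr rfl fun a _ => mul_comm _ _
  · simp only [derivation_sum_smul_apply, dy_norms]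
    rw [pairQ, Finset.mul_sum, Finset.mul_sum]
    exact Finset.sum_congr rfl fun a _ => by ring

theorem sum_yv_dx_zon (hn : 2 ≤ n) (i : ℕ) :
    ∑ a, yv n a * dx n a (zon n (i + 1)) = (i + 1) * pairQ n * zon n i := by
  have h := lowering_zonal hn (∑ a, yv n a • dx n a) (U := pairU n) (w := pairR n * pairQ n)
    (q := pairQ n) ?_ ?_ i
  · rwa [derivation_sum_smul_apply] at h
  · simp [derivation_sum_smul_apply, dx_pairU, pairQ, sq]
  · simp only [derivation_sum_smul_apply, dx_norms]
    rw [pairU, Finset.mul_sum]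
    exact Finset.sum_congr rfl fun a _ => by ring

theorem sum_xv_dy_zon (hn : 2 ≤ n) (i : ℕ) :
    ∑ a, xv n a * dy n a (zon n (i + 1)) = (i + 1) * pairR n * zon n i := by
  have h := lowering_zonal hn (∑ a, xv n a • dy n a) (U := pairU n) (w := pairR n * pairQ n)
    (q := pairR n) ?_ ?_ i
  · rwa [derivation_sum_smul_apply] at h
  · simp [derivation_sum_smul_apply, dy_pairU, pairR, sq]
  · simp only [derivation_sum_smul_apply, dy_norms]
    rw [pairU, Finset.mul_sum]
    exact Finset.sum_congr rfl fun a _ => by ring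

/-- The mixed operator `∑ ∂_{x_a} ∂_{y_a}`. -/
def mixed (f : PairPoly n) : PairPoly n := ∑ a, dx n a (dy n a f)

theorem mixed_pairU_mul (f : PairPoly n) :
    mixed n (pairU n * f) = n * f + ∑ a, xv n a * dx n a f + ∑ a, yv n a * dy n a f
      + pairU n * mixed n f := by
  simp only [mixed, Derivation.leibniz, smul_eq_mul, dy_pairU, map_add, dx_pairU, dx_xv]
  simp only [Finset.sum_add_distrib, ← Finset.mul_sum, mul_one, Finset.sum_const,
    Finset.card_univ, Fintype.card_fin, nsmul_eq_mul]
  have : ∑ a, dy n a f * yv n a = ∑ a, yv n a * dy n a f :=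
    Finset.sum_congr rfl fun a _ => mul_comm _ _
  rw [this]; ring

theorem mixed_norms_mul (f : PairPoly n) :
    mixed n (pairR n * pairQ n * f) = 4 * pairU n * f + 2 * pairR n * ∑ a, yv n a * dx n a f
      + 2 * pairQ n * ∑ a, xv n a * dy n a f + pairR n * pairQ n * mixed n f := by
  have h2 : ∀ a, dx n a (2 : PairPoly n) = 0 := fun a => by
    exact_mod_cast Derivation.map_natCast (dx n a) 2
  simp only [mixed, Derivation.leibniz, smul_eq_mul, dy_pairR, dy_pairQ, map_add, dx_pairR,
    dx_pairQ, dx_yv, mul_zero, zero_add, add_zero, h2]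
  rw [pairU, Finset.mul_sum, Finset.sum_mul, Finset.mul_sum, Finset.mul_sum, Finset.mul_sum,
    ← Finset.sum_add_distrib, ← Finset.sum_add_distrib, ← Finset.sum_add_distrib]
  exact Finset.sum_congr rfl fun a _ => by ring

/-- Applying the mixed operator to the three-term recurrence produces, by the two product rules,
only Euler and lowering sums and the operator at smaller indices, so the induction closes. -/
theorem mixed_zon (hn : 2 ≤ n) (i : ℕ) :
    mixed n (zon n (i + 1)) = (i + 1) * (2 * i + n) * zon n i := by
  have madd : ∀ f g, mixed n (f - g) = mixed n f - mixed n g := fun f g => by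
    simp [mixed, Finset.sum_sub_distrib]
  have mC : ∀ (c : ℝ) f, mixed n (algebraMap ℝ _ c * f) = algebraMap ℝ _ c * mixed n f :=
    fun c f => by simp only [mixed, ← Algebra.smul_def, Finset.smul_sum, Derivation.map_smul]
  have h1 : mixed n (zon n 1) = n := by
    have := mixed_pairU_mul n 1
    simpa [mixed, zon, zonal] using this
  have mrec : ∀ i : ℕ, ((i : PairPoly n) + (n : PairPoly n) - 1) * mixed n (zon n (i + 2)) =
      (2 * (i : PairPoly n) + (n : PairPoly n)) * mixed n (pairU n * zon n (i + 1)) -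
        ((i : PairPoly n) + 1) * mixed n (pairR n * pairQ n * zon n i) := by
    intro i
    have hr := congrArg (mixed n) (zonal_rec hn (pairU n) (pairR n * pairQ n) i)
    have e1 : ((i : PairPoly n) + (n : PairPoly n) - 1) = algebraMap ℝ _ ((i : ℝ) + n - 1) := by
      simp only [map_sub, map_add, map_natCast, map_one]
    have e2 : (2 * (i : PairPoly n) + (n : PairPoly n)) = algebraMap ℝ _ (2 * (i : ℝ) + n) := by
      simp only [map_mul, map_add, map_natCast, map_ofNat]
    have e3 : ((i : PairPoly n) + 1) = algebraMap ℝ _ ((i : ℝ) + 1) := by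
      simp only [map_add, map_natCast, map_one]
    rw [madd, mul_assoc, mul_assoc, e1, e2, e3, mC, mC, mC] at hr
    rw [e1, e2, e3]
    exact hr
  have key : ∀ i : ℕ, mixed n (zon n (i + 1)) = (i + 1) * (2 * i + n) * zon n i ∧
      mixed n (zon n (i + 2)) = (i + 2) * (2 * i + 2 + n) * zon n (i + 1) := by
    intro i
    induction i with
    | zero =>
      refine ⟨by rw [zero_add, h1]; simp [zon, zonal], ?_⟩
      apply zonal_cancel hn 0
      rw [mrec, mixed_pairU_mul, mixed_norms_mul, sum_xv_dx_zon n hn, sum_yv_dy_zon n hn, h1]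
      have z1 : zon n 1 = pairU n := rfl
      have z0 : zon n 0 = 1 := rfl
      rw [z0, z1]
      simp [mixed]
      ring
    | succ i ih =>
      refine ⟨by rw [ih.2]; push_cast; ring, ?_⟩
      apply zonal_cancel hn (i + 1)
      rw [mrec, mixed_pairU_mul, mixed_norms_mul, sum_xv_dx_zon n hn, sum_yv_dy_zon n hn,
        sum_yv_dx_zon n hn, sum_xv_dy_zon n hn, ih.1, ih.2]
      have hr0 := zonal_rec hn (pairU n) (pairR n * pairQ n) i
      change _ * zon n (i + 2) = _ * zon n (i + 1) - _ * zon n i at hr0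
      push_cast
      linear_combination (-((i : PairPoly n) + 2) * (2 * i + 4 + n)) * hr0
  exact (key i).1

/-- The zonal harmonic is a sum of products `p(x) p(y)`. -/
theorem exists_features (hn : 2 ≤ n) (i : ℕ) :
    ∃ (N : ℕ) (p : Fin N → MvPolynomial (Fin n) ℝ),
      ∑ k, rename Sum.inl (p k) * rename Sum.inr (p k) = zon n i := by
  suffices H : ∀ i, ∃ (ι : Type) (_ : Fintype ι) (p : ι → MvPolynomial (Fin n) ℝ),
      ∑ k, rename Sum.inl (p k) * rename Sum.inr (p k) = zon n i by
    obtain ⟨ι, _, p, hp⟩ := H i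
    refine ⟨Fintype.card ι, fun k => p ((Fintype.equivFin ι).symm k), ?_⟩
    rw [← hp]
    exact Equiv.sum_comp (Fintype.equivFin ι).symm
      fun k => rename Sum.inl (p k) * rename Sum.inr (p k)
  intro i
  match i with
  | 0 => exact ⟨Unit, inferInstance, fun _ => 1, by simp [zon, zonal]⟩
  | i + 1 =>
    -- The induction starts in degree 1: passing from degree 0 to 1 by the formula below would need
    -- δ = 1 / (n - 2), which is not available for n = 2.
    induction i with
    | zero => exact ⟨Fin n, inferInstance, fun a => X a, by simp [zon, zonal, pairU, xv, yv]⟩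
    | succ i ih =>
      obtain ⟨ι, _, p, hp⟩ := ih
      have h2 : (2 : ℝ) ≤ n := by exact_mod_cast hn
      have hi : (0 : ℝ) ≤ i := i.cast_nonneg
      set δ : ℝ := (2 * (i : ℝ) + n)⁻¹ with hδ
      set c : ℝ := (2 * (i : ℝ) + n) / ((i : ℝ) + n - 1) with hc
      have hc0 : 0 ≤ c := div_nonneg (by linarith) (by linarith)
      have hA : algebraMap ℝ (PairPoly n) δ * (2 * (i : PairPoly n) + n) = 1 := by
        have : (2 * (i : PairPoly n) + n) = algebraMap ℝ _ (2 * (i : ℝ) + n) := by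
          simp only [map_mul, map_add, map_natCast, map_ofNat]
        rw [this, ← map_mul, hδ, inv_mul_cancel₀ (by linarith), map_one]
      have hB : algebraMap ℝ (PairPoly n) c * ((i : PairPoly n) + n - 1)
          = 2 * (i : PairPoly n) + n := by
        have e1 : ((i : PairPoly n) + n - 1) = algebraMap ℝ _ ((i : ℝ) + n - 1) := by
          simp only [map_sub, map_add, map_natCast, map_one]
        have e2 : (2 * (i : PairPoly n) + n) = algebraMap ℝ _ (2 * (i : ℝ) + n) := by
          simp only [map_mul, map_add, map_natCast, map_ofNat]
        rw [e1, e2, ← map_mul, hc, div_mul_cancel₀ _ (by linarith)]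
      -- For harmonic p of degree i + 1, the polynomial x_a p - δ |x|² ∂_a p is the harmonic
      -- projection of x_a p. Summed over p and a, the products of these in x and y reduce to U
      -- times the zonal, one lowering sum of each kind, and the mixed operator, which together form
      -- the recurrence. The factor √c is real because c ≥ 0; this is where positive definiteness
      -- comes from.
      refine ⟨ι × Fin n, inferInstance, fun ka => MvPolynomial.C (Real.sqrt c) *
        (X ka.2 * p ka.1 - MvPolynomial.C δ * (∑ b, X b ^ 2) * pderiv ka.2 (p ka.1)), ?_⟩
      have hF : ∀ k a, rename Sum.inl (pderiv a (p k)) = dx n a (rename Sum.inl (p k)) :=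
        fun k a => (pderiv_rename Sum.inl_injective a (p k)).symm
      have hG : ∀ k a, rename Sum.inr (pderiv a (p k)) = dy n a (rename Sum.inr (p k)) :=
        fun k a => (pderiv_rename Sum.inr_injective a (p k)).symm
      have hF0 : ∀ k a, dy n a (rename Sum.inl (p k)) = 0 := fun k a => by
        refine pderiv_eq_zero_of_notMem_vars fun h => ?_
        classical
        have := vars_rename Sum.inl (p k) h
        simp at this
      have hG0 : ∀ k a, dx n a (rename Sum.inr (p k)) = 0 := fun k a => by
        refine pderiv_eq_zero_of_notMem_vars fun h => ?_
        classical
        have := vars_rename Sum.inr (p k) h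
        simp at this
      have hs : MvPolynomial.C (Real.sqrt c) * MvPolynomial.C (Real.sqrt c)
          = algebraMap ℝ (PairPoly n) c := by
        rw [← MvPolynomial.C_mul, Real.mul_self_sqrt hc0]; rfl
      have hD : MvPolynomial.C δ = algebraMap ℝ (PairPoly n) δ := rfl
      have hterm : ∀ k a, rename Sum.inl (MvPolynomial.C (Real.sqrt c) *
            (X a * p k - MvPolynomial.C δ * (∑ b, X b ^ 2) * pderiv a (p k))) *
          rename Sum.inr (MvPolynomial.C (Real.sqrt c) *
            (X a * p k - MvPolynomial.C δ * (∑ b, X b ^ 2) * pderiv a (p k))) =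
          algebraMap ℝ (PairPoly n) c * (xv n a * yv n a *
              (rename Sum.inl (p k) * rename Sum.inr (p k))
            - algebraMap ℝ _ δ * pairQ n * (xv n a *
              dy n a (rename Sum.inl (p k) * rename Sum.inr (p k)))
            - algebraMap ℝ _ δ * pairR n * (yv n a *
              dx n a (rename Sum.inl (p k) * rename Sum.inr (p k)))
            + algebraMap ℝ _ δ ^ 2 * (pairR n * pairQ n) *
              dx n a (dy n a (rename Sum.inl (p k) * rename Sum.inr (p k)))) := by
        intro k a
        have hdd : dx n a (dy n a (rename Sum.inr (p k))) = 0 := by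
          rw [← hG]
          refine pderiv_eq_zero_of_notMem_vars fun h => ?_
          classical
          have := vars_rename Sum.inr _ h
          simp at this
        simp only [map_mul, map_sub, rename_C, rename_X, map_sum, map_pow, hF, hG]
        simp only [Derivation.leibniz, smul_eq_mul, hF0, hG0, mul_zero, add_zero,
          zero_add, hdd]
        rw [← hs, ← hD]
        simp only [pairR, pairQ, xv, yv]
        ring
      rw [Fintype.sum_prod_type, Finset.sum_comm]
      simp only [hterm]
      simp only [← Finset.mul_sum, Finset.sum_add_distrib, Finset.sum_sub_distrib, ← map_sum, hp]
      rw [sum_xv_dy_zon n hn, sum_yv_dx_zon n hn]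
      have hm := mixed_zon n hn i
      rw [mixed] at hm
      rw [hm, ← Finset.sum_mul]
      change algebraMap ℝ (PairPoly n) c * (pairU n * zon n (i + 1) - _ - _ + _) = _
      have hr := zonal_rec hn (pairU n) (pairR n * pairQ n) i
      change _ * zon n (i + 2) = _ * zon n (i + 1) - _ * zon n i at hr
      apply zonal_cancel hn i
      set d := algebraMap ℝ (PairPoly n) δ
      linear_combination (pairU n * zon n (i + 1) - d * ((i : PairPoly n) + 1)
        * (pairR n * pairQ n) * zon n i) * hB - hr +
        (algebraMap ℝ (PairPoly n) c * ((i : PairPoly n) + n - 1) * d * (i + 1)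
        * (pairR n * pairQ n) * zon n i) * hA - ((i : PairPoly n) + 1)
        * (pairR n * pairQ n) * zon n i * hA

/-- The Gegenbauer kernel on the unit sphere is a finite sum of products `φ(x) φ(y)`. -/
theorem exists_gegenbauer_features {n : ℕ} (hn : 2 ≤ n) (i : ℕ) :
    ∃ (N : ℕ) (φ : Fin N → EuclideanSpace ℝ (Fin n) → ℝ),
      ∀ x y : EuclideanSpace ℝ (Fin n), ‖x‖ = 1 → ‖y‖ = 1 →
        (gegenbauer n i).eval (inner ℝ x y) = ∑ k, φ k x * φ k y := by
  obtain ⟨N, p, hp⟩ := exists_features n hn i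
  refine ⟨N, fun k x => MvPolynomial.aeval x.ofLp (p k), fun x y hx hy => ?_⟩
  have h := congrArg (MvPolynomial.aeval (Sum.elim x.ofLp y.ofLp)) hp
  rw [zon, map_zonal] at h
  have hU : MvPolynomial.aeval (Sum.elim x.ofLp y.ofLp) (pairU n) = inner ℝ x y := by
    simp [pairU, xv, yv, PiLp.inner_apply, mul_comm]
  have hsq : ∀ z : EuclideanSpace ℝ (Fin n), ‖z‖ = 1 → ∑ a, z a ^ 2 = 1 := fun z hz => by
    rw [← EuclideanSpace.real_norm_sq_eq, hz, one_pow]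
  have hw : MvPolynomial.aeval (Sum.elim x.ofLp y.ofLp) (pairR n * pairQ n) = (1 : ℝ) := by
    simp [pairR, pairQ, xv, yv, hsq x hx, hsq y hy]
  rw [hU, hw, zonal_real] at h
  rw [← h, map_sum]
  refine Finset.sum_congr rfl fun k _ => ?_
  rw [map_mul, MvPolynomial.aeval_rename, MvPolynomial.aeval_rename, Sum.elim_comp_inl,
    Sum.elim_comp_inr]

/-- With feature maps φ_k, the moment is ∑_k (∑_y φ_k(y))², and the row of x is ∑_k φ_k(x) ∑_y
φ_k(y). If the moment is zero, every inner sum is zero, and so is every row. -/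
theorem moment_eq_sum_sq {n : ℕ} (hn : 2 ≤ n) (i : ℕ) (K : Finset (EuclideanSpace ℝ (Fin n)))
    (hK : ∀ x ∈ K, ‖x‖ = 1) :
    0 ≤ moment i K ∧ (moment i K = 0 ↔
      ∀ x ∈ K, ∑ y ∈ K, (gegenbauer n i).eval (inner ℝ x y) = 0) := by
  obtain ⟨N, φ, hφ⟩ := exists_gegenbauer_features hn i
  have hrow : ∀ x ∈ K, ∑ y ∈ K, (gegenbauer n i).eval (inner ℝ x y) =
      ∑ k, φ k x * ∑ y ∈ K, φ k y := by
    intro x hx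
    simp_rw [Finset.mul_sum]
    rw [Finset.sum_comm]
    exact Finset.sum_congr rfl fun y hy => hφ x y (hK x hx) (hK y hy)
  have hm : moment i K = ∑ k, (∑ y ∈ K, φ k y) ^ 2 := by
    rw [moment, Finset.sum_congr rfl hrow, Finset.sum_comm]
    exact Finset.sum_congr rfl fun k _ => by rw [← Finset.sum_mul, sq]
  refine ⟨hm ▸ Finset.sum_nonneg fun k _ => sq_nonneg _, fun h0 x hx => ?_, fun h0 => ?_⟩
  · rw [hm, Finset.sum_eq_zero_iff_of_nonneg fun k _ => sq_nonneg _] at h0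
    rw [hrow x hx]
    refine Finset.sum_eq_zero fun k hk => ?_
    rw [pow_eq_zero_iff two_ne_zero |>.1 (h0 k hk), mul_zero]
  · rw [moment]; exact Finset.sum_eq_zero h0

end Features

end

end SphericalCodes

namespace SphericalCodes

open Polynomial

noncomputable section

/-! ## The mean value functional -/

theorem weight_exponent_gt {n : ℕ} (hn : 2 ≤ n) : (-1 : ℝ) < ((n : ℝ) - 3) / 2 := by
  have h2 : (2 : ℝ) ≤ n := by exact_mod_cast hn
  linarith

theorem weight_eq_mul (n : ℕ) {t : ℝ} (ht : t ∈ Set.Icc (-1 : ℝ) 1) :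
    weight n t = (1 + t) ^ (((n : ℝ) - 3) / 2) * (1 - t) ^ (((n : ℝ) - 3) / 2) := by
  rw [weight, ← Real.mul_rpow (by linarith [ht.1]) (by linarith [ht.2])]
  congr 1; ring

/-- For n = 2 the weight is unbounded at both endpoints. Splitting at 0 leaves one singular power on
each half, integrable because its exponent exceeds -1. -/
theorem intervalIntegrable_weight {n : ℕ} (hn : 2 ≤ n) :
    IntervalIntegrable (weight n) MeasureTheory.volume (-1) 1 := by
  have he := weight_exponent_gt hn
  set e := ((n : ℝ) - 3) / 2 with hedef
  have h1 : IntervalIntegrable (fun t : ℝ => (1 + t) ^ e * (1 - t) ^ e)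
      MeasureTheory.volume (-1) 0 := by
    refine IntervalIntegrable.mul_continuousOn ?_ ?_
    · have := (intervalIntegral.intervalIntegrable_rpow' (a := 0) (b := 1) he).comp_add_left 1
      simpa using this
    · refine ContinuousOn.rpow_const (by fun_prop) fun t ht => Or.inl ?_
      rw [Set.uIcc_of_le (by norm_num)] at ht
      linarith [ht.2]
  have h2 : IntervalIntegrable (fun t : ℝ => (1 + t) ^ e * (1 - t) ^ e)
      MeasureTheory.volume 0 1 := by
    refine IntervalIntegrable.continuousOn_mul ?_ ?_
    · have := (intervalIntegral.intervalIntegrable_rpow' (a := 1) (b := 0) he).comp_sub_left 1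
      simpa using this
    · refine ContinuousOn.rpow_const (by fun_prop) fun t ht => Or.inl ?_
      rw [Set.uIcc_of_le (by norm_num)] at ht
      linarith [ht.1]
  refine (h1.trans h2).congr fun t ht => ?_
  rw [Set.uIoc_of_le (by norm_num)] at ht
  exact (weight_eq_mul n ⟨ht.1.le, ht.2⟩).symm

theorem intervalIntegrable_eval_mul_weight {n : ℕ} (hn : 2 ≤ n) (f : ℝ[X]) :
    IntervalIntegrable (fun t => f.eval t * weight n t) MeasureTheory.volume (-1) 1 :=
  (intervalIntegrable_weight hn).continuousOn_mul f.continuous.continuousOn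

theorem weight_pos {n : ℕ} {t : ℝ} (ht : t ∈ Set.Ioo (-1 : ℝ) 1) : 0 < weight n t :=
  Real.rpow_pos_of_pos (by nlinarith [ht.1, ht.2]) _

theorem integral_eval_mul_weight_pos {n : ℕ} (hn : 2 ≤ n) {f : ℝ[X]} (hf : f ≠ 0)
    (h0 : ∀ t ∈ Set.Icc (-1 : ℝ) 1, 0 ≤ f.eval t) :
    0 < ∫ t in (-1 : ℝ)..1, f.eval t * weight n t := by
  rw [intervalIntegral.integral_pos_iff_support_of_nonneg_ae' ?_
    (intervalIntegrable_eval_mul_weight hn f)]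
  · refine ⟨by norm_num, ?_⟩
    have hsub : Set.Ioo (-1 : ℝ) 1 \ (f.roots.toFinset : Set ℝ) ⊆
        Function.support (fun t => f.eval t * weight n t) ∩ Set.Ioc (-1) 1 := by
      rintro t ⟨ht, hr⟩
      refine ⟨mul_ne_zero (fun h => hr ?_) (weight_pos ht).ne', ht.1, ht.2.le⟩
      simp [hf, h]
    refine lt_of_lt_of_le ?_ (MeasureTheory.measure_mono hsub)
    rw [MeasureTheory.measure_sdiff_null (Finset.measure_zero _ _), Real.volume_Ioo]
    norm_num
  · rw [Set.uIoc_of_le (by norm_num), Filter.EventuallyLE,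
      MeasureTheory.ae_restrict_iff' measurableSet_Ioc]
    refine Filter.Eventually.of_forall fun t ht => ?_
    refine mul_nonneg (h0 t ⟨ht.1.le, ht.2⟩) (Real.rpow_nonneg ?_ _)
    nlinarith [ht.1, ht.2]

theorem integral_weight_pos {n : ℕ} (hn : 2 ≤ n) : 0 < ∫ t in (-1 : ℝ)..1, weight n t := by
  have := integral_eval_mul_weight_pos hn (f := 1) one_ne_zero (fun t _ => by simp)
  simpa using this

/-- The integral `∫ f(t) (1 - t^2)^{(n-3)/2} dt` as a linear functional of `f`, for `n ≥ 2`. -/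
def weightIntegral {n : ℕ} (hn : 2 ≤ n) : ℝ[X] →ₗ[ℝ] ℝ where
  toFun f := ∫ t in (-1 : ℝ)..1, f.eval t * weight n t
  map_add' f g := by
    simp only [eval_add, add_mul]
    exact intervalIntegral.integral_add (intervalIntegrable_eval_mul_weight hn f)
      (intervalIntegrable_eval_mul_weight hn g)
  map_smul' c f := by
    simp only [eval_smul, smul_eq_mul, mul_assoc, RingHom.id_apply]
    exact intervalIntegral.integral_const_mul _ _

/-- The mean value `f_0` of `f`. -/
def mean {n : ℕ} (hn : 2 ≤ n) : ℝ[X] →ₗ[ℝ] ℝ :=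
  (∫ t in (-1 : ℝ)..1, weight n t)⁻¹ • weightIntegral hn

theorem mean_apply {n : ℕ} (hn : 2 ≤ n) (f : ℝ[X]) :
    mean hn f = (∫ t in (-1 : ℝ)..1, weight n t)⁻¹ * ∫ t in (-1 : ℝ)..1, f.eval t * weight n t :=
  rfl

/-- A functional that is positive on nonzero polynomials nonnegative on `[-1,1]`. -/
def StrictlyPositive (μ : ℝ[X] →ₗ[ℝ] ℝ) : Prop :=
  ∀ f : ℝ[X], f ≠ 0 → (∀ t ∈ Set.Icc (-1 : ℝ) 1, 0 ≤ f.eval t) → 0 < μ f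

theorem mean_strictlyPositive {n : ℕ} (hn : 2 ≤ n) : StrictlyPositive (mean hn) :=
  fun _ hf h0 => mul_pos (inv_pos.2 (integral_weight_pos hn)) (integral_eval_mul_weight_pos hn hf h0)

theorem mean_one {n : ℕ} (hn : 2 ≤ n) : mean hn 1 = 1 := by
  rw [mean_apply]
  simp only [eval_one, one_mul]
  exact inv_mul_cancel₀ (integral_weight_pos hn).ne'

theorem gegenbauerCoeff_eq {n : ℕ} (hn : 2 ≤ n) (i : ℕ) (f : ℝ[X]) :
    gegenbauerCoeff n i f = mean hn (f * gegenbauer n i) / mean hn (gegenbauer n i ^ 2) := by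
  rw [mean_apply, mean_apply, mul_div_mul_left _ _ (inv_ne_zero (integral_weight_pos hn).ne')]
  simp only [gegenbauerCoeff, eval_mul, eval_pow]

theorem gegenbauerCoeff_zero {n : ℕ} (hn : 2 ≤ n) (f : ℝ[X]) :
    gegenbauerCoeff n 0 f = mean hn f := by
  rw [gegenbauerCoeff_eq hn]
  simp [gegenbauer, mean_one hn]

/-- Integration by parts against the weight. -/
theorem mean_derivative_identity {n : ℕ} (hn : 2 ≤ n) (f : ℝ[X]) :
    mean hn ((1 - X ^ 2) * derivative f) = ((n : ℝ) - 1) * mean hn (X * f) := by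
  have h2 : (2 : ℝ) ≤ n := by exact_mod_cast hn
  have h : mean hn ((1 - X ^ 2) * derivative f - C ((n : ℝ) - 1) * (X * f)) = 0 := by
    rw [mean_apply]
    have hI := intervalIntegrable_eval_mul_weight hn
      ((1 - X ^ 2) * derivative f - C ((n : ℝ) - 1) * (X * f))
    have := intervalIntegral.integral_eq_sub_of_hasDerivAt_of_le (a := -1) (b := 1)
      (f := fun t : ℝ => (1 - t ^ 2) ^ (((n : ℝ) - 1) / 2) * f.eval t) (by norm_num) ?_ ?_ hI
    · rw [this]
      -- The boundary terms vanish because the exponent of 1 - t² in the primitive is nonzero.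
      have e0 : ((n : ℝ) - 1) / 2 ≠ 0 := by
        have : 0 < ((n : ℝ) - 1) / 2 := by linarith
        exact this.ne'
      simp [Real.zero_rpow e0]
    · refine ContinuousOn.mul (ContinuousOn.rpow_const (by fun_prop) fun t _ => Or.inr ?_)
        f.continuous.continuousOn
      linarith
    · intro t ht
      have hpos : 0 < 1 - t ^ 2 := by nlinarith [ht.1, ht.2]
      have h1 : HasDerivAt (fun t : ℝ => 1 - t ^ 2) (-(2 * t)) t := by
        simpa using (hasDerivAt_pow 2 t).const_sub 1
      have h3 := (h1.rpow_const (p := ((n : ℝ) - 1) / 2) (Or.inl hpos.ne')).mul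
        (f.hasDerivAt t)
      refine HasDerivAt.congr_deriv h3 ?_
      have ew : weight n t = (1 - t ^ 2) ^ (((n : ℝ) - 1) / 2 - 1) := by
        rw [weight]; congr 1; ring
      have ep : (1 - t ^ 2) ^ (((n : ℝ) - 1) / 2) =
          (1 - t ^ 2) * (1 - t ^ 2) ^ (((n : ℝ) - 1) / 2 - 1) := by
        rw [← Real.rpow_one_add' hpos.le (by intro h; linarith)]; congr 1; ring
      rw [ew, ep]
      simp only [eval_sub, eval_mul, eval_one, eval_pow, eval_X, eval_C]
      ring
  rw [map_sub, ← smul_eq_C_mul, map_smul, smul_eq_mul, sub_eq_zero] at h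
  exact h

theorem mean_C_mul {n : ℕ} (hn : 2 ≤ n) (c : ℝ) (f : ℝ[X]) :
    mean hn (C c * f) = c * mean hn f := by
  rw [← smul_eq_C_mul, map_smul, smul_eq_mul]

theorem mean_X {n : ℕ} (hn : 2 ≤ n) : mean hn X = 0 := by
  have h2 : (2 : ℝ) ≤ n := by exact_mod_cast hn
  have h := mean_derivative_identity hn 1
  simp only [derivative_one, mul_zero, map_zero, mul_one] at h
  rcases mul_eq_zero.1 h.symm with h | h
  · linarith
  · exact h

/-- Orthogonality follows from integration by parts and the structure relations, by induction on i
and then on d. The identity for P_i handles d = 0, and that for P_{i+1} t^d raises the exponent to d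
+ 1. -/
theorem mean_gegenbauer_mul_X_pow {n : ℕ} (hn : 2 ≤ n) (i : ℕ) :
    ∀ d < i, mean hn (gegenbauer n i * X ^ d) = 0 := by
  have h2 : (2 : ℝ) ≤ n := by exact_mod_cast hn
  induction i with
  | zero => intro d hd; omega
  | succ i ih =>
    intro d
    induction d using Nat.strong_induction_on with
    | _ d ihd =>
    intro hd
    have hi : (0 : ℝ) ≤ i := i.cast_nonneg
    rcases d with _ | d
    · have h := mean_derivative_identity hn (gegenbauer n i)
      rw [one_sub_sq_mul_derivative hn,
        show ((i : ℝ[X]) + (n : ℝ[X]) - 2) = C ((i : ℝ) + n - 2) by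
          simp only [map_sub, map_add, map_natCast, map_ofNat], mean_C_mul, map_sub] at h
      rw [pow_zero, mul_one]
      rcases i with _ | _ | i
      · simpa [gegenbauer] using mean_X hn
      -- For P_2 the term (t P_1)_0 = (t²)_0 is not zero; it cancels because it has the coefficient
      -- n - 1 on both sides.
      · push_cast at h
        have : mean hn (gegenbauer n (0 + 1 + 1)) * ((n : ℝ) - 1) = 0 := by
          simp only [Nat.zero_add] at h ⊢
          linarith
        rcases mul_eq_zero.1 this with h | h
        · exact h
        · linarith
      · have h1 : mean hn (X * gegenbauer n (i + 1 + 1)) = 0 := by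
          have := ih 1 (by omega)
          rwa [pow_one, mul_comm] at this
        rw [h1] at h
        push_cast at h hi
        have h3 : mean hn (gegenbauer n (i + 1 + 1 + 1)) * ((i : ℝ) + n) = 0 := by linarith
        rcases mul_eq_zero.1 h3 with h | h
        · exact h
        · linarith
    · have h := mean_derivative_identity hn (gegenbauer n (i + 1) * X ^ d)
      have e1 : (1 - X ^ 2) * derivative (gegenbauer n (i + 1) * X ^ d) =
          C ((i : ℝ) + 1) * (gegenbauer n i * X ^ d)
            - C ((i : ℝ) + 1) * (gegenbauer n (i + 1) * X ^ (d + 1))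
            + C (d : ℝ) * (gegenbauer n (i + 1) * X ^ (d - 1))
            - C (d : ℝ) * (gegenbauer n (i + 1) * X ^ (d + 1)) := by
        have hder := one_sub_sq_mul_derivative_succ hn i
        rw [derivative_mul, derivative_X_pow]
        simp only [map_add, map_natCast, map_one]
        rcases d with _ | d
        · simp; linear_combination hder
        · simp only [Nat.add_sub_cancel]
          push_cast
          linear_combination X ^ (d + 1) * hder
      have e2 : X * (gegenbauer n (i + 1) * X ^ d) = gegenbauer n (i + 1) * X ^ (d + 1) := by ring
      rw [e1, e2] at h
      rw [map_sub, map_add, map_sub, mean_C_mul, mean_C_mul, mean_C_mul, mean_C_mul,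
        ih d (by omega)] at h
      have h3 : (d : ℝ) * mean hn (gegenbauer n (i + 1) * X ^ (d - 1)) = 0 := by
        rcases d with _ | d
        · simp
        · rw [Nat.add_sub_cancel, ihd d (by omega) (by omega), mul_zero]
      rw [h3] at h
      have h4 : mean hn (gegenbauer n (i + 1) * X ^ (d + 1)) * ((i : ℝ) + d + n) = 0 := by
        linarith
      have hd0 : (0 : ℝ) ≤ d := d.cast_nonneg
      rcases mul_eq_zero.1 h4 with h | h
      · exact h
      · linarith

/-- If `μ (p t^d) = 0` for all `d < r`, then `μ (p q) = 0` whenever `deg q < r`. -/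
theorem functional_mul_eq_zero {μ : ℝ[X] →ₗ[ℝ] ℝ} {p : ℝ[X]} {r : ℕ}
    (h : ∀ d < r, μ (p * X ^ d) = 0) {q : ℝ[X]} (hq : q.degree < r) : μ (p * q) = 0 := by
  by_cases h0 : q = 0
  · rw [h0, mul_zero, map_zero]
  rw [q.as_sum_range_C_mul_X_pow' (n := r) ((natDegree_lt_iff_degree_lt h0).2 hq),
    Finset.mul_sum, map_sum]
  refine Finset.sum_eq_zero fun d hd => ?_
  rw [← mul_assoc, mul_comm p, mul_assoc, ← smul_eq_C_mul, map_smul,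
    h d (Finset.mem_range.1 hd), smul_zero]

theorem mean_gegenbauer_mul {n : ℕ} (hn : 2 ≤ n) {i : ℕ} {q : ℝ[X]} (hq : q.degree < i) :
    mean hn (gegenbauer n i * q) = 0 :=
  functional_mul_eq_zero (mean_gegenbauer_mul_X_pow hn i) hq

theorem StrictlyPositive.sq {μ : ℝ[X] →ₗ[ℝ] ℝ} (hμ : StrictlyPositive μ) {f : ℝ[X]}
    (hf : f ≠ 0) : 0 < μ (f ^ 2) :=
  hμ _ (pow_ne_zero 2 hf) fun t _ => by rw [eval_pow]; exact sq_nonneg _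

theorem mean_gegenbauer_sq_pos {n : ℕ} (hn : 2 ≤ n) (i : ℕ) :
    0 < mean hn (gegenbauer n i ^ 2) :=
  (mean_strictlyPositive hn).sq (gegenbauer_ne_zero hn i)

theorem degree_sub_C_mul_lt {p q : ℝ[X]} {d : ℕ} (hq : HasPosLead q d) (hp : p.natDegree ≤ d) :
    (p - C (p.coeff d / q.coeff d) * q).degree < d := by
  rw [degree_lt_iff_coeff_zero]
  intro m hm
  rw [coeff_sub, coeff_C_mul]
  rcases hm.eq_or_lt with rfl | h
  · rw [div_mul_cancel₀ _ hq.2.ne', sub_self]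
  · rw [coeff_eq_zero_of_natDegree_lt (lt_of_le_of_lt hp h),
      coeff_eq_zero_of_natDegree_lt (lt_of_le_of_lt hq.1 h), mul_zero, sub_zero]

theorem exists_eq_sum_of_hasPosLead {O : ℕ → ℝ[X]} (hO : ∀ j, HasPosLead (O j) j) (N : ℕ) :
    ∀ f : ℝ[X], f.degree < N → ∃ c : ℕ → ℝ, f = ∑ i ∈ Finset.range N, C (c i) * O i := by
  induction N with
  | zero =>
    intro f hf
    exact ⟨fun _ => 0, by
      have : f = 0 := by simpa [degree_lt_iff_coeff_zero, Polynomial.ext_iff] using hf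
      simp [this]⟩
  | succ N ih =>
    intro f hf
    have hf' : f.natDegree ≤ N := by
      rw [natDegree_le_iff_degree_le]
      exact Order.lt_succ_iff.1 hf
    obtain ⟨d, hd⟩ := ih _ (degree_sub_C_mul_lt (hO N) hf')
    refine ⟨fun i => if i = N then f.coeff N / (O N).coeff N else d i, ?_⟩
    rw [Finset.sum_range_succ]
    dsimp only
    rw [if_pos rfl, Finset.sum_congr rfl (g := fun i => C (d i) * O i), ← hd, sub_add_cancel]
    intro i hi
    rw [if_neg (Finset.mem_range.1 hi).ne]

theorem functional_C_mul (μ : ℝ[X] →ₗ[ℝ] ℝ) (c : ℝ) (f : ℝ[X]) : μ (C c * f) = c * μ f := by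
  rw [← smul_eq_C_mul, map_smul, smul_eq_mul]

section Orthogonal

variable {μ : ℝ[X] →ₗ[ℝ] ℝ} {O : ℕ → ℝ[X]}

theorem HasPosLead.degree_eq {p : ℝ[X]} {d : ℕ} (h : HasPosLead p d) : p.degree = d := by
  rw [degree_eq_natDegree h.ne_zero, h.natDegree_eq]

theorem orthogonal_family (hO : ∀ j, HasPosLead (O j) j) (ho : ∀ j, ∀ d < j, μ (O j * X ^ d) = 0)
    {i j : ℕ} (h : i ≠ j) : μ (O i * O j) = 0 := by
  rcases lt_or_gt_of_ne h with h | h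
  · rw [mul_comm]
    exact functional_mul_eq_zero (ho j) (by rw [(hO i).degree_eq]; exact_mod_cast h)
  · exact functional_mul_eq_zero (ho i) (by rw [(hO j).degree_eq]; exact_mod_cast h)

/-- The expansion of a polynomial in a system of orthogonal polynomials. -/
theorem StrictlyPositive.eq_sum (hμ : StrictlyPositive μ) (hO : ∀ j, HasPosLead (O j) j)
    (ho : ∀ j, ∀ d < j, μ (O j * X ^ d) = 0) {N : ℕ} {f : ℝ[X]} (hf : f.degree < N) :
    f = ∑ i ∈ Finset.range N, C (μ (f * O i) / μ (O i ^ 2)) * O i := by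
  obtain ⟨c, hc⟩ := exists_eq_sum_of_hasPosLead hO N f hf
  have hcoef : ∀ j ∈ Finset.range N, μ (f * O j) / μ (O j ^ 2) = c j := by
    intro j hj
    rw [hc, Finset.sum_mul, map_sum, Finset.sum_eq_single_of_mem j hj]
    · rw [mul_assoc, functional_C_mul, ← pow_two, mul_div_cancel_right₀ _ (hμ.sq (hO j).ne_zero).ne']
    · intro i _ hij
      rw [mul_assoc, functional_C_mul, orthogonal_family hO ho hij, mul_zero]
  calc f = _ := hc
    _ = _ := Finset.sum_congr rfl fun j hj => by rw [hcoef j hj]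

/-- Subtracting from p the multiple of q with the same leading term leaves a lower degree,
orthogonal to q; what remains is a positive multiple of μ(q²). -/
theorem StrictlyPositive.mul_pos_of_hasPosLead (hμ : StrictlyPositive μ) {p q : ℝ[X]} {d : ℕ}
    (hp : HasPosLead p d) (hq : HasPosLead q d) (hqo : ∀ j < d, μ (q * X ^ j) = 0) :
    0 < μ (p * q) := by
  have h1 := functional_mul_eq_zero hqo (degree_sub_C_mul_lt hq hp.1)
  have e : p * q = q * (p - C (p.coeff d / q.coeff d) * q)
      + C (p.coeff d / q.coeff d) * q ^ 2 := by ring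
  rw [e, map_add, h1, zero_add, functional_C_mul]
  exact mul_pos (div_pos hp.2 hq.2) (hμ.sq hq.ne_zero)

end Orthogonal

theorem mean_gegenbauer_mul_gegenbauer {n : ℕ} (hn : 2 ≤ n) {i j : ℕ} (h : i ≠ j) :
    mean hn (gegenbauer n i * gegenbauer n j) = 0 :=
  orthogonal_family (gegenbauer_hasPosLead hn) (mean_gegenbauer_mul_X_pow hn) h

/-- The Gegenbauer expansion of a polynomial. -/
theorem eq_sum_gegenbauerCoeff {n : ℕ} (hn : 2 ≤ n) {N : ℕ} {f : ℝ[X]} (hf : f.natDegree < N) :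
    f = ∑ i ∈ Finset.range N, C (gegenbauerCoeff n i f) * gegenbauer n i := by
  simp only [gegenbauerCoeff_eq hn]
  exact (mean_strictlyPositive hn).eq_sum (gegenbauer_hasPosLead hn) (mean_gegenbauer_mul_X_pow hn)
    (lt_of_le_of_lt degree_le_natDegree (by exact_mod_cast hf))

end

end SphericalCodes

namespace SphericalCodes

open Polynomial

noncomputable section

/-! ## Nonnegative linearization -/

/-- The coefficient `B_m` in `t P_m = A_m P_{m+1} + B_m P_{m-1}`; `A_m = 1 - B_m`. -/
def recB (n m : ℕ) : ℝ := m / (2 * m + n - 2)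

theorem recB_zero (n : ℕ) : recB n 0 = 0 := by simp [recB]

theorem recB_succ_pos {n : ℕ} (hn : 2 ≤ n) (m : ℕ) : 0 < recB n (m + 1) := by
  have h2 : (2 : ℝ) ≤ n := by exact_mod_cast hn
  unfold recB
  push_cast
  have : (0 : ℝ) ≤ m := m.cast_nonneg
  exact div_pos (by linarith) (by linarith)

theorem recB_le_half {n : ℕ} (hn : 2 ≤ n) (m : ℕ) : recB n m ≤ 1 / 2 := by
  rcases m with _ | m
  · rw [recB_zero]; norm_num
  · have h2 : (2 : ℝ) ≤ n := by exact_mod_cast hn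
    unfold recB
    push_cast
    have : (0 : ℝ) ≤ m := m.cast_nonneg
    rw [div_le_div_iff₀ (by linarith) (by norm_num)]
    linarith

theorem recB_mono {n : ℕ} (hn : 2 ≤ n) : Monotone (recB n) := by
  refine monotone_nat_of_le_succ fun m => ?_
  rcases m with _ | m
  · rw [recB_zero]; exact (recB_succ_pos hn 0).le
  · have h2 : (2 : ℝ) ≤ n := by exact_mod_cast hn
    unfold recB
    push_cast
    have : (0 : ℝ) ≤ m := m.cast_nonneg
    rw [div_le_div_iff₀ (by linarith) (by linarith)]
    nlinarith

theorem X_mul_gegenbauer_succ {n : ℕ} (hn : 2 ≤ n) (m : ℕ) :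
    X * gegenbauer n (m + 1) =
      C (1 - recB n (m + 1)) * gegenbauer n (m + 2) + C (recB n (m + 1)) * gegenbauer n m := by
  have h2 : (2 : ℝ) ≤ n := by exact_mod_cast hn
  have h0 : (0 : ℝ) ≤ m := m.cast_nonneg
  have hr := gegenbauer_rec hn m
  have hc : C (recB n (m + 1)) * (2 * (m : ℝ[X]) + n) = (m : ℝ[X]) + 1 := by
    have e : (2 * (m : ℝ[X]) + n) = C (2 * (m : ℝ) + n) := by
      simp only [map_add, map_mul, map_natCast, map_ofNat]
    have e2 : ((m : ℝ[X]) + 1) = C ((m : ℝ) + 1) := by simp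
    rw [e, e2, ← C_mul, recB]
    push_cast
    rw [show 2 * ((m : ℝ) + 1) + n - 2 = 2 * m + n by ring, div_mul_cancel₀ _ (by linarith)]
  have hne : (2 * (m : ℝ[X]) + n) ≠ 0 := by
    have e : (2 * (m : ℝ[X]) + n) = C (2 * (m : ℝ) + n) := by
      simp only [map_add, map_mul, map_natCast, map_ofNat]
    rw [e, Ne, C_eq_zero]; intro h; linarith
  apply mul_left_cancel₀ hne
  simp only [map_sub, map_one]
  linear_combination -hr + (gegenbauer n (m + 2) - gegenbauer n m) * hc

/-- Normalizing factors that turn the three-term recurrence into its dual form. -/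
def dualNorm (n : ℕ) : ℕ → ℝ
  | 0 => 1
  | j + 1 => dualNorm n j * (1 - recB n j) / recB n (j + 1)

theorem dualNorm_pos {n : ℕ} (hn : 2 ≤ n) (j : ℕ) : 0 < dualNorm n j := by
  induction j with
  | zero => exact one_pos
  | succ j ih =>
    have := recB_le_half hn j
    exact div_pos (mul_pos ih (by linarith)) (recB_succ_pos hn j)

theorem recB_mul_dualNorm {n : ℕ} (hn : 2 ≤ n) (j : ℕ) :
    recB n (j + 1) * dualNorm n (j + 1) = dualNorm n j * (1 - recB n j) := by
  rw [dualNorm, mul_div_cancel₀ _ (recB_succ_pos hn j).ne']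

/-- The coefficient of the lower term in the dual recurrence. -/
def dualA (n : ℕ) : ℕ → ℝ
  | 0 => 0
  | j + 1 => 1 - recB n j

/-- A discrete maximum principle for the hyperbolic equation satisfied by
`u m j = F (P_m * π_j P_j)`. -/
theorem hyperbolic_nonneg {n : ℕ} (hn : 2 ≤ n) (u : ℕ → ℕ → ℝ)
    (hrec : ∀ m j, recB n (j + 1) * u (m + 1) (j + 1) =
      (1 - recB n (m + 1)) * u (m + 2) j + recB n (m + 1) * u m j - dualA n j * u (m + 1) (j - 1))
    (h0 : ∀ m, 0 ≤ u m 0) : ∀ j m, j ≤ m → 0 ≤ u m j := by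
  -- T combines the values of u on rows j and j - 1 along a zigzag. For L = 0 it is just B_j u(a,
  -- j), so proving T ≥ 0 together with u ≥ 0 gives an induction hypothesis strong enough to absorb
  -- the negative term of the recurrence.
  set T : ℕ → ℕ → ℕ → ℝ := fun j a L =>
    ∑ i ∈ Finset.range (L + 1), recB n j * u (a + 2 * i) j
      - ∑ i ∈ Finset.range L, dualA n j * u (a + 2 * i + 1) (j - 1) with hT
  suffices H : ∀ j, (∀ m, j ≤ m → 0 ≤ u m j) ∧ ∀ a L, j ≤ a → 0 ≤ T j a L from fun j => (H j).1
  intro j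
  induction j with
  | zero => exact ⟨fun m _ => h0 m, fun a L _ => by simp [hT, recB_zero, dualA]⟩
  | succ j ih =>
    obtain ⟨ihu, ihT⟩ := ih
    -- Summing the recurrence compares the zigzag on row j + 1 with the one on row j. The surplus
    -- terms have coefficients B_{m'} - B_m with m ≤ m', nonnegative because B is monotone. The
    -- displayed end term is nonnegative because B ≤ 1/2.
    have step : ∀ a L, j ≤ a → T j a (L + 1) +
        (1 - recB n (a + 1 + 2 * L) - recB n j) * u (a + 2 * L + 2) j ≤ T (j + 1) (a + 1) L := by
      intro a L ha
      induction L with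
      | zero =>
        have hB : recB n j ≤ recB n (a + 1) := recB_mono hn (by omega)
        have hu := ihu a ha
        simp only [hT, Finset.sum_range_succ, Finset.sum_range_zero, mul_zero, add_zero, zero_add,
          hrec a j, sub_zero, mul_one]
        nlinarith
      | succ L ihL =>
        have hB : recB n (a + 1 + 2 * L) ≤ recB n (a + 1 + 2 * L + 2) := recB_mono hn (by omega)
        have hu := ihu (a + 2 * L + 2) (by omega)
        have e1 : T j a (L + 1 + 1) = T j a (L + 1) + recB n j * u (a + 2 * L + 4) j
            - dualA n j * u (a + 2 * L + 3) (j - 1) := by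
          simp only [hT, Finset.sum_range_succ _ (L + 1 + 1), Finset.sum_range_succ _ (L + 1)]
          rw [show a + 2 * (L + 1 + 1) = a + 2 * L + 4 by ring,
            show a + 2 * (L + 1) + 1 = a + 2 * L + 3 by ring]
          ring
        have e2 : T (j + 1) (a + 1) (L + 1) = T (j + 1) (a + 1) L
            + recB n (j + 1) * u (a + 2 * L + 3) (j + 1) - (1 - recB n j) * u (a + 2 * L + 2) j := by
          simp only [hT, Finset.sum_range_succ _ (L + 1), Finset.sum_range_succ _ L, dualA,
            Nat.add_sub_cancel]
          rw [show a + 1 + 2 * (L + 1) = a + 2 * L + 3 by ring,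
            show a + 1 + 2 * L + 1 = a + 2 * L + 2 by ring]
          ring
        have hr := hrec (a + 2 * L + 2) j
        rw [e1, e2, hr]
        rw [show a + 1 + 2 * (L + 1) = a + 1 + 2 * L + 2 by ring,
          show a + 2 * (L + 1) + 2 = a + 2 * L + 4 by ring,
          show a + 2 * L + 2 + 2 = a + 2 * L + 4 by ring,
          show a + 2 * L + 2 + 1 = a + 2 * L + 3 by ring]
        rw [show a + 1 + 2 * L + 2 = a + 2 * L + 3 by ring] at hB ⊢
        nlinarith
    have hTn : ∀ a L, j + 1 ≤ a → 0 ≤ T (j + 1) a L := by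
      intro a L ha
      obtain ⟨a, rfl⟩ := Nat.exists_eq_add_of_le' (show 1 ≤ a by omega)
      refine le_trans (add_nonneg (ihT a (L + 1) (by omega)) (mul_nonneg ?_ (ihu _ (by omega))))
        (step a L (by omega))
      have := recB_le_half hn (a + 1 + 2 * L)
      have := recB_le_half hn j
      linarith
    refine ⟨fun m hm => ?_, hTn⟩
    have := hTn m 0 hm
    simp only [hT, zero_add, Finset.sum_range_one, Finset.sum_range_zero, mul_zero, add_zero,
      sub_zero] at this
    exact nonneg_of_mul_nonneg_right this (recB_succ_pos hn j)

/-- Expanding F(t P_{m+1} P_j) by the three-term recurrence in either factor gives a discrete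
hyperbolic equation. The normalizing factors π_j put it in the form required by `hyperbolic_nonneg`,
and the boundary values at j = 0 are F(P_m). -/
theorem functional_gegenbauer_mul_nonneg {n : ℕ} (hn : 2 ≤ n) (F : ℝ[X] →ₗ[ℝ] ℝ)
    (hF : ∀ m, 0 ≤ F (gegenbauer n m)) (m j : ℕ) : 0 ≤ F (gegenbauer n m * gegenbauer n j) := by
  have hFC := functional_C_mul F
  have key : ∀ j m, j ≤ m → 0 ≤ F (gegenbauer n m * gegenbauer n j) := by
    intro j m hjm
    have h := hyperbolic_nonneg hn
      (fun m j => dualNorm n j * F (gegenbauer n m * gegenbauer n j)) ?_ ?_ j m hjm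
    · exact nonneg_of_mul_nonneg_right h (dualNorm_pos hn j)
    · intro m j
      have hX : F (X * gegenbauer n (m + 1) * gegenbauer n j) =
          (1 - recB n (m + 1)) * F (gegenbauer n (m + 2) * gegenbauer n j) +
            recB n (m + 1) * F (gegenbauer n m * gegenbauer n j) := by
        rw [X_mul_gegenbauer_succ hn, add_mul, map_add, mul_assoc, mul_assoc, hFC, hFC]
      have hd := recB_mul_dualNorm hn j
      rcases j with _ | j
      · have hX' : F (X * gegenbauer n (m + 1) * gegenbauer n 0) =
            F (gegenbauer n (m + 1) * gegenbauer n 1) := by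
          congr 1; simp [gegenbauer, mul_comm]
        rw [hX'] at hX
        rw [recB_zero] at hd
        simp only [dualA, zero_mul, sub_zero]
        linear_combination dualNorm n 0 * hX +
          F (gegenbauer n (m + 1) * gegenbauer n (0 + 1)) * hd
      · have hX' : F (X * gegenbauer n (m + 1) * gegenbauer n (j + 1)) =
            (1 - recB n (j + 1)) * F (gegenbauer n (m + 1) * gegenbauer n (j + 2)) +
              recB n (j + 1) * F (gegenbauer n (m + 1) * gegenbauer n j) := by
          rw [← hFC, ← hFC, ← map_add]
          congr 1
          linear_combination gegenbauer n (m + 1) * X_mul_gegenbauer_succ hn j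
        have hd' := recB_mul_dualNorm hn j
        simp only [dualA, Nat.add_sub_cancel]
        linear_combination dualNorm n (j + 1) * (hX - hX') +
          F (gegenbauer n (m + 1) * gegenbauer n (j + 1 + 1)) * hd
          - F (gegenbauer n (m + 1) * gegenbauer n j) * hd'
    · intro m
      have : gegenbauer n m * gegenbauer n 0 = gegenbauer n m := by simp [gegenbauer]
      simp only [this]
      exact mul_nonneg (dualNorm_pos hn 0).le (hF m)
  rcases le_total j m with h | h
  · exact key j m h
  · rw [mul_comm]; exact key m j h

/-- The linearization coefficients of P_i P_j are nonnegative: the previous lemma applies to F(f) =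
(f P_k)_0, which by orthogonality is nonnegative on every P_m. -/
theorem mean_triple_nonneg {n : ℕ} (hn : 2 ≤ n) (i j k : ℕ) :
    0 ≤ mean hn (gegenbauer n i * gegenbauer n j * gegenbauer n k) := by
  refine functional_gegenbauer_mul_nonneg hn
    ((mean hn).comp (LinearMap.mulRight ℝ (gegenbauer n k))) (fun m => ?_) i j
  simp only [LinearMap.comp_apply, LinearMap.mulRight_apply]
  by_cases h : m = k
  · subst h; rw [← sq]; exact (mean_gegenbauer_sq_pos hn m).le
  · rw [mean_gegenbauer_mul_gegenbauer hn h]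

/-- All Gegenbauer coefficients of `p` are nonnegative. -/
def GegNonneg {n : ℕ} (hn : 2 ≤ n) (p : ℝ[X]) : Prop :=
  ∀ i, 0 ≤ mean hn (p * gegenbauer n i)

/-- All Gegenbauer coefficients of `p` are nonnegative, and the `d`-th one is positive. -/
def GegPosAt {n : ℕ} (hn : 2 ≤ n) (p : ℝ[X]) (d : ℕ) : Prop :=
  GegNonneg hn p ∧ 0 < mean hn (p * gegenbauer n d)

variable {n : ℕ} {hn : 2 ≤ n} {p q : ℝ[X]} {c : ℝ} {a b d : ℕ}

theorem GegNonneg.coeff_nonneg (h : GegNonneg hn p) (i : ℕ) : 0 ≤ gegenbauerCoeff n i p := by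
  rw [gegenbauerCoeff_eq hn]
  exact div_nonneg (h i) (mean_gegenbauer_sq_pos hn i).le

theorem GegPosAt.coeff_pos (h : GegPosAt hn p d) : 0 < gegenbauerCoeff n d p := by
  rw [gegenbauerCoeff_eq hn]
  exact div_pos h.2 (mean_gegenbauer_sq_pos hn d)

theorem GegNonneg.add (hp : GegNonneg hn p) (hq : GegNonneg hn q) : GegNonneg hn (p + q) :=
  fun i => by rw [add_mul, map_add]; exact add_nonneg (hp i) (hq i)

theorem GegPosAt.add_right (hp : GegPosAt hn p d) (hq : GegNonneg hn q) : GegPosAt hn (p + q) d :=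
  ⟨hp.1.add hq, by rw [add_mul, map_add]; exact add_pos_of_pos_of_nonneg hp.2 (hq d)⟩

theorem GegPosAt.add_left (hp : GegNonneg hn p) (hq : GegPosAt hn q d) : GegPosAt hn (p + q) d := by
  rw [add_comm]; exact hq.add_right hp

theorem GegNonneg.C_mul (hp : GegNonneg hn p) (hc : 0 ≤ c) : GegNonneg hn (C c * p) :=
  fun i => by rw [mul_assoc, mean_C_mul]; exact mul_nonneg hc (hp i)

theorem GegPosAt.C_mul (hp : GegPosAt hn p d) (hc : 0 < c) : GegPosAt hn (C c * p) d :=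
  ⟨hp.1.C_mul hc.le, by rw [mul_assoc, mean_C_mul]; exact mul_pos hc hp.2⟩

theorem gegPosAt_gegenbauer (hn : 2 ≤ n) (d : ℕ) : GegPosAt hn (gegenbauer n d) d := by
  refine ⟨fun i => ?_, by rw [← sq]; exact mean_gegenbauer_sq_pos hn d⟩
  by_cases h : d = i
  · subst h; rw [← sq]; exact (mean_gegenbauer_sq_pos hn d).le
  · rw [mean_gegenbauer_mul_gegenbauer hn h]

theorem mean_mul_gegenbauer_pos_of_hasPosLead (hn : 2 ≤ n) (hp : HasPosLead p d) :
    0 < mean hn (p * gegenbauer n d) :=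
  (mean_strictlyPositive hn).mul_pos_of_hasPosLead hp (gegenbauer_hasPosLead hn d)
    (mean_gegenbauer_mul_X_pow hn d)

theorem HasPosLead.mul (hp : HasPosLead p a) (hq : HasPosLead q b) :
    HasPosLead (p * q) (a + b) :=
  ⟨natDegree_mul_le.trans (add_le_add hp.1 hq.1), by
    rw [coeff_mul_add_eq_of_natDegree_le hp.1 hq.1]; exact mul_pos hp.2 hq.2⟩

theorem mean_mul_mul_eq_sum (hn : 2 ≤ n) (p q : ℝ[X]) (k : ℕ) :
    mean hn (p * q * gegenbauer n k) =
      ∑ i ∈ Finset.range (p.natDegree + 1), ∑ j ∈ Finset.range (q.natDegree + 1),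
        gegenbauerCoeff n i p * gegenbauerCoeff n j q *
          mean hn (gegenbauer n i * gegenbauer n j * gegenbauer n k) := by
  conv_lhs => rw [eq_sum_gegenbauerCoeff hn (Nat.lt_succ_self p.natDegree),
    eq_sum_gegenbauerCoeff hn (Nat.lt_succ_self q.natDegree)]
  rw [Finset.sum_mul_sum, Finset.sum_mul, map_sum]
  refine Finset.sum_congr rfl fun i _ => ?_
  rw [Finset.sum_mul, map_sum]
  refine Finset.sum_congr rfl fun j _ => ?_
  rw [← mean_C_mul, C_mul]
  congr 1; ring

theorem GegNonneg.mul (hp : GegNonneg hn p) (hq : GegNonneg hn q) : GegNonneg hn (p * q) := by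
  intro k
  rw [mean_mul_mul_eq_sum]
  exact Finset.sum_nonneg fun i _ => Finset.sum_nonneg fun j _ =>
    mul_nonneg (mul_nonneg (hp.coeff_nonneg i) (hq.coeff_nonneg j)) (mean_triple_nonneg hn i j k)

theorem GegPosAt.le_natDegree (hp : GegPosAt hn p d) : d ≤ p.natDegree := by
  by_contra! h
  have := hp.2
  rw [mul_comm, mean_gegenbauer_mul hn (lt_of_le_of_lt degree_le_natDegree
    (by exact_mod_cast h))] at this
  exact lt_irrefl _ this

/-- Nothing cancels in the double sum, so the single term P_a P_b suffices; it has degree a + b with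
positive leading coefficient, hence a positive coefficient at P_{a+b}. -/
theorem GegPosAt.mul (hp : GegPosAt hn p a) (hq : GegPosAt hn q b) :
    GegPosAt hn (p * q) (a + b) := by
  refine ⟨hp.1.mul hq.1, ?_⟩
  rw [mean_mul_mul_eq_sum]
  have hnn : ∀ i j, 0 ≤ gegenbauerCoeff n i p * gegenbauerCoeff n j q *
      mean hn (gegenbauer n i * gegenbauer n j * gegenbauer n (a + b)) := fun i j =>
    mul_nonneg (mul_nonneg (hp.1.coeff_nonneg i) (hq.1.coeff_nonneg j)) (mean_triple_nonneg hn i j _)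
  refine Finset.sum_pos' (fun i _ => Finset.sum_nonneg fun j _ => hnn i j)
    ⟨a, Finset.mem_range.2 (Nat.lt_succ_of_le hp.le_natDegree),
      Finset.sum_pos' (fun j _ => hnn a j)
        ⟨b, Finset.mem_range.2 (Nat.lt_succ_of_le hq.le_natDegree), ?_⟩⟩
  exact mul_pos (mul_pos hp.coeff_pos hq.coeff_pos) (mean_mul_gegenbauer_pos_of_hasPosLead hn
    ((gegenbauer_hasPosLead hn a).mul (gegenbauer_hasPosLead hn b)))

/-! ## Gegenbauer coefficients of the adjacent polynomials -/

theorem gegPosAt_adjH (hn : 2 ≤ n) (j : ℕ) : GegPosAt hn (adjH n j) j := by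
  have key : ∀ j, GegPosAt hn (adjH n j) j ∧ GegPosAt hn (adjH n (j + 1)) (j + 1) := by
    intro j
    induction j with
    | zero =>
      refine ⟨by rw [adjH_zero]; exact gegPosAt_gegenbauer hn 0, ?_⟩
      rw [zero_add, adjH_one hn]
      exact (gegPosAt_gegenbauer hn 1).C_mul (by exact_mod_cast (by omega : 0 < n))
    | succ j ih =>
      refine ⟨ih.2, ?_⟩
      rw [adjH_add_two hn]
      exact GegPosAt.add_left ih.1.1 ((gegPosAt_gegenbauer hn (j + 2)).C_mul
        (add_pos (kap_pos hn _) (kap_pos hn _)))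
  exact (key j).1

theorem gegNonneg_adjJ (hn : 2 ≤ n) (j : ℕ) : GegNonneg hn (adjJ n j) := by
  rcases j with _ | j
  · exact (gegPosAt_adjH hn 0).1
  · exact (gegPosAt_adjH hn (j + 1)).1.add (gegPosAt_adjH hn j).1

theorem gegPosAt_adjJ (hn : 2 ≤ n) {i j : ℕ} (hij : i ≤ j) : GegPosAt hn (adjJ n j) i := by
  induction j with
  | zero =>
    obtain rfl : i = 0 := by omega
    exact gegPosAt_adjH hn 0
  | succ j ih =>
    rw [← sub_add_cancel (adjJ n (j + 1)) (adjJ n j), adjJ_succ_sub hn]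
    have h1 := (gegPosAt_gegenbauer hn (j + 1)).C_mul (add_pos (kap_pos hn (j + 1)) (kap_pos hn j))
    rcases hij.lt_or_eq with h | rfl
    · exact GegPosAt.add_left h1.1 (ih (by omega))
    · exact h1.add_right (gegNonneg_adjJ hn j)

/-- `adjH n j` contains only Gegenbauer polynomials of one parity. The factor 1 + t supplies the
other parity, so that every coefficient up to the degree is positive. -/
theorem gegPosAt_one_add_X_mul_adjH (hn : 2 ≤ n) (j : ℕ) :
    ∀ i ≤ j + 1, GegPosAt hn ((1 + X) * adjH n j) i := by
  have hX : gegenbauer n 1 = X := rfl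
  have h1 : gegenbauer n 0 = 1 := rfl
  have hXmul : ∀ i, GegPosAt hn (X * gegenbauer n i) (i + 1) := fun i => by
    rw [← hX, add_comm i 1]
    exact (gegPosAt_gegenbauer hn 1).mul (gegPosAt_gegenbauer hn i)
  have key : ∀ j, (∀ i ≤ j + 1, GegPosAt hn ((1 + X) * adjH n j) i) ∧
      ∀ i ≤ j + 2, GegPosAt hn ((1 + X) * adjH n (j + 1)) i := by
    intro j
    induction j with
    | zero =>
      constructor
      · intro i hi
        rw [adjH_zero, mul_one, ← hX, ← h1]
        interval_cases i
        · exact (gegPosAt_gegenbauer hn 0).add_right (gegPosAt_gegenbauer hn 1).1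
        · exact GegPosAt.add_left (gegPosAt_gegenbauer hn 0).1 (gegPosAt_gegenbauer hn 1)
      · intro i hi
        have e : (1 + X) * adjH n (0 + 1) = C (n : ℝ) * (gegenbauer n 1 + X * gegenbauer n 1) := by
          rw [zero_add, adjH_one hn, hX]; ring
        rw [e]
        refine GegPosAt.C_mul ?_ (by exact_mod_cast (by omega : 0 < n))
        interval_cases i
        · refine GegPosAt.add_left (gegPosAt_gegenbauer hn 1).1 ⟨(hXmul 1).1, ?_⟩
          rw [h1, mul_one, hX, ← sq]
          exact (mean_strictlyPositive hn).sq X_ne_zero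
        · exact (gegPosAt_gegenbauer hn 1).add_right (hXmul 1).1
        · exact GegPosAt.add_left (gegPosAt_gegenbauer hn 1).1 (hXmul 1)
    | succ j ih =>
      refine ⟨ih.2, fun i hi => ?_⟩
      have e : (1 + X) * adjH n (j + 1 + 1) = (1 + X) * adjH n j +
          C (kap n (j + 2) + kap n (j + 1)) *
            (gegenbauer n (j + 2) + X * gegenbauer n (j + 2)) := by
        rw [adjH_add_two hn]; ring
      have hr := add_pos (kap_pos hn (j + 2)) (kap_pos hn (j + 1))
      have hs := (gegPosAt_gegenbauer hn (j + 2)).add_right (hXmul (j + 2)).1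
      rw [e]
      rcases Nat.lt_or_ge i (j + 2) with h | h
      · exact (ih.1 i (by omega)).add_right (hs.1.C_mul hr.le)
      · refine GegPosAt.add_left (ih.1 0 (by omega)).1 (GegPosAt.C_mul ?_ hr)
        rcases h.eq_or_lt with rfl | h
        · exact hs
        · obtain rfl : i = j + 2 + 1 := by omega
          exact GegPosAt.add_left (gegPosAt_gegenbauer hn (j + 2)).1 (hXmul (j + 2))
  exact (key j).1

end

end SphericalCodes

namespace SphericalCodes

open Polynomial

noncomputable section

/-! ## Jacobi polynomials -/

theorem ring_choose_succ (r : ℝ) (m : ℕ) :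
    Ring.choose r (m + 1) * ((m : ℝ) + 1) = Ring.choose r m * (r - m) := by
  have h := Ring.choose_smul_choose r (Nat.le_succ m)
  rw [Nat.choose_succ_self_right, Nat.succ_sub (le_refl m), Nat.sub_self, Ring.choose_one_right,
    nsmul_eq_mul] at h
  push_cast at h
  linarith

theorem ring_choose_pos {r : ℝ} {m : ℕ} (h : (m : ℝ) - 1 < r) : 0 < Ring.choose r m := by
  induction m with
  | zero => rw [Ring.choose_zero_right]; exact one_pos
  | succ m ih =>
    push_cast at h
    have h1 := ring_choose_succ r m
    have h2 : 0 < Ring.choose r m * (r - m) := mul_pos (ih (by linarith)) (by linarith)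
    rw [← h1] at h2
    exact pos_of_mul_pos_left h2 (by positivity)

/-- The coefficients of the Jacobi polynomial in the basis `((t-1)/2)^j ((t+1)/2)^{i-j}`. -/
def jacobiCoeff (i : ℕ) (a b : ℝ) (j : ℕ) : ℝ :=
  Ring.choose ((i : ℝ) + a) (i - j) * Ring.choose ((i : ℝ) + b) j

/-- This ratio of neighbouring coefficients is exactly what makes the off-diagonal terms of the
Jacobi operator match up in `jacobiOp_jacobi`. -/
theorem jacobiCoeff_succ (i : ℕ) (a b : ℝ) {j : ℕ} (hj : j < i) :
    jacobiCoeff i a b (j + 1) * (((j : ℝ) + 1) * (j + 1 + a)) =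
      jacobiCoeff i a b j * (((i : ℝ) - j) * (i - j + b)) := by
  obtain ⟨l, rfl⟩ := Nat.exists_eq_add_of_lt hj
  unfold jacobiCoeff
  have e1 : j + l + 1 - (j + 1) = l := by omega
  have e2 : j + l + 1 - j = l + 1 := by omega
  rw [e1, e2]
  have h1 := ring_choose_succ (((j + l + 1 : ℕ) : ℝ) + a) l
  have h2 := ring_choose_succ (((j + l + 1 : ℕ) : ℝ) + b) j
  push_cast at h1 h2 ⊢
  linear_combination Ring.choose ((j : ℝ) + l + 1 + a) l * (j + 1 + a) * h2
    - Ring.choose ((j : ℝ) + l + 1 + b) j * (l + 1 + b) * h1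

theorem jacobiCoeff_pos {i j : ℕ} {a b : ℝ} (ha : -1 < a) (hb : -1 < b) (hj : j ≤ i) :
    0 < jacobiCoeff i a b j := by
  have hj' : (j : ℝ) ≤ i := by exact_mod_cast hj
  have hj0 : (0 : ℝ) ≤ j := j.cast_nonneg
  refine mul_pos (ring_choose_pos ?_) (ring_choose_pos ?_)
  · rw [Nat.cast_sub hj]; linarith
  · linarith

theorem jacobi_eq (i : ℕ) (a b : ℝ) :
    jacobi i a b = C ((1 / 2) ^ i) *
      ∑ j ∈ Finset.range (i + 1), C (jacobiCoeff i a b j) * ((X - 1) ^ j * (X + 1) ^ (i - j)) := by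
  rw [jacobi, Finset.mul_sum]
  refine Finset.sum_congr rfl fun j hj => ?_
  have hj' : j ≤ i := Nat.lt_succ_iff.1 (Finset.mem_range.1 hj)
  obtain ⟨l, rfl⟩ := Nat.exists_eq_add_of_le hj'
  rw [Nat.add_sub_cancel_left, jacobiCoeff, Nat.add_sub_cancel_left, mul_pow, mul_pow, pow_add,
    C_mul (a := (1 / 2) ^ j), C_pow, C_pow]
  ring

theorem jacobi_hasPosLead {i : ℕ} {a b : ℝ} (ha : -1 < a) (hb : -1 < b) :
    HasPosLead (jacobi i a b) i := by
  rw [jacobi_eq]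
  refine HasPosLead.C_mul ?_ (by positivity)
  have hX1 : HasPosLead (X - 1 : ℝ[X]) 1 := by
    constructor
    · rw [← C_1, natDegree_X_sub_C]
    · simp [coeff_one]
  have hX2 : HasPosLead (X + 1 : ℝ[X]) 1 := by
    constructor
    · rw [← C_1, natDegree_X_add_C]
    · simp [coeff_one]
  have hpow : ∀ {p : ℝ[X]}, HasPosLead p 1 → ∀ j, HasPosLead (p ^ j) j := by
    intro p hp j
    induction j with
    | zero => simp [HasPosLead]
    | succ j ih => rw [pow_succ]; exact ih.mul hp
  have hterm : ∀ j ∈ Finset.range (i + 1),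
      HasPosLead (C (jacobiCoeff i a b j) * ((X - 1) ^ j * (X + 1) ^ (i - j))) i := by
    intro j hj
    have hj' : j ≤ i := Nat.lt_succ_iff.1 (Finset.mem_range.1 hj)
    have := (hpow hX1 j).mul (hpow hX2 (i - j))
    rw [Nat.add_sub_cancel' hj'] at this
    exact this.C_mul (jacobiCoeff_pos ha hb hj')
  refine ⟨natDegree_sum_le_of_forall_le _ _ fun j hj => (hterm j hj).1, ?_⟩
  rw [finsetSum_coeff]
  exact Finset.sum_pos (fun j hj => (hterm j hj).2) ⟨0, Finset.mem_range.2 (Nat.succ_pos i)⟩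

/-- The Jacobi differential operator. -/
def jacobiOp (a b : ℝ) (y : ℝ[X]) : ℝ[X] :=
  (1 - X ^ 2) * derivative (derivative y) + (C (b - a) - C (a + b + 2) * X) * derivative y

theorem jacobiOp_C_mul (a b c : ℝ) (y : ℝ[X]) : jacobiOp a b (C c * y) = C c * jacobiOp a b y := by
  simp only [jacobiOp, derivative_C_mul]; ring

theorem jacobiOp_sum (a b : ℝ) {ι : Type*} (s : Finset ι) (y : ι → ℝ[X]) :
    jacobiOp a b (∑ i ∈ s, y i) = ∑ i ∈ s, jacobiOp a b (y i) := by
  simp only [jacobiOp, derivative_sum, Finset.mul_sum, Finset.sum_add_distrib]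

theorem X_sub_one_ne_zero : (X - 1 : ℝ[X]) ≠ 0 := by
  rw [← C_1]; exact X_sub_C_ne_zero 1

theorem X_add_one_ne_zero : (X + 1 : ℝ[X]) ≠ 0 := by
  rw [← C_1]; exact X_add_C_ne_zero 1

theorem natCast_mul_mul_pow_pred (u : ℝ[X]) (j : ℕ) :
    (j : ℝ[X]) * (u * u ^ (j - 1)) = j * u ^ j := by
  rcases j with _ | j
  · simp
  · rw [Nat.add_sub_cancel, pow_succ']

/-- In the basis (t-1)^j (t+1)^l the operator is tridiagonal. The identity is checked after
multiplication by (t-1)(t+1), where the logarithmic derivative of the product is polynomial. -/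
theorem jacobiOp_bernstein (a b : ℝ) (j l : ℕ) :
    jacobiOp a b ((X - 1) ^ j * (X + 1) ^ l) =
      -(C ((j : ℝ) * (j + a)) * ((X - 1) ^ (j - 1) * (X + 1) ^ (l + 1))
        + C (2 * (j : ℝ) * l + (a + 1) * l + (b + 1) * j) * ((X - 1) ^ j * (X + 1) ^ l)
        + C ((l : ℝ) * (l + b)) * ((X - 1) ^ (j + 1) * (X + 1) ^ (l - 1))) := by
  have hu := natCast_mul_mul_pow_pred (X - 1) j
  have hv := natCast_mul_mul_pow_pred (X + 1) l
  set E : ℝ[X] := (X - 1) ^ j * (X + 1) ^ l with hE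
  have h1 : (X - 1) * (X + 1) * derivative E =
      ((j : ℝ[X]) * (X + 1) + (l : ℝ[X]) * (X - 1)) * E := by
    rw [hE, derivative_mul, derivative_pow, derivative_pow]
    simp only [derivative_sub, derivative_add, derivative_X, derivative_one, sub_zero, add_zero,
      mul_one, C_eq_natCast]
    linear_combination (X + 1) ^ (l + 1) * hu + (X - 1) ^ (j + 1) * hv
  have h2 := congrArg derivative h1
  simp only [derivative_mul, derivative_sub, derivative_add, derivative_X, derivative_one, sub_zero,
    add_zero, mul_one, one_mul, derivative_natCast, zero_mul, zero_add] at h2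
  apply mul_left_cancel₀ (mul_ne_zero X_sub_one_ne_zero X_add_one_ne_zero)
  simp only [jacobiOp, map_add, map_sub, map_mul, map_natCast, map_one, map_ofNat]
  have e1 : (X - 1) * (X + 1) * ((j : ℝ[X]) * ((X - 1) ^ (j - 1) * (X + 1) ^ (l + 1))) =
      (j : ℝ[X]) * (X + 1) ^ 2 * E := by
    rw [hE]; linear_combination (X + 1) ^ (l + 2) * hu
  have e2 : (X - 1) * (X + 1) * ((l : ℝ[X]) * ((X - 1) ^ (j + 1) * (X + 1) ^ (l - 1))) =
      (l : ℝ[X]) * (X - 1) ^ 2 * E := by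
    rw [hE]; linear_combination (X - 1) ^ (j + 2) * hv
  linear_combination (-(X - 1 : ℝ[X]) * (X + 1)) * h2 + (C b - C a - (C a + C b + 2) * X) * h1
    - (((j : ℝ[X]) - 1) * (X + 1) + ((l : ℝ[X]) - 1) * (X - 1)) * h1
    + ((j : ℝ[X]) + C a) * e1 + ((l : ℝ[X]) + C b) * e2

/-- The terms arriving at index j from j + 1 and j - 1 become multiples of the j-th coefficient by
`jacobiCoeff_succ`, and the three contributions add up to an eigenvalue independent of j. -/
theorem jacobiOp_jacobi (i : ℕ) (a b : ℝ) :
    jacobiOp a b (jacobi i a b) = -(C ((i : ℝ) * (i + a + b + 1)) * jacobi i a b) := by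
  rw [jacobi_eq, jacobiOp_C_mul, jacobiOp_sum]
  set E : ℕ → ℝ[X] := fun j => (X - 1) ^ j * (X + 1) ^ (i - j) with hE
  set c := jacobiCoeff i a b with hc
  have h1 : ∑ j ∈ Finset.range (i + 1), C (c j) * (C ((j : ℝ) * (j + a)) *
      ((X - 1) ^ (j - 1) * (X + 1) ^ (i - j + 1))) =
      ∑ j ∈ Finset.range (i + 1), C (c j * (((i : ℝ) - j) * (i - j + b))) * E j := by
    rw [Finset.sum_range_succ', Finset.sum_range_succ]
    simp only [Nat.cast_zero, zero_mul, map_zero, mul_zero, add_zero, sub_self]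
    refine Finset.sum_congr rfl fun j hj => ?_
    have hj' := Finset.mem_range.1 hj
    rw [hc, ← jacobiCoeff_succ i a b hj', hE, ← mul_assoc, ← C_mul,
      show i - (j + 1) + 1 = i - j by omega, Nat.add_sub_cancel]
    push_cast
    rfl
  have h2 : ∑ j ∈ Finset.range (i + 1), C (c j) * (C (((i - j : ℕ) : ℝ) * ((i - j : ℕ) + b)) *
      ((X - 1) ^ (j + 1) * (X + 1) ^ (i - j - 1))) =
      ∑ j ∈ Finset.range (i + 1), C (c j * ((j : ℝ) * (j + a))) * E j := by
    rw [Finset.sum_range_succ, Finset.sum_range_succ']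
    simp only [Nat.cast_zero, zero_mul, map_zero, mul_zero, add_zero, Nat.sub_self]
    refine Finset.sum_congr rfl fun j hj => ?_
    have hj' := Finset.mem_range.1 hj
    have := jacobiCoeff_succ i a b hj'
    rw [hE, ← mul_assoc, ← C_mul, Nat.cast_sub hj'.le, hc, ← this, Nat.sub_sub]
    push_cast
    rfl
  rw [← mul_assoc, mul_comm (C _) (C ((1 / 2 : ℝ) ^ i)), mul_assoc, ← mul_neg]
  congr 1
  have h3 : ∀ j ∈ Finset.range (i + 1), jacobiOp a b (C (c j) * E j) =
      -(C (c j) * (C ((j : ℝ) * (j + a)) * ((X - 1) ^ (j - 1) * (X + 1) ^ (i - j + 1)))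
        + C (c j * (2 * (j : ℝ) * (i - j : ℕ) + (a + 1) * (i - j : ℕ) + (b + 1) * j)) * E j
        + C (c j) * (C (((i - j : ℕ) : ℝ) * ((i - j : ℕ) + b)) *
          ((X - 1) ^ (j + 1) * (X + 1) ^ (i - j - 1)))) := by
    intro j _
    rw [jacobiOp_C_mul, hE, jacobiOp_bernstein, C_mul (a := c j)]
    ring
  rw [Finset.sum_congr rfl h3, Finset.sum_neg_distrib, Finset.sum_add_distrib,
    Finset.sum_add_distrib, h1, h2, ← Finset.sum_add_distrib, ← Finset.sum_add_distrib,
    Finset.mul_sum]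
  congr 1
  refine Finset.sum_congr rfl fun j hj => ?_
  have hj' : j ≤ i := Nat.lt_succ_iff.1 (Finset.mem_range.1 hj)
  rw [← add_mul, ← add_mul, ← C_add, ← C_add, Nat.cast_sub hj']
  change _ = C _ * (C (c j) * E j)
  rw [← mul_assoc (C ((i : ℝ) * (i + a + b + 1))) (C (c j)) (E j), ← C_mul]
  congr 2
  ring

/-- Polynomial solutions of the Jacobi equation are orthogonal to lower degree polynomials. -/
theorem orthogonal_of_jacobiOp {μ : ℝ[X] →ₗ[ℝ] ℝ} {a b : ℝ} (hab : 0 < a + b + 1)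
    (hμ : ∀ f, μ ((1 - X ^ 2) * derivative f + (C (b - a) - C (a + b + 2) * X) * f) = 0)
    {i : ℕ} {y : ℝ[X]} (hy : jacobiOp a b y = -(C ((i : ℝ) * (i + a + b + 1)) * y)) :
    ∀ d < i, μ (y * X ^ d) = 0 := by
  have hC := functional_C_mul μ
  intro d
  induction d using Nat.strong_induction_on with
  | _ d ih =>
  intro hd
  -- The Jacobi operator is symmetric for μ: the difference of the two sides is the annihilated
  -- expression for the Wronskian y' t^d - y (t^d)'.
  have hsym : μ (y * jacobiOp a b (X ^ d)) = μ (jacobiOp a b y * X ^ d) := by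
    have h := hμ (derivative y * X ^ d - y * derivative (X ^ d))
    rw [← sub_eq_zero, ← map_sub, ← neg_eq_zero, ← map_neg, ← h]
    congr 1
    simp only [jacobiOp, derivative_sub, derivative_mul]
    ring
  have hop : y * jacobiOp a b (X ^ d) = C ((d : ℝ) * (d - 1)) * (y * X ^ (d - 2))
      + C ((b - a) * d) * (y * X ^ (d - 1)) - C ((d : ℝ) * (d + a + b + 1)) * (y * X ^ d) := by
    rcases d with _ | _ | d
    · simp [jacobiOp]
    · simp only [jacobiOp, zero_add, pow_one, derivative_X, derivative_one, mul_zero, Nat.cast_one,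
        sub_self, Nat.sub_self, pow_zero, map_mul, map_sub, map_add, map_one, map_zero, map_ofNat]
      ring
    · have hd1 : derivative (X ^ (d + 1 + 1) : ℝ[X]) = C ((d : ℝ) + 2) * X ^ (d + 1) := by
        rw [derivative_X_pow, Nat.add_sub_cancel]
        congr 2; push_cast; ring
      have hd2 : derivative (X ^ (d + 1) : ℝ[X]) = C ((d : ℝ) + 1) * X ^ d := by
        rw [derivative_X_pow, Nat.add_sub_cancel]
        congr 2; push_cast; ring
      rw [jacobiOp, hd1, derivative_C_mul, hd2]
      simp only [Nat.add_sub_cancel, Nat.cast_add,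
        Nat.cast_one, map_mul, map_sub, map_add, map_natCast, map_one, map_ofNat,
        show d + 1 + 1 - 2 = d by omega]
      ring
  have h1 : ((d : ℝ) * (d - 1)) * μ (y * X ^ (d - 2)) = 0 := by
    rcases d with _ | _ | d
    · simp
    · simp
    · rw [ih _ (by omega) (by omega), mul_zero]
  have h2 : ((b - a) * d) * μ (y * X ^ (d - 1)) = 0 := by
    rcases d with _ | d
    · simp
    · rw [ih _ (by omega) (by omega), mul_zero]
  rw [hop, hy, map_sub, map_add, hC, hC, hC, h1, h2, neg_mul, map_neg,
    mul_assoc (C _) y, hC] at hsym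
  have hd' : (d : ℝ) + 1 ≤ i := by exact_mod_cast hd
  have hd0 : (0 : ℝ) ≤ d := d.cast_nonneg
  -- On t^d the operator has the same eigenvalue formula with d in place of i, up to powers already
  -- handled; the factor is the difference of the two eigenvalues, nonzero for d < i.
  have h3 : ((i : ℝ) - d) * (i + d + a + b + 1) * μ (y * X ^ d) = 0 := by linear_combination hsym
  rcases mul_eq_zero.1 h3 with h3 | h3
  · have : 0 < ((i : ℝ) - d) * (i + d + a + b + 1) := mul_pos (by linarith) (by linarith)
    exact absurd h3 this.ne'
  · exact h3

/-- Orthogonal polynomials with positive leading coefficients are unique up to positive factors. -/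
theorem eq_C_mul_of_orthogonal {μ : ℝ[X] →ₗ[ℝ] ℝ} (hμ : StrictlyPositive μ) {p q : ℝ[X]} {i : ℕ}
    (hp : HasPosLead p i) (hq : HasPosLead q i) (hpo : ∀ d < i, μ (p * X ^ d) = 0)
    (hqo : ∀ d < i, μ (q * X ^ d) = 0) : ∃ c : ℝ, 0 < c ∧ p = C c * q := by
  refine ⟨p.coeff i / q.coeff i, div_pos hp.2 hq.2, ?_⟩
  have hdeg := degree_sub_C_mul_lt hq hp.1
  set c := p.coeff i / q.coeff i
  by_contra hne
  have hne' : p - C c * q ≠ 0 := sub_ne_zero.2 hne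
  have h1 := functional_mul_eq_zero hpo hdeg
  have h2 := functional_mul_eq_zero hqo hdeg
  have h3 := hμ.sq hne'
  have e : (p - C c * q) ^ 2 = p * (p - C c * q) - c • (q * (p - C c * q)) := by
    rw [smul_eq_C_mul]; ring
  rw [e, map_sub, map_smul, h1, h2, smul_zero, sub_zero] at h3
  exact lt_irrefl _ h3

/-! ## The adjacent systems -/

/-- The functional `f ↦ ((1 - t) (1 + t)^ε f)_0`. -/
def adjMean {n : ℕ} (hn : 2 ≤ n) (ε : ℕ) : ℝ[X] →ₗ[ℝ] ℝ :=
  (mean hn).comp (LinearMap.mulLeft ℝ ((1 - X) * (1 + X) ^ ε))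

theorem adjMean_apply {n : ℕ} (hn : 2 ≤ n) (ε : ℕ) (f : ℝ[X]) :
    adjMean hn ε f = mean hn ((1 - X) * (1 + X) ^ ε * f) := rfl

theorem adjMean_strictlyPositive {n : ℕ} (hn : 2 ≤ n) (ε : ℕ) :
    StrictlyPositive (adjMean hn ε) := by
  intro f hf h0
  refine mean_strictlyPositive hn _ (mul_ne_zero (mul_ne_zero one_sub_X_ne_zero
    (pow_ne_zero _ one_add_X_ne_zero)) hf) fun t ht => ?_
  rw [LinearMap.mulLeft_apply]
  simp only [eval_mul, eval_sub, eval_one, eval_X, eval_pow, eval_add]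
  exact mul_nonneg (mul_nonneg (by linarith [ht.2]) (pow_nonneg (by linarith [ht.1]) _)) (h0 t ht)

/-- The orthogonal polynomials for `adjMean`, `ε ∈ {0, 1}`. -/
def adjPoly (n ε j : ℕ) : ℝ[X] := if ε = 0 then adjJ n j else adjH n j

theorem adjPoly_hasPosLead {n : ℕ} (hn : 2 ≤ n) (ε j : ℕ) : HasPosLead (adjPoly n ε j) j := by
  unfold adjPoly
  split_ifs
  · exact adjJ_hasPosLead hn j
  · exact adjH_hasPosLead hn j

theorem adjMean_adjPoly_mul_X_pow {n : ℕ} (hn : 2 ≤ n) {ε : ℕ} (hε : ε = 0 ∨ ε = 1) (j : ℕ) :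
    ∀ d < j, adjMean hn ε (adjPoly n ε j * X ^ d) = 0 := by
  intro d hd
  have hPj : mean hn (gegenbauer n j * X ^ d) = 0 := mean_gegenbauer_mul_X_pow hn j d hd
  rw [adjMean_apply]
  rcases hε with rfl | rfl
  · have e : (1 - X) * (1 + X) ^ 0 * (adjPoly n 0 j * X ^ d) =
        C (kap n j) * (gegenbauer n j * X ^ d - gegenbauer n (j + 1) * X ^ d) := by
      have := one_sub_mul_adjJ hn j
      rw [adjPoly, if_pos rfl]
      linear_combination X ^ d * this
    rw [e, mean_C_mul, map_sub, hPj, mean_gegenbauer_mul_X_pow hn (j + 1) d (by omega), sub_zero,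
      mul_zero]
  · have e : (1 - X) * (1 + X) ^ 1 * (adjPoly n 1 j * X ^ d) =
        C (kap n j) * (gegenbauer n j * X ^ d - gegenbauer n (j + 1) * X ^ (d + 1)) := by
      have := one_sub_sq_mul_adjH hn j
      rw [adjPoly, if_neg one_ne_zero]
      linear_combination X ^ d * this
    rw [e, mean_C_mul, map_sub, hPj, mean_gegenbauer_mul_X_pow hn (j + 1) (d + 1) (by omega),
      sub_zero, mul_zero]

/-- The Pearson equation for the parameters a = (n-1)/2 and b = ε + (n-3)/2, for which b - a = ε - 1
and a + b + 2 = n + ε. -/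
theorem adjMean_identity {n : ℕ} (hn : 2 ≤ n) {ε : ℕ} (hε : ε = 0 ∨ ε = 1) (f : ℝ[X]) :
    adjMean hn ε ((1 - X ^ 2) * derivative f +
      (C ((ε : ℝ) - 1) - C ((n : ℝ) + ε) * X) * f) = 0 := by
  have h := mean_derivative_identity hn ((1 - X) * (1 + X) ^ ε * f)
  rw [adjMean_apply, ← sub_eq_zero.2 h, ← mean_C_mul, ← map_sub]
  congr 1
  rcases hε with rfl | rfl
  · simp only [pow_zero, mul_one, derivative_mul, derivative_one, derivative_X,
      Nat.cast_zero, map_sub, map_add, map_natCast, map_one, map_zero]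
    ring
  · simp only [pow_one, derivative_mul, derivative_one,
      derivative_X, Nat.cast_one, map_sub, map_add, map_natCast, map_one]
    ring

theorem adjacentJacobi_eq {n : ℕ} (hn : 2 ≤ n) {ε : ℕ} (hε : ε = 0 ∨ ε = 1) (j : ℕ) :
    ∃ c : ℝ, 0 < c ∧ adjacentJacobi n ε j = C c * adjPoly n ε j := by
  have h2 : (2 : ℝ) ≤ n := by exact_mod_cast hn
  have hε0 : (0 : ℝ) ≤ ε := ε.cast_nonneg
  refine eq_C_mul_of_orthogonal (adjMean_strictlyPositive hn ε)
    (jacobi_hasPosLead (by linarith) (by linarith)) (adjPoly_hasPosLead hn ε j) ?_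
    (adjMean_adjPoly_mul_X_pow hn hε j)
  refine orthogonal_of_jacobiOp (a := ((n : ℝ) - 1) / 2) (b := (ε : ℝ) + ((n : ℝ) - 3) / 2)
    (by linarith) (fun f => ?_) (jacobiOp_jacobi j _ _)
  convert adjMean_identity hn hε f using 6
  · ring
  · congr 1; ring

end

end SphericalCodes

namespace SphericalCodes

open Polynomial

noncomputable section

/-! ## Zeros of quasi-orthogonal polynomials and positive quadratures -/

theorem eval_sign_of_no_root {q : ℝ[X]} (h : ∀ x ∈ Set.Ioo (-1 : ℝ) 1, q.eval x ≠ 0) :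
    (∀ t ∈ Set.Icc (-1 : ℝ) 1, 0 ≤ q.eval t) ∨ (∀ t ∈ Set.Icc (-1 : ℝ) 1, q.eval t ≤ 0) := by
  have hcl : closure (Set.Ioo (-1 : ℝ) 1) = Set.Icc (-1) 1 := closure_Ioo (by norm_num)
  have hpre : (∀ t ∈ Set.Ioo (-1 : ℝ) 1, 0 ≤ q.eval t) ∨
      (∀ t ∈ Set.Ioo (-1 : ℝ) 1, q.eval t ≤ 0) := by
    by_contra! hcon
    obtain ⟨⟨x, hx, hx0⟩, ⟨y, hy, hy0⟩⟩ := hcon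
    have hconv := (isPreconnected_Ioo (a := (-1 : ℝ)) (b := 1)).intermediate_value hx hy
      q.continuous.continuousOn
    obtain ⟨z, hz, hz0⟩ := hconv ⟨hx0.le, hy0.le⟩
    exact h z hz hz0
  rcases hpre with h | h
  · left
    rw [← hcl]
    exact fun t ht => closure_minimal (s := Set.Ioo (-1 : ℝ) 1) (t := {t | 0 ≤ q.eval t}) h
      (isClosed_le continuous_const q.continuous) ht
  · right
    rw [← hcl]
    exact fun t ht => closure_minimal (s := Set.Ioo (-1 : ℝ) 1) (t := {t | q.eval t ≤ 0}) h
      (isClosed_le q.continuous continuous_const) ht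

/-- S collects the zeros of odd multiplicity in (-1, 1): a repeated root is removed from S and its
square moved into the factor of constant sign. -/
theorem exists_nodal_mul_sign {q : ℝ[X]} (hq : q ≠ 0) :
    ∃ (S : Finset ℝ) (h : ℝ[X]), (∀ x ∈ S, x ∈ Set.Ioo (-1 : ℝ) 1) ∧
      q = Lagrange.nodal S id * h ∧
      ((∀ t ∈ Set.Icc (-1 : ℝ) 1, 0 ≤ h.eval t) ∨ (∀ t ∈ Set.Icc (-1 : ℝ) 1, h.eval t ≤ 0)) := by
  induction hd : q.natDegree using Nat.strong_induction_on generalizing q with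
  | _ d ih =>
  by_cases hroot : ∃ x ∈ Set.Ioo (-1 : ℝ) 1, q.eval x = 0
  · obtain ⟨x, hx, hx0⟩ := hroot
    obtain ⟨q₁, rfl⟩ := dvd_iff_isRoot.2 hx0
    have hq₁ : q₁ ≠ 0 := right_ne_zero_of_mul hq
    have hdeg : q₁.natDegree < d := by
      rw [natDegree_mul (X_sub_C_ne_zero x) hq₁, natDegree_X_sub_C] at hd
      omega
    obtain ⟨S, h, hS, hfac, hsign⟩ := ih _ hdeg hq₁ rfl
    by_cases hxS : x ∈ S
    · refine ⟨S.erase x, (X - C x) ^ 2 * h, fun y hy => hS y (Finset.mem_of_mem_erase hy), ?_, ?_⟩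
      · rw [hfac, Lagrange.nodal_eq_mul_nodal_erase hxS]
        simp only [id]
        ring
      · refine hsign.imp (fun hs t ht => ?_) fun hs t ht => ?_
        · rw [eval_mul, eval_pow]; exact mul_nonneg (sq_nonneg _) (hs t ht)
        · rw [eval_mul, eval_pow]; exact mul_nonpos_of_nonneg_of_nonpos (sq_nonneg _) (hs t ht)
    · refine ⟨insert x S, h, fun y hy => ?_, ?_, hsign⟩
      · rcases Finset.mem_insert.1 hy with rfl | hy
        · exact hx
        · exact hS y hy
      · rw [hfac, Lagrange.nodal_insert_eq_nodal hxS]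
        simp only [id]
        ring
  · push Not at hroot
    exact ⟨∅, q, by simp, by simp, eval_sign_of_no_root hroot⟩

/-- With fewer than r sign changes, the nodal polynomial of the sign changes would be orthogonal to
q although its product with q has constant sign. -/
theorem StrictlyPositive.exists_zeros {μ : ℝ[X] →ₗ[ℝ] ℝ} (hμ : StrictlyPositive μ) {q : ℝ[X]}
    (hq : q ≠ 0) {r : ℕ} (ho : ∀ d < r, μ (q * X ^ d) = 0) :
    ∃ (S : Finset ℝ) (h : ℝ[X]), r ≤ S.card ∧ (∀ x ∈ S, x ∈ Set.Ioo (-1 : ℝ) 1) ∧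
      q = Lagrange.nodal S id * h ∧
      ((∀ t ∈ Set.Icc (-1 : ℝ) 1, 0 ≤ h.eval t) ∨ (∀ t ∈ Set.Icc (-1 : ℝ) 1, h.eval t ≤ 0)) := by
  obtain ⟨S, h, hS, hfac, hsign⟩ := exists_nodal_mul_sign hq
  refine ⟨S, h, ?_, hS, hfac, hsign⟩
  by_contra! hlt
  have h0 : μ (q * Lagrange.nodal S id) = 0 := by
    refine functional_mul_eq_zero ho ?_
    rw [Lagrange.degree_nodal]
    exact_mod_cast hlt
  have hh : h ≠ 0 := by rintro rfl; exact hq (by rw [hfac, mul_zero])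
  have hne : Lagrange.nodal S id ^ 2 * h ≠ 0 := mul_ne_zero (pow_ne_zero 2 Lagrange.nodal_ne_zero) hh
  have e : q * Lagrange.nodal S id = Lagrange.nodal S id ^ 2 * h := by rw [hfac]; ring
  rw [e] at h0
  rcases hsign with hs | hs
  · refine (hμ _ hne fun t ht => ?_).ne' h0
    rw [eval_mul, eval_pow]
    exact mul_nonneg (sq_nonneg _) (hs t ht)
  · have := hμ _ (neg_ne_zero.2 hne) fun t ht => by
      rw [eval_neg, eval_mul, eval_pow, neg_nonneg]
      exact mul_nonpos_of_nonneg_of_nonpos (sq_nonneg _) (hs t ht)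
    rw [map_neg, h0, neg_zero] at this
    exact lt_irrefl _ this

/-- A full orthogonal polynomial has simple zeros, all in `(-1, 1)`. -/
theorem StrictlyPositive.eq_C_mul_nodal {μ : ℝ[X] →ₗ[ℝ] ℝ} (hμ : StrictlyPositive μ) {q : ℝ[X]}
    {r : ℕ} (hq : HasPosLead q r) (ho : ∀ d < r, μ (q * X ^ d) = 0) :
    ∃ S : Finset ℝ, S.card = r ∧ (∀ x ∈ S, x ∈ Set.Ioo (-1 : ℝ) 1) ∧
      q = C q.leadingCoeff * Lagrange.nodal S id := by
  obtain ⟨S, h, hr, hS, hfac, -⟩ := hμ.exists_zeros hq.ne_zero ho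
  have hh : h ≠ 0 := by rintro rfl; exact hq.ne_zero (by rw [hfac, mul_zero])
  have hdeg : r = S.card + h.natDegree := by
    rw [← hq.natDegree_eq, hfac, natDegree_mul Lagrange.nodal_ne_zero hh, Lagrange.natDegree_nodal]
  refine ⟨S, by omega, hS, ?_⟩
  rw [eq_C_of_natDegree_eq_zero (by omega : h.natDegree = 0)] at hfac
  have hl : q.leadingCoeff = h.coeff 0 := by
    rw [hfac, leadingCoeff_mul, Lagrange.nodal_monic.leadingCoeff, one_mul, leadingCoeff_C]
  rw [hl, mul_comm]
  exact hfac

theorem eval_nodal_id_eq_zero_iff {S : Finset ℝ} {t : ℝ} :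
    (Lagrange.nodal S id).eval t = 0 ↔ t ∈ S := by
  rw [Lagrange.eval_nodal, Finset.prod_eq_zero_iff]
  constructor
  · rintro ⟨x, hx, h⟩
    rwa [sub_eq_zero.1 h]
  · exact fun h => ⟨t, h, sub_self t⟩

/-- Division by the nodal polynomial: the quotient has degree below r and is annihilated, and the
remainder is the Lagrange interpolant. -/
theorem interpolatory_quadrature {μ : ℝ[X] →ₗ[ℝ] ℝ} {S : Finset ℝ} {r : ℕ}
    (ho : ∀ d < r, μ (Lagrange.nodal S id * X ^ d) = 0) {f : ℝ[X]} (hf : f.degree < (S.card + r : ℕ)) :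
    μ f = ∑ x ∈ S, μ (Lagrange.basis S id x) * f.eval x := by
  have hm : (Lagrange.nodal S (id : ℝ → ℝ)).Monic := Lagrange.nodal_monic
  have hdiv := modByMonic_add_div f (Lagrange.nodal S (id : ℝ → ℝ))
  have hq : (f /ₘ Lagrange.nodal S id).degree < r := by
    by_cases h0 : f /ₘ Lagrange.nodal S id = 0
    · rw [h0, degree_zero]; exact WithBot.bot_lt_coe _
    · rw [← natDegree_lt_iff_degree_lt h0, natDegree_divByMonic f hm, Lagrange.natDegree_nodal]
      have hf0 : f ≠ 0 := by rintro rfl; exact h0 (zero_divByMonic _)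
      have hf' := (natDegree_lt_iff_degree_lt hf0).2 hf
      have : f.natDegree ≥ S.card := by
        by_contra! hlt
        apply h0
        rw [divByMonic_eq_zero_iff hm, Lagrange.degree_nodal]
        exact lt_of_le_of_lt degree_le_natDegree (by exact_mod_cast hlt)
      omega
  have hrem : f %ₘ Lagrange.nodal S id = ∑ x ∈ S, C (f.eval x) * Lagrange.basis S id x := by
    rw [← Lagrange.interpolate_apply (v := id) (r := fun x => f.eval x)]
    refine Lagrange.eq_interpolate_of_eval_eq _ Function.injective_id.injOn ?_ fun x hx => ?_
    · rw [← Lagrange.degree_nodal (v := (id : ℝ → ℝ))]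
      exact degree_modByMonic_lt _ hm
    · have h1 := congrArg (eval x) hdiv
      rw [eval_add, eval_mul, eval_nodal_id_eq_zero_iff.2 hx, zero_mul, add_zero] at h1
      exact h1
  conv_lhs => rw [← hdiv, map_add, functional_mul_eq_zero ho hq, add_zero, hrem, map_sum]
  refine Finset.sum_congr rfl fun x _ => ?_
  rw [← smul_eq_C_mul, map_smul, smul_eq_mul, mul_comm]

/-- A positive quadrature for `μ` with `k` nodes in `[-1, s]`, exact in degrees `≤ 2k - 2`. -/
structure LowerQuadrature (μ : ℝ[X] →ₗ[ℝ] ℝ) (k : ℕ) (s : ℝ) (N : Finset ℝ) (w : ℝ → ℝ) :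
    Prop where
  card_eq : N.card = k
  pos : ∀ x ∈ N, 0 < w x
  ge : ∀ x ∈ N, -1 ≤ x
  le : ∀ x ∈ N, x ≤ s
  exact : ∀ f : ℝ[X], f.natDegree ≤ 2 * k - 2 → μ f = ∑ x ∈ N, w x * f.eval x

theorem card_le_of_eval_eq_zero {g : ℝ[X]} (hg : g ≠ 0) {N : Finset ℝ}
    (h : ∀ x ∈ N, g.eval x = 0) : N.card ≤ g.natDegree :=
  card_le_degree_of_subset_roots (Multiset.subset_iff.2 fun {x} hx =>
    (mem_roots hg).2 (h x hx))

theorem HasPosLead.exists_root_ge {p : ℝ[X]} {d : ℕ} (hp : HasPosLead p (d + 1)) {s : ℝ}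
    (hs : p.eval s ≤ 0) : ∃ z, s ≤ z ∧ p.eval z = 0 := by
  have hdeg : 0 < p.degree := by
    rw [degree_eq_natDegree hp.ne_zero, hp.natDegree_eq]; exact_mod_cast Nat.succ_pos d
  have ht := p.tendsto_atTop_of_leadingCoeff_nonneg hdeg hp.leadingCoeff_pos.le
  obtain ⟨M, hM, hsM⟩ := ((ht.eventually_ge_atTop 0).and (Filter.eventually_ge_atTop s)).exists
  obtain ⟨z, hz, hz0⟩ := intermediate_value_Icc hsM p.continuous.continuousOn ⟨hs, hM⟩
  exact ⟨z, hz.1, hz0⟩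

namespace LowerQuadrature

variable {μ : ℝ[X] →ₗ[ℝ] ℝ} {k : ℕ} {s : ℝ} {N : Finset ℝ} {w : ℝ → ℝ}

/-- Otherwise p = (t - z) g with z ≥ s. Orthogonality gives μ(p g) = 0, while the quadrature writes
this as a sum of the nonpositive terms w (x - z) g(x)². So g would vanish at k - 1 or more nodes,
more than its degree allows. -/
theorem eval_pos (hQ : LowerQuadrature μ k s N w) {p : ℝ[X]} {j : ℕ} (hj : j < k)
    (hp : HasPosLead p j) (ho : ∀ d < j, μ (p * X ^ d) = 0) {t : ℝ} (hst : s ≤ t) :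
    0 < p.eval t := by
  rcases j with _ | j
  · rw [eq_C_of_natDegree_le_zero hp.1, eval_C]; exact hp.2
  by_contra! hle
  obtain ⟨z, hz, hz0⟩ := hp.exists_root_ge hle
  obtain ⟨g, rfl⟩ := dvd_iff_isRoot.2 hz0
  have hg : g ≠ 0 := right_ne_zero_of_mul hp.ne_zero
  have hgd : g.natDegree = j := by
    have := hp.natDegree_eq
    rw [natDegree_mul (X_sub_C_ne_zero z) hg, natDegree_X_sub_C] at this
    omega
  have h0 : μ ((X - C z) * g * g) = 0 := by
    refine functional_mul_eq_zero ho ?_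
    rw [degree_eq_natDegree hg, hgd]
    exact_mod_cast Nat.lt_succ_self j
  rw [hQ.exact _ ?_, ← neg_eq_zero, ← Finset.sum_neg_distrib,
    Finset.sum_eq_zero_iff_of_nonneg] at h0
  · have hr : ∀ x ∈ N.erase z, g.eval x = 0 := by
      intro x hx
      obtain ⟨hxz, hxN⟩ := Finset.mem_erase.1 hx
      have h1 := h0 x hxN
      simp only [eval_mul, eval_sub, eval_X, eval_C, neg_eq_zero] at h1
      rcases mul_eq_zero.1 h1 with h | h
      · exact absurd h (hQ.pos x hxN).ne'
      · rcases mul_eq_zero.1 h with h | h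
        · exact (mul_eq_zero.1 h).resolve_left (sub_ne_zero.2 hxz)
        · exact h
    have h1 := card_le_of_eval_eq_zero hg hr
    have h2 := Finset.pred_card_le_card_erase (s := N) (a := z)
    have := hQ.card_eq
    omega
  · intro x hx
    simp only [eval_mul, eval_sub, eval_X, eval_C]
    have h1 : x - z ≤ 0 := by have := hQ.le x hx; linarith
    have h2 := (hQ.pos x hx).le
    have : w x * ((x - z) * g.eval x * g.eval x) = w x * (g.eval x) ^ 2 * (x - z) := by ring
    rw [this, neg_nonneg]
    exact mul_nonpos_of_nonneg_of_nonpos (mul_nonneg h2 (sq_nonneg _)) h1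
  · rw [natDegree_mul hp.ne_zero hg, hp.natDegree_eq, hgd]; omega

/-- Orthogonality to degrees below k - 1 gives at least k - 1 sign changes in (-1, 1). If one zero β
is left outside, q g with g the nodal polynomial of the sign changes other than s has constant sign
on the quadrature nodes and integral zero. This forces β to be a quadrature node, hence β = -1. -/
theorem eq_C_mul_nodal (hμ : StrictlyPositive μ) (hQ : LowerQuadrature μ k s N w) (hk : 1 ≤ k)
    (hs1 : s < 1) {q : ℝ[X]} (hq : HasPosLead q k) (ho : ∀ d, d + 1 < k → μ (q * X ^ d) = 0)
    (hqs : q.eval s = 0) :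
    ∃ S : Finset ℝ, S.card = k ∧ (∀ x ∈ S, x ∈ Set.Ico (-1 : ℝ) 1) ∧ s ∈ S ∧
      ((∀ x ∈ N, -1 < x) → ∀ x ∈ S, -1 < x) ∧ q = C q.leadingCoeff * Lagrange.nodal S id := by
  have hNne : N.Nonempty := Finset.card_pos.1 (by rw [hQ.card_eq]; omega)
  obtain ⟨x₀, hx₀⟩ := hNne
  have hs0 : -1 ≤ s := (hQ.ge x₀ hx₀).trans (hQ.le x₀ hx₀)
  rcases hk.eq_or_lt with rfl | hk
  · obtain ⟨g, hg⟩ := dvd_iff_isRoot.2 hqs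
    have hg0 : g ≠ 0 := by rintro rfl; exact hq.ne_zero (by rw [hg, mul_zero])
    have hgd : g.natDegree = 0 := by
      have := hq.natDegree_eq
      rw [hg, natDegree_mul (X_sub_C_ne_zero s) hg0, natDegree_X_sub_C] at this
      omega
    refine ⟨{s}, Finset.card_singleton s, by simpa using ⟨hs0, hs1⟩, Finset.mem_singleton_self s,
      fun h x hx => ?_, ?_⟩
    · rw [Finset.mem_singleton.1 hx]
      exact (h x₀ hx₀).trans_le (hQ.le x₀ hx₀)
    · rw [eq_C_of_natDegree_eq_zero hgd] at hg
      have hl : q.leadingCoeff = g.coeff 0 := by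
        rw [hg, leadingCoeff_mul, leadingCoeff_X_sub_C, one_mul, leadingCoeff_C]
      rw [hl, mul_comm]
      simpa [Lagrange.nodal_eq] using hg
  -- This strict inequality, which keeps s distinct from a zero at -1, needs two quadrature nodes;
  -- for k = 1, treated above, s = -1 is not excluded.
  have hs0' : -1 < s := by
    obtain ⟨x, hx, y, hy, hxy⟩ := Finset.one_lt_card.1 (by rw [hQ.card_eq]; exact hk : 1 < N.card)
    rcases hxy.lt_or_gt with h | h
    · exact ((hQ.ge x hx).trans_lt h).trans_le (hQ.le y hy)
    · exact ((hQ.ge y hy).trans_lt h).trans_le (hQ.le x hx)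
  obtain ⟨S, h, hr, hS, hfac, hsign⟩ := hμ.exists_zeros hq.ne_zero (r := k - 1)
    fun d hd => ho d (by omega)
  have hh : h ≠ 0 := by rintro rfl; exact hq.ne_zero (by rw [hfac, mul_zero])
  have hdeg : k = S.card + h.natDegree := by
    rw [← hq.natDegree_eq, hfac, natDegree_mul Lagrange.nodal_ne_zero hh, Lagrange.natDegree_nodal]
  have hlead : q.leadingCoeff = h.leadingCoeff := by
    rw [hfac, leadingCoeff_mul, Lagrange.nodal_monic.leadingCoeff, one_mul]
  rcases Nat.eq_zero_or_pos h.natDegree with hd0 | hd1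
  · have hfac' : q = C q.leadingCoeff * Lagrange.nodal S id := by
      rw [hlead, leadingCoeff, hd0, mul_comm, ← eq_C_of_natDegree_eq_zero hd0]
      exact hfac
    refine ⟨S, by omega, fun x hx => ⟨(hS x hx).1.le, (hS x hx).2⟩, ?_,
      fun _ x hx => (hS x hx).1, hfac'⟩
    rw [hfac', eval_mul, eval_C] at hqs
    exact eval_nodal_id_eq_zero_iff.1 ((mul_eq_zero.1 hqs).resolve_left hq.leadingCoeff_pos.ne')
  have hd1' : h.natDegree = 1 := by omega
  set c := h.leadingCoeff with hc
  have hc0 : 0 < c := by rw [← hlead]; exact hq.leadingCoeff_pos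
  set β := -(h.coeff 0) / c with hβ
  have hlin : h = C c * (X - C β) := by
    conv_lhs => rw [eq_X_add_C_of_natDegree_le_one hd1'.le]
    have e1 : h.coeff 1 = c := by rw [hc, leadingCoeff, hd1']
    rw [e1, mul_sub, ← C_mul, hβ, mul_div_cancel₀ _ hc0.ne', C_neg, sub_neg_eq_add]
  have hβ1 : 0 ≤ (β + 1) * (β - 1) := by
    have e : ∀ t, h.eval t = c * (t - β) := fun t => by
      conv_lhs => rw [hlin]
      simp
    have h1 : 0 ≤ h.eval (-1) * h.eval 1 := by
      rcases hsign with hs | hs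
      · exact mul_nonneg (hs _ ⟨le_refl _, by norm_num⟩) (hs _ ⟨by norm_num, le_refl _⟩)
      · exact mul_nonneg_of_nonpos_of_nonpos (hs _ ⟨le_refl _, by norm_num⟩)
          (hs _ ⟨by norm_num, le_refl _⟩)
    rw [e, e] at h1
    have h2 : c * (-1 - β) * (c * (1 - β)) = c ^ 2 * ((β + 1) * (β - 1)) := by ring
    rw [h2] at h1
    exact nonneg_of_mul_nonneg_right h1 (by positivity)
  have hβout : β ≤ -1 ∨ 1 ≤ β := by
    by_contra! hcon
    nlinarith [hcon.1, hcon.2]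
  have hsS : s ∈ S := by
    rw [hfac, eval_mul, hlin] at hqs
    refine eval_nodal_id_eq_zero_iff.1 ((mul_eq_zero.1 hqs).resolve_right ?_)
    simp only [eval_mul, eval_C, eval_sub, eval_X]
    refine mul_ne_zero hc0.ne' (sub_ne_zero.2 ?_)
    rcases hβout with h | h
    · exact (h.trans_lt hs0').ne'
    · exact (hs1.trans_le h).ne
  set g := Lagrange.nodal (S.erase s) (id : ℝ → ℝ) with hg
  have hg0 : g ≠ 0 := Lagrange.nodal_ne_zero
  have hgd : g.natDegree = k - 2 := by
    rw [hg, Lagrange.natDegree_nodal, Finset.card_erase_of_mem hsS]; omega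
  have hSg : Lagrange.nodal S id = (X - C s) * g := Lagrange.nodal_eq_mul_nodal_erase hsS
  have h0 : μ (q * g) = 0 := by
    refine functional_mul_eq_zero (r := k - 1) (fun d hd => ho d (by omega)) ?_
    rw [degree_eq_natDegree hg0, hgd]
    exact_mod_cast (by omega : k - 2 < k - 1)
  have hev : ∀ x, (q * g).eval x = c * (x - s) * (x - β) * (g.eval x) ^ 2 := fun x => by
    rw [hfac, hSg, hlin]
    simp only [eval_mul, eval_sub, eval_X, eval_C]
    ring
  rw [hQ.exact _ (by rw [natDegree_mul hq.ne_zero hg0, hq.natDegree_eq, hgd]; omega)] at h0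
  have hzero : ∀ x ∈ N, w x * (q * g).eval x = 0 := by
    rcases hβout with hb | hb
    · have h1 : ∑ x ∈ N, -(w x * (q * g).eval x) = 0 := by
        rw [Finset.sum_neg_distrib, h0, neg_zero]
      rw [Finset.sum_eq_zero_iff_of_nonneg] at h1
      · exact fun x hx => neg_eq_zero.1 (h1 x hx)
      · intro x hx
        have a1 := hQ.ge x hx
        have a2 := hQ.le x hx
        rw [hev, show -(w x * (c * (x - s) * (x - β) * g.eval x ^ 2)) =
          w x * (c * (s - x) * (x - β) * g.eval x ^ 2) by ring]
        exact mul_nonneg (hQ.pos x hx).le (mul_nonneg (mul_nonneg (mul_nonneg hc0.le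
          (by linarith)) (by linarith)) (sq_nonneg _))
    · rw [Finset.sum_eq_zero_iff_of_nonneg] at h0
      · exact h0
      · intro x hx
        have a2 := hQ.le x hx
        rw [hev, show w x * (c * (x - s) * (x - β) * g.eval x ^ 2) =
          w x * (c * (s - x) * (β - x) * g.eval x ^ 2) by ring]
        exact mul_nonneg (hQ.pos x hx).le (mul_nonneg (mul_nonneg (mul_nonneg hc0.le
          (by linarith)) (by linarith)) (sq_nonneg _))
  have hβN : β ∈ N := by
    by_contra hβN
    have hr : ∀ x ∈ N.erase s, g.eval x = 0 := by
      intro x hx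
      obtain ⟨hxs, hxN⟩ := Finset.mem_erase.1 hx
      have h1 := hzero x hxN
      rw [hev] at h1
      have hxβ : x ≠ β := by rintro rfl; exact hβN hxN
      have := (mul_eq_zero.1 h1).resolve_left (hQ.pos x hxN).ne'
      exact pow_eq_zero_iff two_ne_zero |>.1 ((mul_eq_zero.1 this).resolve_left
        (mul_ne_zero (mul_ne_zero hc0.ne' (sub_ne_zero.2 hxs)) (sub_ne_zero.2 hxβ)))
    have h1 := card_le_of_eval_eq_zero hg0 hr
    have h2 := Finset.pred_card_le_card_erase (s := N) (a := s)
    have := hQ.card_eq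
    omega
  have hβeq : β = -1 := by
    rcases hβout with h | h
    · exact le_antisymm h (hQ.ge β hβN)
    · have := hQ.le β hβN; linarith
  have hβS : β ∉ S := fun h => by have := (hS β h).1; linarith
  refine ⟨insert β S, by rw [Finset.card_insert_of_notMem hβS]; omega, fun x hx => ?_,
    Finset.mem_insert_of_mem hsS, fun hN => absurd (hN β hβN) (by rw [hβeq]; exact lt_irrefl _), ?_⟩
  · rcases Finset.mem_insert.1 hx with rfl | hx
    · rw [hβeq]; exact ⟨le_refl _, by norm_num⟩
    · exact ⟨(hS x hx).1.le, (hS x hx).2⟩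
  · rw [Lagrange.nodal_insert_eq_nodal hβS, hlead]
    conv_lhs => rw [hfac, hlin]
    simp only [id]
    ring

end LowerQuadrature

end

end SphericalCodes

/-! ### Positive quadratures supplied by the Levenshtein interval -/

namespace SphericalCodes

open Polynomial

noncomputable section

theorem adjPoly_eq_C_mul_nodal {n : ℕ} (hn : 2 ≤ n) {ε : ℕ} (hε : ε = 0 ∨ ε = 1) (i : ℕ) :
    ∃ S : Finset ℝ, S.card = i ∧ (∀ x ∈ S, x ∈ Set.Ioo (-1 : ℝ) 1) ∧
      adjPoly n ε i = C (adjPoly n ε i).leadingCoeff * Lagrange.nodal S id ∧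
      (0 < i → greatestZero n i 1 ε ∈ S) ∧ (∀ x ∈ S, x ≤ greatestZero n i 1 ε) ∧
      -1 ≤ greatestZero n i 1 ε := by
  obtain ⟨S, hc, hS, he⟩ := (adjMean_strictlyPositive hn ε).eq_C_mul_nodal
    (adjPoly_hasPosLead hn ε i) (adjMean_adjPoly_mul_X_pow hn hε i)
  refine ⟨S, hc, hS, he, ?_⟩
  rcases Nat.eq_zero_or_pos i with rfl | hi
  · have : S = ∅ := Finset.card_eq_zero.1 hc
    subst this
    simp [greatestZero]
  · have hne : S.Nonempty := Finset.card_pos.1 (by omega)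
    have hset : greatestZero n i 1 ε = S.max' hne := by
      rw [greatestZero, if_neg hi.ne']
      obtain ⟨c, hc0, hcj⟩ := adjacentJacobi_eq hn hε i
      have h1 : jacobi i (((1 : ℕ) : ℝ) + ((n : ℝ) - 3) / 2) ((ε : ℝ) + ((n : ℝ) - 3) / 2) =
          adjacentJacobi n ε i := by
        rw [adjacentJacobi]; congr 1; push_cast; ring
      have h2 : {t : ℝ | (jacobi i (((1 : ℕ) : ℝ) + ((n : ℝ) - 3) / 2)
          ((ε : ℝ) + ((n : ℝ) - 3) / 2)).IsRoot t} = (S : Set ℝ) := by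
        ext t
        have hl := (adjPoly_hasPosLead hn ε i).leadingCoeff_pos
        rw [Set.mem_ofPred_eq, h1, hcj, he, IsRoot.def, eval_mul, eval_mul, eval_C, eval_C,
          mul_eq_zero, mul_eq_zero, or_iff_right hc0.ne', or_iff_right hl.ne',
          eval_nodal_id_eq_zero_iff, Finset.mem_coe]
      rw [h2]
      exact (Finset.isGreatest_max' S hne).csSup_eq
    rw [hset]
    exact ⟨fun _ => S.max'_mem hne, fun x hx => S.le_max' x hx,
      (hS _ (S.max'_mem hne)).1.le⟩

/-- The test function is nonnegative and vanishes at all nodes but one, so that node's weight must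
carry a positive integral. -/
theorem StrictlyPositive.weight_pos {μ : ℝ[X] →ₗ[ℝ] ℝ} (hμ : StrictlyPositive μ) {N : Finset ℝ}
    {w : ℝ → ℝ} {f : ℝ[X]} (hf : f ≠ 0) (h0 : ∀ t ∈ Set.Icc (-1 : ℝ) 1, 0 ≤ f.eval t)
    (hex : μ f = ∑ x ∈ N, w x * f.eval x) {x : ℝ} (hx : x ∈ N) (hx1 : x ∈ Set.Icc (-1 : ℝ) 1)
    (hv : ∀ y ∈ N, y ≠ x → f.eval y = 0) : 0 < w x := by
  have h1 := hμ f hf h0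
  rw [hex, Finset.sum_eq_single_of_mem x hx fun y hy hyx => by rw [hv y hy hyx, mul_zero]] at h1
  by_contra! hw
  exact absurd h1 (not_lt.2 (mul_nonpos_of_nonpos_of_nonneg hw (h0 x hx1)))

theorem nodal_id_ne_zero (S : Finset ℝ) : Lagrange.nodal S (id : ℝ → ℝ) ≠ 0 :=
  Lagrange.nodal_monic.ne_zero

theorem functional_nodal_mul_X_pow {μ : ℝ[X] →ₗ[ℝ] ℝ} {p : ℝ[X]} {S : Finset ℝ} {c : ℝ}
    (hc : c ≠ 0) (hp : p = C c * Lagrange.nodal S id) {r : ℕ} (ho : ∀ d < r, μ (p * X ^ d) = 0) :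
    ∀ d < r, μ (Lagrange.nodal S id * X ^ d) = 0 := by
  intro d hd
  have h1 := ho d hd
  rw [hp, mul_assoc, functional_C_mul] at h1
  exact (mul_eq_zero.1 h1).resolve_left hc

theorem adjMean_zero_one_add_mul {n : ℕ} (hn : 2 ≤ n) (f : ℝ[X]) :
    adjMean hn 0 ((1 + X) * f) = adjMean hn 1 f := by
  rw [adjMean_apply, adjMean_apply]
  congr 1
  ring

/-- The Radau quadrature with fixed node -1: the other nodes are the zeros of the orthogonal
polynomial for ε = 1, so the lower end t_j^{1,1} of the interval bounds them all by s. -/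
theorem exists_lowerQuadrature_zero {n : ℕ} (hn : 2 ≤ n) (j : ℕ) {s : ℝ}
    (hs : greatestZero n j 1 1 ≤ s) :
    ∃ N w, LowerQuadrature (adjMean hn 0) (j + 1) s N w := by
  obtain ⟨S, hc, hS, he, -, hle, hge⟩ := adjPoly_eq_C_mul_nodal hn (Or.inr rfl : (1 : ℕ) = 0 ∨ _) j
  have hS1 : (-1 : ℝ) ∉ S := fun h => (hS _ h).1.ne rfl
  have hnod : Lagrange.nodal (insert (-1) S) (id : ℝ → ℝ) = (1 + X) * Lagrange.nodal S id := by
    rw [Lagrange.nodal_insert_eq_nodal hS1]; simp [add_comm]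
  have hcard : (insert (-1) S).card = j + 1 := by rw [Finset.card_insert_of_notMem hS1, hc]
  have hex : ∀ f : ℝ[X], f.natDegree ≤ 2 * (j + 1) - 2 → adjMean hn 0 f =
      ∑ x ∈ insert (-1) S, adjMean hn 0 (Lagrange.basis (insert (-1) S) id x) * f.eval x := by
    intro f hf
    refine interpolatory_quadrature (r := j) ?_ ?_
    · intro d hd
      rw [hnod, mul_assoc, adjMean_zero_one_add_mul]
      exact functional_nodal_mul_X_pow (adjPoly_hasPosLead hn 1 j).leadingCoeff_pos.ne' he
        (adjMean_adjPoly_mul_X_pow hn (Or.inr rfl) j) d hd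
    · refine lt_of_le_of_lt degree_le_natDegree ?_
      rw [hcard]; exact_mod_cast (by omega)
  refine ⟨insert (-1) S, _, hcard, ?_, ?_, ?_, hex⟩
  · intro x hx
    rcases Finset.mem_insert.1 hx with rfl | hxS
    · refine (adjMean_strictlyPositive hn 0).weight_pos (pow_ne_zero 2 (nodal_id_ne_zero S)) ?_
        (hex _ ?_) hx ⟨le_rfl, by norm_num⟩ ?_
      · intro t _; rw [eval_pow]; positivity
      · rw [natDegree_pow, Lagrange.natDegree_nodal]; omega
      · intro y hy hyx
        rw [eval_pow, eval_nodal_id_eq_zero_iff.2 ((Finset.mem_insert.1 hy).resolve_left hyx),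
          zero_pow two_ne_zero]
    · refine (adjMean_strictlyPositive hn 0).weight_pos (mul_ne_zero one_add_X_ne_zero
        (pow_ne_zero 2 (nodal_id_ne_zero (S.erase x)))) ?_ (hex _ ?_) hx
        ⟨(hS x hxS).1.le, (hS x hxS).2.le⟩ ?_
      · intro t ht
        simp only [eval_mul, eval_add, eval_one, eval_X, eval_pow]
        have := ht.1
        exact mul_nonneg (by linarith) (sq_nonneg _)
      · refine natDegree_mul_le.trans ?_
        have h1 : (1 + X : ℝ[X]).natDegree ≤ 1 := by compute_degree
        rw [natDegree_pow, Lagrange.natDegree_nodal, Finset.card_erase_of_mem hxS]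
        have := Finset.card_pos.2 ⟨x, hxS⟩
        omega
      · intro y hy hyx
        rcases Finset.mem_insert.1 hy with rfl | hyS
        · simp
        · rw [eval_mul, eval_pow, eval_nodal_id_eq_zero_iff.2 (Finset.mem_erase.2 ⟨hyx, hyS⟩),
            zero_pow two_ne_zero, mul_zero]
  · intro x hx
    rcases Finset.mem_insert.1 hx with rfl | hx
    exacts [le_rfl, (hS x hx).1.le]
  · intro x hx
    rcases Finset.mem_insert.1 hx with rfl | hx
    exacts [hge.trans hs, (hle x hx).trans hs]

/-- The Gauss quadrature for ε = 0 with weights multiplied by 1 + x. The factor 1 + t costs one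
degree of exactness, which leaves 2k - 2. -/
theorem exists_lowerQuadrature_one {n : ℕ} (hn : 2 ≤ n) {k : ℕ} (hk : 1 ≤ k) {s : ℝ}
    (hs : greatestZero n k 1 0 ≤ s) :
    ∃ N w, LowerQuadrature (adjMean hn 1) k s N w ∧ ∀ x ∈ N, -1 < x := by
  obtain ⟨S, hc, hS, he, -, hle, -⟩ := adjPoly_eq_C_mul_nodal hn (Or.inl rfl : (0 : ℕ) = 0 ∨ _) k
  have hex : ∀ f : ℝ[X], f.degree < (k + k : ℕ) → adjMean hn 0 f =
      ∑ x ∈ S, adjMean hn 0 (Lagrange.basis S id x) * f.eval x := by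
    intro f hf
    refine interpolatory_quadrature (r := k) ?_ (by rwa [hc])
    exact functional_nodal_mul_X_pow (adjPoly_hasPosLead hn 0 k).leadingCoeff_pos.ne' he
      (adjMean_adjPoly_mul_X_pow hn (Or.inl rfl) k)
  refine ⟨S, fun x => adjMean hn 0 (Lagrange.basis S id x) * (1 + x), ⟨hc, ?_,
    fun x hx => (hS x hx).1.le, fun x hx => (hle x hx).trans hs, ?_⟩, fun x hx => (hS x hx).1⟩
  · intro x hx
    have hk := Finset.card_pos.2 ⟨x, hx⟩
    have h1 := (hS x hx).1
    refine mul_pos ?_ (by linarith)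
    refine (adjMean_strictlyPositive hn 0).weight_pos
      (pow_ne_zero 2 (nodal_id_ne_zero (S.erase x))) ?_ (hex _ ?_) hx
        ⟨(hS x hx).1.le, (hS x hx).2.le⟩ ?_
    · intro t _; rw [eval_pow]; positivity
    · refine lt_of_le_of_lt degree_le_natDegree ?_
      rw [natDegree_pow, Lagrange.natDegree_nodal, Finset.card_erase_of_mem hx]
      exact_mod_cast (by omega)
    · intro y hy hyx
      rw [eval_pow, eval_nodal_id_eq_zero_iff.2 (Finset.mem_erase.2 ⟨hyx, hy⟩),
        zero_pow two_ne_zero]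
  · intro f hf
    rw [← adjMean_zero_one_add_mul, hex]
    · refine Finset.sum_congr rfl fun x _ => ?_
      simp only [eval_mul, eval_add, eval_one, eval_X]
      ring
    · rcases eq_or_ne f 0 with rfl | hf0
      · simp only [mul_zero, degree_zero]; exact WithBot.bot_lt_coe _
      refine lt_of_le_of_lt (degree_mul_le _ _) ?_
      have h1 : (1 + X : ℝ[X]).degree ≤ 1 := by compute_degree
      refine lt_of_le_of_lt (add_le_add h1 degree_le_natDegree) ?_
      exact_mod_cast (by omega)

end

end SphericalCodes

/-! ### Levenshtein nodes and the Levenshtein polynomial -/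

namespace SphericalCodes

open Polynomial

noncomputable section

/-- The polynomial `O_k(t) O_{k-1}(s) - O_k(s) O_{k-1}(t)`. -/
def nodeFactor (n k ε : ℕ) (s : ℝ) : ℝ[X] :=
  C ((adjPoly n ε (k - 1)).eval s) * adjPoly n ε k
    + C (-(adjPoly n ε k).eval s) * adjPoly n ε (k - 1)

/-- The reproducing property of g at s: p - p(s) is a multiple of t - s, and the corresponding
product with g is annihilated. -/
theorem functional_mul_eq_eval_mul {μ : ℝ[X] →ₗ[ℝ] ℝ} {g p : ℝ[X]} {s : ℝ} {r : ℕ}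
    (ho : ∀ d < r, μ ((X - C s) * g * X ^ d) = 0) (hp : p.natDegree ≤ r) :
    μ (g * p) = p.eval s * μ g := by
  have hdiv := modByMonic_add_div p (X - C s)
  rw [modByMonic_X_sub_C_eq_C_eval] at hdiv
  have hq : (p /ₘ (X - C s)).degree < r := by
    by_cases h0 : p /ₘ (X - C s) = 0
    · rw [h0, degree_zero]; exact WithBot.bot_lt_coe _
    · rw [← natDegree_lt_iff_degree_lt h0, natDegree_divByMonic p (monic_X_sub_C s), natDegree_X_sub_C]
      have : p.natDegree ≠ 0 := by
        intro hz
        apply h0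
        rw [divByMonic_eq_zero_iff (monic_X_sub_C s), degree_X_sub_C]
        refine lt_of_le_of_lt degree_le_natDegree ?_
        rw [hz]; norm_num
      omega
  have h1 := functional_mul_eq_zero ho hq
  rw [← functional_C_mul]
  conv_lhs => rw [← hdiv]
  rw [show g * (C (p.eval s) + (X - C s) * (p /ₘ (X - C s))) =
    C (p.eval s) * g + (X - C s) * g * (p /ₘ (X - C s)) by ring, map_add, h1, add_zero]

theorem hasPosLead_nodal (S : Finset ℝ) : HasPosLead (Lagrange.nodal S id) S.card := by
  refine ⟨Lagrange.natDegree_nodal.le, ?_⟩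
  have h1 : (Lagrange.nodal S (id : ℝ → ℝ)).Monic := Lagrange.nodal_monic
  have h2 := h1.coeff_natDegree
  rw [Lagrange.natDegree_nodal] at h2
  rw [h2]; exact one_pos

/-- The Christoffel–Darboux kernel in disguise: the reproducing property makes the i-th coefficient
O_i(s) μ(g) / μ(O_i²), and μ(g) > 0 follows by testing against O_{k-1}. -/
theorem StrictlyPositive.nodal_erase_eq_sum {μ : ℝ[X] →ₗ[ℝ] ℝ} (hμ : StrictlyPositive μ)
    {O : ℕ → ℝ[X]} (hO : ∀ j, HasPosLead (O j) j) (ho : ∀ j, ∀ d < j, μ (O j * X ^ d) = 0)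
    {S : Finset ℝ} {k : ℕ} (hk : 1 ≤ k) (hS : S.card = k) {s : ℝ} (hs : s ∈ S)
    (hq : ∀ d, d + 1 < k → μ (Lagrange.nodal S id * X ^ d) = 0)
    (hpos : ∀ j < k, 0 < (O j).eval s) :
    ∃ d : ℕ → ℝ, (∀ i < k, 0 < d i) ∧
      Lagrange.nodal (S.erase s) id = ∑ i ∈ Finset.range k, C (d i) * O i := by
  set g : ℝ[X] := Lagrange.nodal (S.erase s) id with hg
  have hSg : Lagrange.nodal S id = (X - C s) * g := by
    rw [hg, Lagrange.nodal_eq_mul_nodal_erase hs]; rfl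
  have hgd : HasPosLead g (k - 1) := by
    have := hasPosLead_nodal (S.erase s)
    rwa [Finset.card_erase_of_mem hs, hS] at this
  have horth : ∀ d < k - 1, μ ((X - C s) * g * X ^ d) = 0 := by
    intro d hd
    rw [← hSg]; exact hq d (by omega)
  have hev : ∀ j < k, μ (g * O j) = (O j).eval s * μ g := fun j hj =>
    functional_mul_eq_eval_mul horth ((hO j).natDegree_eq.le.trans (by omega))
  have hμg : 0 < μ g := by
    have h1 := hμ.mul_pos_of_hasPosLead hgd (hO (k - 1)) (ho (k - 1))
    rw [hev _ (by omega)] at h1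
    exact (pos_iff_pos_of_mul_pos h1).1 (hpos _ (by omega))
  refine ⟨_, fun i hi => ?_, hμ.eq_sum hO ho (N := k) ?_⟩
  · rw [hev i hi]
    exact div_pos (mul_pos (hpos i hi) hμg) (hμ.sq (hO i).ne_zero)
  · rw [hgd.degree_eq]; exact_mod_cast (by omega)

/-- The properties of the zeros of `nodeFactor n k ε s` for `s` in the Levenshtein interval. -/
structure LevenshteinNodes (n k ε : ℕ) (s : ℝ) (S : Finset ℝ) : Prop where
  one_le : 1 ≤ k
  card_eq : S.card = k
  mem_Ico : ∀ x ∈ S, x ∈ Set.Ico (-1 : ℝ) 1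
  mem : s ∈ S
  neg_one_notMem : ε = 1 → (-1 : ℝ) ∉ S
  eq_nodal : nodeFactor n k ε s = C (nodeFactor n k ε s).leadingCoeff * Lagrange.nodal S id
  lead_pos : 0 < (nodeFactor n k ε s).leadingCoeff
  eval_pos : ∀ j < k, 0 < (adjPoly n ε j).eval s
  eval_nonpos : (adjPoly n ε k).eval s ≤ 0
  exists_eq_sum : ∃ d : ℕ → ℝ, (∀ i < k, 0 < d i) ∧
      Lagrange.nodal (S.erase s) id = ∑ i ∈ Finset.range k, C (d i) * adjPoly n ε i

theorem exists_levenshteinNodes {n k ε : ℕ} (hn : 2 ≤ n) (hk : 1 ≤ k) (hε : ε = 0 ∨ ε = 1)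
    {s : ℝ} (hs : s ∈ levenshteinInterval n k ε) : ∃ S, LevenshteinNodes n k ε s S := by
  have hQ : ∃ N w, LowerQuadrature (adjMean hn ε) k s N w ∧ (ε = 1 → ∀ x ∈ N, -1 < x) := by
    rcases hε with rfl | rfl
    · rw [levenshteinInterval, if_pos rfl] at hs
      obtain ⟨N, w, h⟩ := exists_lowerQuadrature_zero hn (k - 1) hs.1
      rw [Nat.sub_add_cancel hk] at h
      exact ⟨N, w, h, by simp⟩
    · rw [levenshteinInterval, if_neg one_ne_zero] at hs
      obtain ⟨N, w, h, h'⟩ := exists_lowerQuadrature_one hn hk hs.1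
      exact ⟨N, w, h, fun _ => h'⟩
  obtain ⟨N, w, hQ, hN⟩ := hQ
  have hsz : s ≤ greatestZero n k 1 ε := by
    rcases hε with rfl | rfl
    · rw [levenshteinInterval, if_pos rfl] at hs; exact hs.2
    · rw [levenshteinInterval, if_neg one_ne_zero] at hs; exact hs.2
  obtain ⟨Z, -, hZ, hZe, hz, -, -⟩ := adjPoly_eq_C_mul_nodal hn hε k
  have hz := hz hk
  set z := greatestZero n k 1 ε with hzdef
  have hz0 : (adjPoly n ε k).eval z = 0 := by
    rw [hZe, eval_mul, eval_nodal_id_eq_zero_iff.2 hz, mul_zero]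
  have hs1 : s < 1 := hsz.trans_lt (hZ z hz).2
  have hO := adjPoly_hasPosLead hn ε
  have ho := adjMean_adjPoly_mul_X_pow hn hε
  have hpos : ∀ j < k, ∀ t, s ≤ t → 0 < (adjPoly n ε j).eval t := fun j hj t ht =>
    hQ.eval_pos hj (hO j) (ho j) ht
  have hq : HasPosLead (nodeFactor n k ε s) k := by
    refine HasPosLead.add_lower ((hO k).C_mul (hpos _ (by omega) s le_rfl)) ?_
    exact lt_of_le_of_lt (natDegree_C_mul_le _ _) (by rw [(hO _).natDegree_eq]; omega)
  have hqo : ∀ d, d + 1 < k → adjMean hn ε (nodeFactor n k ε s * X ^ d) = 0 := by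
    intro d hd
    rw [nodeFactor, add_mul, mul_assoc, mul_assoc, map_add, functional_C_mul, functional_C_mul,
      ho k d (by omega), ho (k - 1) d (by omega)]
    ring
  obtain ⟨S, hc, hS, hsS, hS1, he⟩ := hQ.eq_C_mul_nodal (adjMean_strictlyPositive hn ε) hk hs1 hq hqo
    (by rw [nodeFactor]; simp only [eval_add, eval_mul, eval_C]; ring)
  have hlead := hq.leadingCoeff_pos
  have hsum := (adjMean_strictlyPositive hn ε).nodal_erase_eq_sum hO ho hk hc hsS
    (fun d hd => by
      have h1 := hqo d hd
      rw [he, mul_assoc, functional_C_mul] at h1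
      exact (mul_eq_zero.1 h1).resolve_left hlead.ne') (fun j hj => hpos j hj s le_rfl)
  refine ⟨S, hk, hc, hS, hsS, fun h1 hm => (hS1 (hN h1) _ hm).ne rfl, he, hlead,
    fun j hj => hpos j hj s le_rfl, ?_, hsum⟩
  obtain ⟨d, hd, hg⟩ := hsum
  -- The sign of O_k(s) is read off at the greatest zero z ≥ s of O_k, where only the second term
  -- survives; by the factorization the value is nonnegative, and O_{k-1}(z) > 0.
  have h1 : (nodeFactor n k ε s).eval z =
      -(adjPoly n ε k).eval s * (adjPoly n ε (k - 1)).eval z := by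
    rw [nodeFactor]; simp only [eval_add, eval_mul, eval_C, hz0]; ring
  have h2 : 0 ≤ (nodeFactor n k ε s).eval z := by
    rw [he, Lagrange.nodal_eq_mul_nodal_erase hsS, hg]
    simp only [eval_mul, eval_C, eval_sub, eval_X, id, eval_finsetSum]
    refine mul_nonneg hlead.le (mul_nonneg (by linarith) (Finset.sum_nonneg fun i hi => ?_))
    have hi := Finset.mem_range.1 hi
    exact mul_nonneg (hd i hi).le (hpos i hi z hsz).le
  rw [h1] at h2
  have h3 := hpos (k - 1) (by omega) z hsz
  by_contra! h4
  nlinarith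

theorem count_nodeMultiset_le_two (n k ε : ℕ) (s a : ℝ) :
    (nodeMultiset n k ε s).count a ≤ 2 := by
  rw [nodeMultiset]
  refine (Multiset.count_le_of_le a (tsub_le_self.trans tsub_le_self)).trans ?_
  rw [Multiset.count_nsmul]
  have := Multiset.nodup_iff_count_le_one.1 (nodes n k ε s).nodup a
  omega

namespace LevenshteinNodes

variable {n k ε : ℕ} {s : ℝ} {S : Finset ℝ}

theorem nodes_eq (hn : 2 ≤ n) (hε : ε = 0 ∨ ε = 1) (hS : LevenshteinNodes n k ε s S) :
    nodes n k ε s = if ε = 0 then S else insert (-1) S := by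
  obtain ⟨a, ha, hak⟩ := adjacentJacobi_eq hn hε k
  obtain ⟨b, hb, hbk⟩ := adjacentJacobi_eq hn hε (k - 1)
  have h1 : (X + 1 : ℝ[X]) ^ ε * (adjacentJacobi n ε k * C ((adjacentJacobi n ε (k - 1)).eval s)
      - C ((adjacentJacobi n ε k).eval s) * adjacentJacobi n ε (k - 1)) =
      C (a * b * (nodeFactor n k ε s).leadingCoeff) *
        ((X + 1) ^ ε * Lagrange.nodal S id) := by
    rw [map_mul, mul_assoc, mul_left_comm _ ((X + 1 : ℝ[X]) ^ ε), ← hS.eq_nodal, hak, hbk, nodeFactor]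
    simp only [eval_mul, eval_C, map_mul, map_neg]
    ring
  have hc : a * b * (nodeFactor n k ε s).leadingCoeff ≠ 0 :=
    (mul_pos (mul_pos ha hb) hS.lead_pos).ne'
  ext t
  rw [nodes, h1, Multiset.mem_toFinset, roots_C_mul _ hc, mem_roots (mul_ne_zero
    (pow_ne_zero _ X_add_one_ne_zero) (nodal_id_ne_zero S)), IsRoot.def, eval_mul, mul_eq_zero,
    eval_nodal_id_eq_zero_iff]
  rcases hε with rfl | rfl
  · simp
  · simp [add_eq_zero_iff_eq_neg]

theorem nodeMultiset_eq (hn : 2 ≤ n) (hε : ε = 0 ∨ ε = 1) (hS : LevenshteinNodes n k ε s S) :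
    nodeMultiset n k ε s = (if ε = 0 then 0 else {-1}) + {s} + 2 • (S.erase s).val := by
  rw [nodeMultiset, hS.nodes_eq hn hε]
  have hcount : ∀ (U : Finset ℝ) (a : ℝ), U.val.count a = if a ∈ U then 1 else 0 := fun U a =>
    Multiset.count_eq_of_nodup U.nodup
  ext a
  have hs := hS.mem
  rcases hε with rfl | rfl
  · simp only [if_true, Multiset.count_sub, Multiset.count_add, Multiset.count_nsmul, hcount,
      Finset.mem_erase, Multiset.count_singleton, Multiset.count_zero]
    by_cases h1 : a = s
    · subst h1; simp [hs]
    · by_cases h2 : a ∈ S <;> simp [h1, h2]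
  · have h3 := hS.neg_one_notMem rfl
    simp only [if_neg one_ne_zero, Multiset.count_sub, Multiset.count_add, Multiset.count_nsmul,
      hcount, Finset.mem_erase, Multiset.count_singleton, Finset.mem_insert]
    by_cases h1 : a = s
    · subst h1
      have : a ≠ -1 := by rintro rfl; exact h3 hs
      simp [hs, this]
    · by_cases h2 : a ∈ S
      · have : a ≠ -1 := by rintro rfl; exact h3 h2
        simp [h1, h2, this]
      · by_cases h4 : a = -1
        · subst h4; simp [h1, h2]
        · simp [h1, h2, h4]

theorem levenshteinPoly_eq (hn : 2 ≤ n) (hε : ε = 0 ∨ ε = 1) (hS : LevenshteinNodes n k ε s S) :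
    levenshteinPoly n k ε s = (1 + X) ^ ε * (X - C s) * Lagrange.nodal (S.erase s) id ^ 2 := by
  rw [levenshteinPoly, hS.nodeMultiset_eq hn hε, nodalPoly, Multiset.map_add, Multiset.prod_add,
    Multiset.map_add, Multiset.prod_add, Multiset.map_nsmul, Multiset.prod_nsmul]
  congr 1
  rcases hε with rfl | rfl
  · simp
  · simp [add_comm]

theorem card_nodeMultiset (hn : 2 ≤ n) (hε : ε = 0 ∨ ε = 1) (hS : LevenshteinNodes n k ε s S) :
    (nodeMultiset n k ε s).card = 2 * k - 1 + ε := by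
  rw [hS.nodeMultiset_eq hn hε]
  simp only [Multiset.card_add, Multiset.card_nsmul, Multiset.card_singleton, Finset.card_val,
    Finset.card_erase_of_mem hS.mem, hS.card_eq]
  have := hS.one_le
  rcases hε with rfl | rfl <;> simp <;> omega

theorem nodes_mem_Ico (hn : 2 ≤ n) (hε : ε = 0 ∨ ε = 1) (hS : LevenshteinNodes n k ε s S) :
    ∀ x ∈ nodes n k ε s, x ∈ Set.Ico (-1 : ℝ) 1 := by
  intro x hx
  rw [hS.nodes_eq hn hε] at hx
  split_ifs at hx
  · exact hS.mem_Ico x hx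
  · rcases Finset.mem_insert.1 hx with rfl | hx
    exacts [⟨le_rfl, by norm_num⟩, hS.mem_Ico x hx]

theorem mem_nodes (hn : 2 ≤ n) (hε : ε = 0 ∨ ε = 1) (hS : LevenshteinNodes n k ε s S) :
    s ∈ nodes n k ε s := by
  rw [hS.nodes_eq hn hε]
  split_ifs
  exacts [hS.mem, Finset.mem_insert_of_mem hS.mem]

theorem levenshteinPoly_eval_eq_zero_iff (hn : 2 ≤ n) (hε : ε = 0 ∨ ε = 1)
    (hS : LevenshteinNodes n k ε s S) (t : ℝ) :
    (levenshteinPoly n k ε s).eval t = 0 ↔ t ∈ nodes n k ε s := by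
  rw [hS.levenshteinPoly_eq hn hε, hS.nodes_eq hn hε]
  simp only [eval_mul, eval_pow, eval_sub, eval_add, eval_one, eval_X, eval_C, mul_eq_zero,
    pow_eq_zero_iff two_ne_zero, eval_nodal_id_eq_zero_iff, sub_eq_zero, Finset.mem_erase]
  have := hS.mem
  have h2 : t = s ∨ t ≠ s ∧ t ∈ S ↔ t ∈ S := by
    by_cases h : t = s
    · subst h; simpa
    · simp [h]
  rcases hε with rfl | rfl
  · simp [h2]
  · have h3 : 1 + t = 0 ↔ t = -1 := by constructor <;> intro h <;> linarith
    simp [or_assoc, h2, h3]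

theorem levenshteinPoly_eval_nonpos (hn : 2 ≤ n) (hε : ε = 0 ∨ ε = 1)
    (hS : LevenshteinNodes n k ε s S) {t : ℝ} (ht : t ∈ Set.Icc (-1) s) :
    (levenshteinPoly n k ε s).eval t ≤ 0 := by
  rw [hS.levenshteinPoly_eq hn hε]
  simp only [eval_mul, eval_pow, eval_sub, eval_add, eval_one, eval_X, eval_C]
  have h1 := ht.1
  have h2 := ht.2
  exact mul_nonpos_of_nonpos_of_nonneg (mul_nonpos_of_nonneg_of_nonpos
    (pow_nonneg (by linarith) _) (by linarith)) (sq_nonneg _)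

/-- The polynomial is a positive multiple of a product of two factors: one has positive Gegenbauer
coefficients in degrees 0, …, k + ε, the other in degrees 0, …, k - 1. The sign O_k(s) ≤ 0 keeps the
first factor free of cancellation. -/
theorem gegenbauerCoeff_levenshteinPoly_pos (hn : 2 ≤ n) (hε : ε = 0 ∨ ε = 1)
    (hS : LevenshteinNodes n k ε s S) {i : ℕ} (hi : i ≤ 2 * k - 1 + ε) :
    0 < gegenbauerCoeff n i (levenshteinPoly n k ε s) := by
  have hk := hS.one_le
  have hpos : ∀ j, ∀ i ≤ j + ε, GegPosAt hn ((1 + X) ^ ε * adjPoly n ε j) i := by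
    intro j i hij
    rcases hε with rfl | rfl
    · rw [pow_zero, one_mul, adjPoly, if_pos rfl]; exact gegPosAt_adjJ hn hij
    · rw [pow_one, adjPoly, if_neg one_ne_zero]; exact gegPosAt_one_add_X_mul_adjH hn j i hij
  have hadj : ∀ j, GegPosAt hn (adjPoly n ε j) j := by
    intro j
    rw [adjPoly]
    split_ifs
    exacts [gegPosAt_adjJ hn le_rfl, gegPosAt_adjH hn j]
  obtain ⟨d, hd, hg⟩ := hS.exists_eq_sum
  have hgpos : ∀ j < k, GegPosAt hn (Lagrange.nodal (S.erase s) id) j := by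
    intro j hj
    rw [hg, ← Finset.add_sum_erase _ _ (Finset.mem_range.2 hj)]
    refine ((hadj j).C_mul (hd j hj)).add_right ?_
    refine Finset.sum_induction _ (GegNonneg hn) (fun _ _ => GegNonneg.add)
      (fun i => by simp) fun i hi => ?_
    exact ((hadj i).1.C_mul (hd i (Finset.mem_range.1 (Finset.mem_of_mem_erase hi))).le)
  have heq : levenshteinPoly n k ε s = C (nodeFactor n k ε s).leadingCoeff⁻¹ *
      ((C ((adjPoly n ε (k - 1)).eval s) * ((1 + X) ^ ε * adjPoly n ε k)
        + C (-(adjPoly n ε k).eval s) * ((1 + X) ^ ε * adjPoly n ε (k - 1)))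
        * Lagrange.nodal (S.erase s) id) := by
    have h1 : (C ((adjPoly n ε (k - 1)).eval s) * ((1 + X) ^ ε * adjPoly n ε k)
        + C (-(adjPoly n ε k).eval s) * ((1 + X) ^ ε * adjPoly n ε (k - 1))) =
        (1 + X) ^ ε * nodeFactor n k ε s := by rw [nodeFactor]; ring
    rw [h1, hS.eq_nodal, hS.levenshteinPoly_eq hn hε, leadingCoeff_mul, leadingCoeff_C,
      Lagrange.nodal_monic.leadingCoeff, mul_one, Lagrange.nodal_eq_mul_nodal_erase hS.mem]
    have h2 : (C (nodeFactor n k ε s).leadingCoeff⁻¹ * C (nodeFactor n k ε s).leadingCoeff : ℝ[X])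
        = 1 := by rw [← C_mul, inv_mul_cancel₀ hS.lead_pos.ne', C_1]
    simp only [id]
    linear_combination (-(1 + X) ^ ε * (X - C s) * Lagrange.nodal (S.erase s) id ^ 2) * h2
  rw [heq]
  refine GegPosAt.coeff_pos (hn := hn) (GegPosAt.C_mul ?_ (inv_pos.2 hS.lead_pos))
  obtain ⟨a, b, ha, hb, rfl⟩ : ∃ a b, a ≤ k + ε ∧ b < k ∧ i = a + b := by
    by_cases h : i ≤ k + ε
    · exact ⟨i, 0, h, hk, rfl⟩
    · exact ⟨k + ε, i - (k + ε), le_rfl, by omega, by omega⟩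
  refine GegPosAt.mul ?_ (hgpos b hb)
  refine ((hpos k a ha).C_mul (hS.eval_pos _ (by omega))).add_right ?_
  exact (hpos (k - 1) 0 (Nat.zero_le _)).1.C_mul (by linarith [hS.eval_nonpos])

theorem natDegree_levenshteinPoly (hn : 2 ≤ n) (hε : ε = 0 ∨ ε = 1)
    (hS : LevenshteinNodes n k ε s S) : (levenshteinPoly n k ε s).natDegree = 2 * k - 1 + ε := by
  rw [levenshteinPoly, nodalPoly, natDegree_multiset_prod_X_sub_C_eq_card,
    hS.card_nodeMultiset hn hε]

theorem one_notMem_nodes (hn : 2 ≤ n) (hε : ε = 0 ∨ ε = 1) (hS : LevenshteinNodes n k ε s S) :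
    (1 : ℝ) ∉ nodes n k ε s := fun h => (hS.nodes_mem_Ico hn hε 1 h).2.ne rfl

theorem nodal_nodes (hn : 2 ≤ n) (hε : ε = 0 ∨ ε = 1) (hS : LevenshteinNodes n k ε s S) :
    Lagrange.nodal (nodes n k ε s) id = (1 + X) ^ ε * Lagrange.nodal S id := by
  rw [hS.nodes_eq hn hε]
  rcases hε with rfl | rfl
  · simp
  · rw [if_neg one_ne_zero, Lagrange.nodal_insert_eq_nodal (hS.neg_one_notMem rfl)]
    simp [add_comm]

theorem card_nodes (hn : 2 ≤ n) (hε : ε = 0 ∨ ε = 1) (hS : LevenshteinNodes n k ε s S) :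
    (nodes n k ε s).card = k + ε := by
  rw [hS.nodes_eq hn hε]
  rcases hε with rfl | rfl
  · simp [hS.card_eq]
  · rw [if_neg one_ne_zero, Finset.card_insert_of_notMem (hS.neg_one_notMem rfl), hS.card_eq]

theorem adjMean_nodal_mul_X_pow (hn : 2 ≤ n) (hε : ε = 0 ∨ ε = 1)
    (hS : LevenshteinNodes n k ε s S) {d : ℕ} (hd : d + 1 < k) :
    adjMean hn ε (Lagrange.nodal S id * X ^ d) = 0 := by
  have ho := adjMean_adjPoly_mul_X_pow hn hε
  have h1 : adjMean hn ε (nodeFactor n k ε s * X ^ d) = 0 := by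
    rw [nodeFactor, add_mul, mul_assoc, mul_assoc, map_add, functional_C_mul, functional_C_mul,
      ho k d (by omega), ho (k - 1) d (by omega)]
    ring
  rw [hS.eq_nodal, mul_assoc, functional_C_mul] at h1
  exact (mul_eq_zero.1 h1).resolve_left hS.lead_pos.ne'

/-- The k + ε + 1 nodes include 1, and their nodal polynomial is orthogonal to degrees below k - 1,
so exactness reaches degree 2k - 1 + ε. -/
theorem mean_eq_add_sum (hn : 2 ≤ n) (hε : ε = 0 ∨ ε = 1) (hS : LevenshteinNodes n k ε s S)
    {f : ℝ[X]} (hf : f.natDegree ≤ 2 * k - 1 + ε) :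
    mean hn f = mean hn (Lagrange.basis (insert 1 (nodes n k ε s)) id 1) * f.eval 1
      + ∑ α ∈ nodes n k ε s, quadratureWeight n k ε s α * f.eval α := by
  have hk := hS.one_le
  have h1 := hS.one_notMem_nodes hn hε
  rw [interpolatory_quadrature (μ := mean hn) (S := insert 1 (nodes n k ε s)) (r := k - 1) ?_ ?_,
    Finset.sum_insert h1]
  · simp only [quadratureWeight, gegenbauerCoeff_zero hn]
  · intro d hd
    have h2 := hS.adjMean_nodal_mul_X_pow hn hε (d := d) (by omega)
    rw [adjMean_apply] at h2
    rw [Lagrange.nodal_insert_eq_nodal h1, hS.nodal_nodes hn hε, ← neg_eq_zero, ← h2, ← map_neg]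
    congr 1
    simp only [id, map_one]
    ring
  · refine lt_of_le_of_lt degree_le_natDegree ?_
    rw [Finset.card_insert_of_notMem h1, hS.card_nodes hn hε]
    exact_mod_cast (by omega)

end LevenshteinNodes

/-! ### The quadrature weight at 1 and the Levenshtein bound -/

theorem mean_gegenbauer_succ {n : ℕ} (hn : 2 ≤ n) (i : ℕ) : mean hn (gegenbauer n (i + 1)) = 0 := by
  simpa using mean_gegenbauer_mul_X_pow hn (i + 1) 0 (Nat.succ_pos i)

theorem mean_one_add_X_pow_mul_adjPoly {n ε : ℕ} (hn : 2 ≤ n) (hε : ε = 0 ∨ ε = 1) (j : ℕ) :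
    mean hn ((1 + X) ^ ε * adjPoly n ε j) = 1 := by
  rcases hε with rfl | rfl
  · simp only [pow_zero, one_mul, adjPoly, if_true]
    induction j with
    | zero => rw [adjJ, adjH_zero, mean_one]
    | succ j ih =>
      rw [← sub_add_cancel (adjJ n (j + 1)) (adjJ n j), adjJ_succ_sub hn, map_add, mean_C_mul,
        mean_gegenbauer_succ, ih]
      ring
  · simp only [pow_one, adjPoly, if_neg one_ne_zero]
    induction j with
    | zero => rw [adjH_zero, mul_one, map_add, mean_one, mean_X, add_zero]
    | succ j ih =>
      rw [← sub_add_cancel (adjH n (j + 1)) (adjH n j), mul_add, one_add_mul_adjH_sub hn, map_add,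
        mean_C_mul, map_add, mean_gegenbauer_succ, mean_gegenbauer_succ, ih]
      ring

theorem adjJ_eval_one {n : ℕ} (hn : 2 ≤ n) (j : ℕ) :
    (adjJ n j).eval 1 * ((n : ℝ) - 1) = kap n j * (2 * (j : ℝ) + n - 1) := by
  cases j with
  | zero => simp [adjJ, adjH_zero, kap_zero]
  | succ j =>
    have h1 := adjH_eval_one hn j
    have h2 := adjH_eval_one hn (j + 1)
    have h3 := kap_succ hn j
    rw [adjJ, eval_add]
    push_cast at *
    linear_combination h1 + h2 - h3

namespace LevenshteinNodes

variable {n k ε : ℕ} {s : ℝ} {S : Finset ℝ}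

/-- The quadrature is tested on (1 + t)^ε times `nodeFactor`, which vanishes at every node except 1,
so only the weight at 1 remains. -/
theorem mean_basis_mul (hn : 2 ≤ n) (hε : ε = 0 ∨ ε = 1) (hS : LevenshteinNodes n k ε s S) :
    mean hn (Lagrange.basis (insert 1 (nodes n k ε s)) id 1) *
      (2 ^ ε * ((adjPoly n ε (k - 1)).eval s * (adjPoly n ε k).eval 1
        - (adjPoly n ε k).eval s * (adjPoly n ε (k - 1)).eval 1)) =
      (adjPoly n ε (k - 1)).eval s - (adjPoly n ε k).eval s := by
  have hk := hS.one_le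
  have hdeg : ((1 + X) ^ ε * nodeFactor n k ε s).natDegree ≤ 2 * k - 1 + ε := by
    have h1 : ((1 + X : ℝ[X]) ^ ε).natDegree ≤ ε := by
      refine natDegree_pow_le.trans ?_
      have : (1 + X : ℝ[X]).natDegree ≤ 1 := by compute_degree
      nlinarith
    have h2 : (nodeFactor n k ε s).natDegree ≤ k := by
      rw [hS.eq_nodal]
      refine (natDegree_C_mul_le _ _).trans ?_
      rw [Lagrange.natDegree_nodal, hS.card_eq]
    exact natDegree_mul_le.trans (by omega)
  have h1 := hS.mean_eq_add_sum hn hε hdeg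
  rw [Finset.sum_eq_zero, add_zero] at h1
  · have h2 : mean hn ((1 + X) ^ ε * nodeFactor n k ε s) =
        (adjPoly n ε (k - 1)).eval s - (adjPoly n ε k).eval s := by
      rw [nodeFactor, mul_add, mul_left_comm, mul_left_comm _ (C _), map_add, mean_C_mul, mean_C_mul,
        mean_one_add_X_pow_mul_adjPoly hn hε, mean_one_add_X_pow_mul_adjPoly hn hε]
      ring
    rw [← h2, h1, nodeFactor]
    simp only [eval_mul, eval_add, eval_C, eval_pow, eval_one, eval_X]
    norm_num
    left
    ring
  · intro α hα
    have h3 : ((1 + X) ^ ε * nodeFactor n k ε s).eval α = 0 := by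
      rw [hS.eq_nodal, mul_left_comm, ← hS.nodal_nodes hn hε, eval_mul,
        eval_nodal_id_eq_zero_iff.2 hα, mul_zero]
    rw [h3, mul_zero]

theorem mean_basis_one (hn : 2 ≤ n) (hε : ε = 0 ∨ ε = 1) (hS : LevenshteinNodes n k ε s S) :
    mean hn (Lagrange.basis (insert 1 (nodes n k ε s)) id 1) = (levenshteinBound n k ε s)⁻¹ := by
  have hω := hS.mean_basis_mul hn hε
  have hpos := hS.eval_pos
  have hnonpos := hS.eval_nonpos
  have hs := hS.mem_Ico s hS.mem
  have hs1 : 0 < 1 - s := by linarith [hs.2]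
  obtain ⟨j, rfl⟩ : ∃ j, k = j + 1 := ⟨k - 1, by have := hS.one_le; omega⟩
  have hn1 : (0 : ℝ) < n - 1 := by
    have : (2 : ℝ) ≤ n := by exact_mod_cast hn
    linarith
  rw [Nat.add_sub_cancel] at hω
  have hb := hpos j (Nat.lt_succ_self j)
  have hba : 0 < (adjPoly n ε j).eval s - (adjPoly n ε (j + 1)).eval s := by linarith
  suffices h : levenshteinBound n (j + 1) ε s *
      ((adjPoly n ε j).eval s - (adjPoly n ε (j + 1)).eval s) =
      2 ^ ε * ((adjPoly n ε j).eval s * (adjPoly n ε (j + 1)).eval 1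
        - (adjPoly n ε (j + 1)).eval s * (adjPoly n ε j).eval 1) by
    rw [← h] at hω
    refine eq_inv_of_mul_eq_one_left ?_
    refine mul_right_cancel₀ hba.ne' ?_
    rw [one_mul, mul_assoc, hω]
  rcases hε with rfl | rfl
  · simp only [adjPoly, if_true] at *
    have h1 := congrArg (eval s) (adjJ_succ_sub hn j)
    have h2 := congrArg (eval 1) (adjJ_succ_sub hn j)
    have h3 := congrArg (eval s) (one_sub_mul_adjJ hn j)
    have h4 := adjJ_eval_one hn j
    have hr : 0 < kap n (j + 1) + kap n j := add_pos (kap_pos hn _) (kap_pos hn _)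
    simp only [eval_sub, eval_mul, eval_C, eval_one, eval_X, gegenbauer_eval_one hn] at h1 h2 h3
    have hκ : (((j + 1 + n - 3).choose (j + 1 - 1) : ℕ) : ℝ) = kap n j := by
      rw [kap]; congr 2; omega
    rw [levenshteinBound, if_pos rfl, hκ, Nat.add_sub_cancel]
    set r := kap n (j + 1) + kap n j
    set p := (gegenbauer n (j + 1)).eval s
    -- Since r P_k(s) = O_k(s) - O_{k-1}(s) with O_k(s) ≤ 0 < O_{k-1}(s), the denominator in the
    -- Levenshtein bound does not vanish.
    have hp : p < 0 := by
      by_contra! hp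
      have := mul_nonneg hr.le hp
      linarith
    have hp' := hp.ne
    have hs1' := hs1.ne'
    have hn1' := hn1.ne'
    have hB : kap n j * ((2 * (((j + 1 : ℕ) : ℝ)) + n - 3) / ((n : ℝ) - 1)) = (adjJ n j).eval 1 := by
      rw [mul_div_assoc', div_eq_iff hn1', h4]; push_cast; ring
    have hP : kap n j * (((gegenbauer n j).eval s - p) / ((1 - s) * p)) = (adjJ n j).eval s / p := by
      rw [mul_div_assoc', ← h3]; field_simp
    have hbp : (adjJ n j).eval s / p * p = (adjJ n j).eval s := div_mul_cancel₀ _ hp'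
    rw [pow_zero, one_mul]
    linear_combination ((adjJ n j).eval s - (adjJ n (j + 1)).eval s) * (hB - hP)
      + (adjJ n j).eval s / p * h1 - (adjJ n j).eval s * h2 + r * hbp
  · simp only [adjPoly, if_neg one_ne_zero] at *
    have hsm : 0 < 1 + s := by
      rcases hs.1.eq_or_lt with h | h
      · exact absurd hS.mem (h ▸ hS.neg_one_notMem rfl)
      · linarith
    have h1 := congrArg (eval s) (one_add_mul_adjH_sub hn j)
    have h2 := congrArg (eval 1) (one_add_mul_adjH_sub hn j)
    have h3 := congrArg (eval s) (one_sub_mul_adjJ hn (j + 1))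
    have h4 := adjJ_eval_one hn (j + 1)
    have hr : 0 < kap n (j + 1) := kap_pos hn _
    simp only [eval_sub, eval_add, eval_mul, eval_C, eval_one, eval_X, gegenbauer_eval_one hn, adjJ]
      at h1 h2 h3 h4
    have hκ : (((j + 1 + n - 2).choose (j + 1) : ℕ) : ℝ) = kap n (j + 1) := rfl
    rw [levenshteinBound, if_neg one_ne_zero, hκ]
    set p := (gegenbauer n (j + 1)).eval s
    set q := (gegenbauer n (j + 1 + 1)).eval s
    set a := (adjH n (j + 1)).eval s
    set b := (adjH n j).eval s
    have hpq : p + q ≠ 0 := by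
      intro h0
      rw [h0, mul_zero] at h1
      have := (mul_eq_zero.1 h1).resolve_left hsm.ne'
      linarith
    have hab : a - b ≠ 0 := by linarith
    have hs1' := hs1.ne'
    have hsm' := hsm.ne'
    have hn1' := hn1.ne'
    have hB : kap n (j + 1) * ((2 * (((j + 1 : ℕ) : ℝ)) + n - 1) / ((n : ℝ) - 1)) =
        (adjH n (j + 1)).eval 1 + (adjH n j).eval 1 := by
      rw [mul_div_assoc', div_eq_iff hn1', h4]
    have hP : (1 + s) * (p - q) / ((1 - s) * (p + q)) * (a - b) = a + b := by
      rw [div_mul_eq_mul_div, div_eq_iff (mul_ne_zero hs1' hpq)]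
      refine mul_left_cancel₀ hr.ne' ?_
      linear_combination kap n (j + 1) * (p - q) * h1 - kap n (j + 1) * (p + q) * h3
    linear_combination (b - a) * hB + kap n (j + 1) * hP - (a + b) / 2 * h2

end LevenshteinNodes

end

end SphericalCodes

/-! ### Rolle's theorem, absolute monotonicity and Hermite interpolation -/

namespace SphericalCodes

open Polynomial

noncomputable section

/-- `F 0, F 1, …` are the successive derivatives of `F 0` within `s`. -/
def IsDerivSeqOn (F : ℕ → ℝ → ℝ) (s : Set ℝ) : Prop :=
  ∀ j, ∀ x ∈ s, HasDerivWithinAt (F j) (F (j + 1) x) s x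

namespace IsDerivSeqOn

variable {F G : ℕ → ℝ → ℝ} {s : Set ℝ}

theorem sub (hF : IsDerivSeqOn F s) (hG : IsDerivSeqOn G s) :
    IsDerivSeqOn (fun j x => F j x - G j x) s := fun j x hx => (hF j x hx).sub (hG j x hx)

theorem shift (hF : IsDerivSeqOn F s) : IsDerivSeqOn (fun j => F (j + 1)) s := fun j =>
  hF (j + 1)

theorem continuousOn (hF : IsDerivSeqOn F s) (j : ℕ) : ContinuousOn (F j) s := fun x hx =>
  (hF j x hx).continuousWithinAt

theorem polynomial (p : ℝ[X]) (s : Set ℝ) :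
    IsDerivSeqOn (fun j x => (derivative^[j] p).eval x) s := fun j x _ => by
  beta_reduce
  rw [Function.iterate_succ_apply']
  exact (Polynomial.hasDerivAt _ x).hasDerivWithinAt

theorem exists_zero (hF : IsDerivSeqOn F s) (hs : s.OrdConnected) {a b : ℝ} (ha : a ∈ s)
    (hb : b ∈ s) (hab : a < b) (h : F 0 a = F 0 b) : ∃ c ∈ Set.Ioo a b, F 1 c = 0 := by
  have hsub := hs.out ha hb
  refine exists_hasDerivAt_eq_zero hab ((hF.continuousOn 0).mono hsub) h fun x hx => ?_
  exact (hF 0 x (hsub (Set.Ioo_subset_Icc_self hx))).hasDerivAt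
    (Filter.mem_of_superset (Icc_mem_nhds hx.1 hx.2) hsub)

/-- The new zeros lie strictly between consecutive old ones. Disjointness lets double zeros be
counted again later; the last clause keeps the zeros found so far below the point being added. -/
theorem exists_zeros (hF : IsDerivSeqOn F s) (hs : s.OrdConnected) (S : Finset ℝ) :
    (∀ x ∈ S, x ∈ s) → (∀ x ∈ S, F 0 x = 0) →
      ∃ S' : Finset ℝ, S.card ≤ S'.card + 1 ∧ Disjoint S' S ∧ (∀ x ∈ S', F 1 x = 0) ∧
        (∀ x ∈ S', x ∈ s) ∧ ∀ x ∈ S', ∃ y ∈ S, x < y := by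
  induction S using Finset.induction_on_max with
  | empty => exact fun _ _ => ⟨∅, by simp⟩
  | insert a S ha ih =>
    intro hSs hS0
    obtain ⟨S', h1, h2, h3, h4, h5⟩ := ih (fun x hx => hSs x (Finset.mem_insert_of_mem hx))
      (fun x hx => hS0 x (Finset.mem_insert_of_mem hx))
    have haS : a ∉ S := fun h => (ha a h).ne rfl
    have hlt : ∀ x ∈ S', x < a := fun x hx => by
      obtain ⟨y, hy, hxy⟩ := h5 x hx
      exact hxy.trans (ha y hy)
    have hdisj : Disjoint S' (insert a S) :=
      Finset.disjoint_insert_right.2 ⟨fun h => (hlt a h).ne rfl, h2⟩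
    rcases S.eq_empty_or_nonempty with rfl | hne
    · exact ⟨∅, by simp⟩
    · set b := S.max' hne with hb
      have hbS := S.max'_mem hne
      obtain ⟨c, hc, hc0⟩ := hF.exists_zero hs (hSs b (Finset.mem_insert_of_mem hbS))
        (hSs a (Finset.mem_insert_self a S)) (ha b hbS)
        (by rw [hS0 b (Finset.mem_insert_of_mem hbS), hS0 a (Finset.mem_insert_self a S)])
      have hcS' : c ∉ S' := by
        intro h
        obtain ⟨y, hy, hcy⟩ := h5 c h
        exact absurd (hcy.trans_le (S.le_max' y hy)) (not_lt.2 hc.1.le)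
      have hcS : c ∉ S := fun h => absurd (S.le_max' c h) (not_le.2 hc.1)
      refine ⟨insert c S', ?_, ?_, ?_, ?_, ?_⟩
      · rw [Finset.card_insert_of_notMem haS, Finset.card_insert_of_notMem hcS']; omega
      · refine Finset.disjoint_insert_left.2 ⟨?_, hdisj⟩
        rw [Finset.mem_insert, not_or]
        exact ⟨hc.2.ne, hcS⟩
      · exact Finset.forall_mem_insert _ _ _ |>.2 ⟨hc0, h3⟩
      · refine Finset.forall_mem_insert _ _ _ |>.2 ⟨hs.out (hSs b (Finset.mem_insert_of_mem hbS))
          (hSs a (Finset.mem_insert_self a S)) (Set.Ioo_subset_Icc_self hc), h4⟩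
      · exact fun x hx => ⟨a, Finset.mem_insert_self a S,
          (Finset.forall_mem_insert (p := fun x => x < a) _ _).2 ⟨hc.2, hlt⟩ x hx⟩

theorem exists_zero_of_card (hs : s.OrdConnected) (d : ℕ) :
    ∀ {F : ℕ → ℝ → ℝ}, IsDerivSeqOn F s → ∀ {S : Finset ℝ}, d + 1 ≤ S.card →
      (∀ x ∈ S, x ∈ s) → (∀ x ∈ S, F 0 x = 0) → ∃ ξ ∈ s, F d ξ = 0 := by
  induction d with
  | zero =>
    intro F _ S hc hSs hS
    obtain ⟨x, hx⟩ := Finset.card_pos.1 (by omega : 0 < S.card)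
    exact ⟨x, hSs x hx, hS x hx⟩
  | succ d ih =>
    intro F hF S hc hSs hS
    obtain ⟨S', h1, -, h3, h4, -⟩ := hF.exists_zeros hs S hSs hS
    exact ih hF.shift (by omega) h4 h3

/-- Rolle's theorem for simple and double zeros. -/
theorem exists_zero_of_card_add_card (hF : IsDerivSeqOn F s) (hs : s.OrdConnected) {S D : Finset ℝ}
    (hDS : D ⊆ S) {d : ℕ} (hc : d + 1 ≤ S.card + D.card) (hSs : ∀ x ∈ S, x ∈ s)
    (hS : ∀ x ∈ S, F 0 x = 0) (hD : ∀ x ∈ D, F 1 x = 0) : ∃ ξ ∈ s, F d ξ = 0 := by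
  cases d with
  | zero =>
    have := Finset.card_le_card hDS
    exact exists_zero_of_card hs 0 hF (by omega) hSs hS
  | succ d =>
    obtain ⟨S', h1, h2, h3, h4, -⟩ := hF.exists_zeros hs S hSs hS
    have hdisj : Disjoint S' D := Finset.disjoint_of_subset_right hDS h2
    refine exists_zero_of_card hs d hF.shift (S := S' ∪ D) ?_ ?_ ?_
    · rw [Finset.card_union_of_disjoint hdisj]; omega
    · intro x hx
      rcases Finset.mem_union.1 hx with h | h
      exacts [h4 x h, hSs x (hDS h)]
    · intro x hx
      rcases Finset.mem_union.1 hx with h | h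
      exacts [h3 x h, hD x h]

theorem monotoneOn (hF : IsDerivSeqOn F s) (hs : Convex ℝ s) {j : ℕ}
    (h : ∀ x ∈ s, 0 ≤ F (j + 1) x) : MonotoneOn (F j) s :=
  monotoneOn_of_hasDerivWithinAt_nonneg hs (hF.continuousOn j)
    (fun x hx => (hF j x (interior_subset hx)).mono interior_subset)
    fun x hx => h x (interior_subset hx)

/-- The derivative of (x - a) F' - (N+1) F is (x - a) F'' - N F', which is nonnegative by induction
applied to F'. As N is arbitrary, F must vanish; this replaces an appeal to analyticity. -/
theorem nat_mul_le (hs : Convex ℝ s) {a : ℝ} (ha : a ∈ s) (has : ∀ x ∈ s, a ≤ x) (N : ℕ) :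
    ∀ {F : ℕ → ℝ → ℝ}, IsDerivSeqOn F s → (∀ j, ∀ x ∈ s, 0 ≤ F j x) → (∀ j, F j a = 0) →
      ∀ x ∈ s, N * F 0 x ≤ (x - a) * F 1 x := by
  induction N with
  | zero =>
    intro F _ h0 _ x hx
    rw [Nat.cast_zero, zero_mul]
    exact mul_nonneg (sub_nonneg.2 (has x hx)) (h0 1 x hx)
  | succ N ih =>
    intro F hF h0 hFa x hx
    have hder : ∀ y ∈ s, HasDerivWithinAt (fun y => (y - a) * F 1 y - ((N + 1 : ℕ) : ℝ) * F 0 y)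
        (1 * F 1 y + (y - a) * F 2 y - ((N + 1 : ℕ) : ℝ) * F 1 y) s y := fun y hy =>
      (((hasDerivWithinAt_id y s).sub_const a).mul (hF 1 y hy)).sub ((hF 0 y hy).const_mul _)
    have hmono := monotoneOn_of_hasDerivWithinAt_nonneg hs
      (fun y hy => (hder y hy).continuousWithinAt)
      (fun y hy => (hder y (interior_subset hy)).mono interior_subset) (fun y hy => by
        have := ih hF.shift (fun j => h0 (j + 1)) (fun j => hFa (j + 1)) y (interior_subset hy)
        simp only [zero_add] at this
        push_cast
        have h2 : F (1 + 1) y = F 2 y := rfl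
        rw [h2] at this
        linarith) ha hx (has x hx)
    simp only [sub_self, hFa, mul_zero] at hmono
    linarith

end IsDerivSeqOn

section AbsolutelyMonotone

variable {h : ℝ → ℝ}

theorem isDerivSeqOn_iteratedDerivWithin (hh : AbsolutelyMonotoneOn h (Set.Ico (-1) 1)) :
    IsDerivSeqOn (fun j => iteratedDerivWithin j h (Set.Ico (-1) 1)) (Set.Ico (-1) 1) := by
  intro j x hx
  beta_reduce
  rw [iteratedDerivWithin_succ]
  exact (hh.contDiffOn.differentiableOn_iteratedDerivWithin (WithTop.coe_lt_coe.2
    (ENat.natCast_lt_top j)) (uniqueDiffOn_Ico _ _) x hx).hasDerivWithinAt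

theorem iteratedDerivWithin_Ico_nonneg (hh : AbsolutelyMonotoneOn h (Set.Ico (-1) 1)) (j : ℕ)
    {x : ℝ} (hx : x ∈ Set.Ico (-1 : ℝ) 1) : 0 ≤ iteratedDerivWithin j h (Set.Ico (-1) 1) x :=
  hh.iteratedDerivWithin_nonneg (uniqueDiffOn_Ico _ _) j hx

/-- Rolle gives a zero c > -1 of h'; as h' is nonnegative and monotone it vanishes at -1 too, and
Rolle on [-1, c] passes to h''. So all derivatives vanish at -1, and `nat_mul_le` applies to h -
h(-1). -/
theorem eq_of_eq_of_lt (hh : AbsolutelyMonotoneOn h (Set.Ico (-1) 1)) {a b : ℝ}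
    (ha : a ∈ Set.Ico (-1 : ℝ) 1) (hb : b ∈ Set.Ico (-1 : ℝ) 1) (hab : a < b) (heq : h a = h b) :
    ∀ x ∈ Set.Ico (-1 : ℝ) 1, h x = h (-1) := by
  set I := Set.Ico (-1 : ℝ) 1 with hI
  set F : ℕ → ℝ → ℝ := fun j => iteratedDerivWithin j h I with hFdef
  have hF : IsDerivSeqOn F I := isDerivSeqOn_iteratedDerivWithin hh
  have hF0 : ∀ j, ∀ x ∈ I, 0 ≤ F j x := fun j x hx => iteratedDerivWithin_Ico_nonneg hh j hx
  have hconv : Convex ℝ I := convex_Ico _ _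
  have hord : I.OrdConnected := Set.ordConnected_Ico
  have hmem : (-1 : ℝ) ∈ I := ⟨le_rfl, by norm_num⟩
  have hFh : F 0 = h := iteratedDerivWithin_zero
  have hmono : ∀ j, MonotoneOn (F j) I := fun j => hF.monotoneOn hconv (hF0 (j + 1))
  have hzero : ∀ j, ∃ c ∈ I, -1 < c ∧ F (j + 1) c = 0 := by
    intro j
    induction j with
    | zero =>
      obtain ⟨c, hc, hc0⟩ := hF.exists_zero hord ha hb hab (by rw [hFh, heq])
      exact ⟨c, hord.out ha hb (Set.Ioo_subset_Icc_self hc), ha.1.trans_lt hc.1, hc0⟩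
    | succ j ih =>
      obtain ⟨c, hcI, hc1, hc0⟩ := ih
      have h1 : F (j + 1) (-1) = 0 := le_antisymm
        ((hmono (j + 1) hmem hcI hc1.le).trans hc0.le) (hF0 _ _ hmem)
      have hshift : IsDerivSeqOn (fun i => F (i + (j + 1))) I := fun i x hx => by
        have := hF (i + (j + 1)) x hx
        rwa [show i + (j + 1) + 1 = i + 1 + (j + 1) by ring] at this
      obtain ⟨c', hc', hc0'⟩ := hshift.exists_zero hord hmem hcI hc1 (by
        simp only [zero_add]; rw [h1, hc0])
      refine ⟨c', hord.out hmem hcI (Set.Ioo_subset_Icc_self hc'), hc'.1, ?_⟩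
      rw [show j + 1 + 1 = 1 + (j + 1) by ring]
      exact hc0'
  have hneg : ∀ j, F (j + 1) (-1) = 0 := fun j => by
    obtain ⟨c, hcI, hc1, hc0⟩ := hzero j
    exact le_antisymm ((hmono (j + 1) hmem hcI hc1.le).trans hc0.le) (hF0 _ _ hmem)
  set G : ℕ → ℝ → ℝ := fun j x => F j x - if j = 0 then h (-1) else 0 with hG
  have hGd : IsDerivSeqOn G I := fun j x hx => by
    have := (hF j x hx).sub_const (if j = 0 then h (-1) else 0)
    simpa [hG] using this
  have hle : ∀ x ∈ I, h (-1) ≤ h x := fun x hx => by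
    have := hmono 0 hmem hx hx.1
    rwa [hFh] at this
  have hG0 : ∀ j, ∀ x ∈ I, 0 ≤ G j x := by
    intro j x hx
    rcases j with _ | j
    · simpa [hG, hFh] using hle x hx
    · simpa [hG] using hF0 (j + 1) x hx
  have hGa : ∀ j, G j (-1) = 0 := by
    intro j
    rcases j with _ | j
    · simp [hG, hFh]
    · simpa [hG] using hneg j
  intro x hx
  refine le_antisymm ?_ (hle x hx)
  by_contra! hlt
  have hpos : 0 < G 0 x := by simpa [hG, hFh] using hlt
  obtain ⟨N, hN⟩ := exists_nat_gt ((x - -1) * G 1 x / G 0 x)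
  rw [div_lt_iff₀ hpos] at hN
  exact absurd (IsDerivSeqOn.nat_mul_le hconv hmem (fun x hx => hx.1) N hGd hG0 hGa x hx)
    (not_le.2 hN)

theorem iterate_derivative_eq_C {p : ℝ[X]} {d : ℕ} (hp : p.natDegree ≤ d) :
    derivative^[d] p = C ((d.factorial : ℝ) * p.coeff d) := by
  have h1 : (derivative^[d] p).natDegree ≤ 0 :=
    (natDegree_iterate_derivative p d).trans (by omega)
  rw [eq_C_of_natDegree_le_zero h1, coeff_iterate_derivative, zero_add, Nat.descFactorial_self,
    nsmul_eq_mul]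

theorem card_toFinset_add_card_filter {T : Multiset ℝ} (h2 : ∀ a, T.count a ≤ 2) :
    T.toFinset.card + (T.toFinset.filter fun a => T.count a = 2).card = T.card := by
  rw [← Multiset.toFinset_sum_count_eq, Finset.card_eq_sum_ones, Finset.card_filter,
    ← Finset.sum_add_distrib]
  refine Finset.sum_congr rfl fun a ha => ?_
  have h1 := Multiset.one_le_count_iff_mem.2 (Multiset.mem_toFinset.1 ha)
  have := h2 a
  split_ifs with h <;> omega

theorem nodalPoly_dvd {T : Multiset ℝ} (a : ℝ) : (X - C a) ^ T.count a ∣ nodalPoly T := by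
  have h1 : Multiset.replicate (T.count a) a ≤ T := Multiset.le_count_iff_replicate_le.1 le_rfl
  have h3 := Multiset.prod_dvd_prod_of_le
    (Multiset.map_le_map (f := fun c : ℝ => (X - C c : ℝ[X])) h1)
  rwa [Multiset.map_replicate, Multiset.prod_replicate] at h3

theorem nodalPoly_iterate_derivative_eval {T : Multiset ℝ} {a : ℝ} {j : ℕ} (hj : j < T.count a) :
    (derivative^[j] (nodalPoly T)).eval a = 0 := by
  have hd := pow_sub_dvd_iterate_derivative_of_pow_dvd j (nodalPoly_dvd (T := T) a)
  exact dvd_iff_isRoot.mp ((dvd_pow_self _ (by omega)).trans hd)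

variable {T : Multiset ℝ} {g : ℝ[X]}

/-- Choosing c to make h - g - c ∏(x - a) vanish at t gives one zero more than |T|, counted with
multiplicity. By Rolle, c is h^{(|T|)}(ξ) / |T|!, which is nonnegative. -/
theorem IsHermiteInterpolant.exists_remainder (hh : AbsolutelyMonotoneOn h (Set.Ico (-1) 1))
    (hg : IsHermiteInterpolant h T g) (h2 : ∀ a, T.count a ≤ 2)
    (hT : ∀ a ∈ T, a ∈ Set.Ico (-1 : ℝ) 1) {t : ℝ} (ht : t ∈ Set.Ico (-1 : ℝ) 1) :
    ∃ c, 0 ≤ c ∧ h t = g.eval t + c * (nodalPoly T).eval t := by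
  by_cases htT : t ∈ T
  · have h1 := hg.2 t htT 0 (Multiset.count_pos.2 htT)
    refine ⟨0, le_rfl, ?_⟩
    rw [iteratedDerivWithin_zero] at h1
    rw [zero_mul, add_zero, ← h1, Function.iterate_zero, id]
  have hne : (nodalPoly T).eval t ≠ 0 := by
    unfold nodalPoly
    rw [eval_multiset_prod]
    intro h0
    rw [Multiset.prod_eq_zero_iff] at h0
    simp only [Multiset.map_map, Multiset.mem_map] at h0
    obtain ⟨b, hb, hb0⟩ := h0
    simp only [Function.comp_apply, eval_sub, eval_X, eval_C, sub_eq_zero] at hb0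
    exact htT (hb0 ▸ hb)
  set c := (h t - g.eval t) / (nodalPoly T).eval t with hc
  have hct : c * (nodalPoly T).eval t = h t - g.eval t := div_mul_cancel₀ _ hne
  refine ⟨c, ?_, by linarith⟩
  have hD := (isDerivSeqOn_iteratedDerivWithin hh).sub
    (IsDerivSeqOn.polynomial (g + C c * nodalPoly T) (Set.Ico (-1) 1))
  have hvan : ∀ a ∈ T, ∀ j < T.count a, iteratedDerivWithin j h (Set.Ico (-1) 1) a -
      (derivative^[j] (g + C c * nodalPoly T)).eval a = 0 := by
    intro a ha j hj
    rw [iterate_map_add derivative j, iterate_derivative_C_mul, eval_add, eval_mul,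
      nodalPoly_iterate_derivative_eval hj, hg.2 a ha j hj]
    ring
  have htF : t ∉ T.toFinset := fun h => htT (Multiset.mem_toFinset.1 h)
  obtain ⟨ξ, hξ, hξ0⟩ := hD.exists_zero_of_card_add_card Set.ordConnected_Ico
    (S := insert t T.toFinset) (D := T.toFinset.filter fun a => T.count a = 2) (d := T.card)
    ((Finset.filter_subset _ _).trans (Finset.subset_insert _ _))
    (by rw [Finset.card_insert_of_notMem htF, ← card_toFinset_add_card_filter h2]; omega)
    (Finset.forall_mem_insert _ _ _ |>.2 ⟨ht, fun x hx => hT x (Multiset.mem_toFinset.1 hx)⟩)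
    (Finset.forall_mem_insert _ _ _ |>.2 ⟨by
      simp only [iteratedDerivWithin_zero, Function.iterate_zero, id, eval_add, eval_mul, eval_C]
      linarith, fun x hx => hvan x (Multiset.mem_toFinset.1 hx) 0
        (Multiset.count_pos.2 (Multiset.mem_toFinset.1 hx))⟩)
    (fun x hx => by
      obtain ⟨h3, h4⟩ := Finset.mem_filter.1 hx
      exact hvan x (Multiset.mem_toFinset.1 h3) 1 (by omega))
  have hmon : (nodalPoly T).Monic := monic_multiset_prod_of_monic _ _ fun a _ => monic_X_sub_C a
  have hdeg : (nodalPoly T).natDegree = T.card := natDegree_multiset_prod_X_sub_C_eq_card T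
  have hder : derivative^[T.card] (g + C c * nodalPoly T) = C ((T.card.factorial : ℝ) * c) := by
    have hg1 : g.coeff T.card = 0 := coeff_eq_zero_of_degree_lt hg.1
    have hg2 : g.natDegree ≤ T.card := natDegree_le_of_degree_le hg.1.le
    have h5 := hmon.coeff_natDegree
    rw [hdeg] at h5
    rw [iterate_derivative_eq_C, coeff_add, coeff_C_mul, hg1, h5, zero_add, mul_one]
    exact (natDegree_add_le _ _).trans (max_le hg2 ((natDegree_C_mul_le _ _).trans hdeg.le))
  rw [hder, eval_C, sub_eq_zero] at hξ0
  have h6 := iteratedDerivWithin_Ico_nonneg hh T.card hξ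
  rw [hξ0] at h6
  exact nonneg_of_mul_nonneg_right h6 (by exact_mod_cast Nat.factorial_pos _)

/-- With d = deg g < |T|, the function h - g has enough zeros for Rolle at order d, so the leading
coefficient is h^{(d)}(ξ) / d!. -/
theorem IsHermiteInterpolant.leadingCoeff_nonneg (hh : AbsolutelyMonotoneOn h (Set.Ico (-1) 1))
    (hg : IsHermiteInterpolant h T g) (h2 : ∀ a, T.count a ≤ 2)
    (hT : ∀ a ∈ T, a ∈ Set.Ico (-1 : ℝ) 1) : 0 ≤ g.leadingCoeff := by
  rcases eq_or_ne g 0 with rfl | hg0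
  · simp
  have hdeg : g.natDegree < T.card := (natDegree_lt_iff_degree_lt hg0).2 hg.1
  have hD := (isDerivSeqOn_iteratedDerivWithin hh).sub
    (IsDerivSeqOn.polynomial g (Set.Ico (-1) 1))
  have hvan : ∀ a ∈ T, ∀ j < T.count a, iteratedDerivWithin j h (Set.Ico (-1) 1) a -
      (derivative^[j] g).eval a = 0 := by
    intro a ha j hj
    rw [hg.2 a ha j hj, sub_self]
  obtain ⟨ξ, hξ, hξ0⟩ := hD.exists_zero_of_card_add_card Set.ordConnected_Ico
    (S := T.toFinset) (D := T.toFinset.filter fun a => T.count a = 2) (d := g.natDegree)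
    (Finset.filter_subset _ _) (by rw [card_toFinset_add_card_filter h2]; omega)
    (fun x hx => hT x (Multiset.mem_toFinset.1 hx))
    (fun x hx => hvan x (Multiset.mem_toFinset.1 hx) 0
        (Multiset.count_pos.2 (Multiset.mem_toFinset.1 hx)))
    (fun x hx => by
      obtain ⟨h3, h4⟩ := Finset.mem_filter.1 hx
      exact hvan x (Multiset.mem_toFinset.1 h3) 1 (by omega))
  rw [iterate_derivative_eq_C le_rfl, eval_C, sub_eq_zero] at hξ0
  have h6 := iteratedDerivWithin_Ico_nonneg hh g.natDegree hξ
  rw [hξ0] at h6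
  exact nonneg_of_mul_nonneg_right h6 (by exact_mod_cast Nat.factorial_pos _)

end AbsolutelyMonotone

end

end SphericalCodes

/-! ### The polynomial of the universal upper bound -/

namespace SphericalCodes

open Polynomial

noncomputable section

section UniversalUpperBound

variable {n k ε : ℕ} {s : ℝ} {S : Finset ℝ} {h : ℝ → ℝ}

theorem gegenbauerCoeff_C_mul_add (hn : 2 ≤ n) (i : ℕ) (c : ℝ) (p q : ℝ[X]) :
    gegenbauerCoeff n i (C c * p + q) = c * gegenbauerCoeff n i p + gegenbauerCoeff n i q := by
  rw [gegenbauerCoeff_eq hn, gegenbauerCoeff_eq hn, gegenbauerCoeff_eq hn, add_mul, map_add,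
    mul_assoc, mean_C_mul]
  ring

theorem gegenbauerCoeff_eq_zero (hn : 2 ≤ n) {i : ℕ} {p : ℝ[X]} (hp : p.natDegree < i) :
    gegenbauerCoeff n i p = 0 := by
  rw [gegenbauerCoeff_eq hn, mul_comm, mean_gegenbauer_mul hn
    (degree_le_natDegree.trans_lt (by exact_mod_cast hp)), zero_div]

theorem isHermiteInterpolant_uubInterp (h : ℝ → ℝ) (n k ε : ℕ) (s : ℝ) :
    IsHermiteInterpolant h (nodeMultiset n k ε s) (uubInterp h n k ε s) :=
  isHermiteInterpolant_hermiteInterp h _ (count_nodeMultiset_le_two n k ε s)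

namespace LevenshteinNodes

theorem nodeMultiset_mem_Ico (hn : 2 ≤ n) (hε : ε = 0 ∨ ε = 1) (hS : LevenshteinNodes n k ε s S) :
    ∀ a ∈ nodeMultiset n k ε s, a ∈ Set.Ico (-1 : ℝ) 1 := by
  intro a ha
  refine hS.nodes_mem_Ico hn hε a ?_
  have h1 := Multiset.mem_of_le (tsub_le_self.trans tsub_le_self) ha
  exact Multiset.mem_of_mem_nsmul h1

theorem natDegree_uubInterp (hn : 2 ≤ n) (hε : ε = 0 ∨ ε = 1) (hS : LevenshteinNodes n k ε s S) :
    (uubInterp h n k ε s).natDegree < 2 * k - 1 + ε := by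
  have h1 := (isHermiteInterpolant_uubInterp h n k ε s).1
  rw [hS.card_nodeMultiset hn hε] at h1
  have hk := hS.one_le
  rcases eq_or_ne (uubInterp h n k ε s) 0 with h0 | h0
  · rw [h0, natDegree_zero]; omega
  · exact (natDegree_lt_iff_degree_lt h0).2 h1

theorem exists_remainder (hn : 2 ≤ n) (hε : ε = 0 ∨ ε = 1) (hS : LevenshteinNodes n k ε s S)
    (hh : AbsolutelyMonotoneOn h (Set.Ico (-1) 1)) {t : ℝ} (ht : t ∈ Set.Ico (-1 : ℝ) 1) :
    ∃ c, 0 ≤ c ∧ h t = (uubInterp h n k ε s).eval t + c * (levenshteinPoly n k ε s).eval t :=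
  (isHermiteInterpolant_uubInterp h n k ε s).exists_remainder hh (count_nodeMultiset_le_two n k ε s)
    (hS.nodeMultiset_mem_Ico hn hε) ht

theorem div_le_uubLambda (hn : 2 ≤ n) (hε : ε = 0 ∨ ε = 1) (hS : LevenshteinNodes n k ε s S)
    {i : ℕ} (hi : 1 ≤ i) (hi' : i ≤ (uubInterp h n k ε s).natDegree) :
    gegenbauerCoeff n i (uubInterp h n k ε s) ≤
      uubLambda h n k ε s * gegenbauerCoeff n i (levenshteinPoly n k ε s) := by
  have hd := hS.natDegree_uubInterp (h := h) hn hε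
  rw [← div_le_iff₀ (hS.gegenbauerCoeff_levenshteinPoly_pos hn hε (by omega))]
  exact le_csSup ((Set.finite_Icc _ _).image _).bddAbove ⟨i, ⟨hi, hi'⟩, rfl⟩

/-- The quotient at i = deg g_T is already positive, because the leading coefficient of g_T is
positive. This makes λ = 0 equivalent to a constant g_T in the equality case. -/
theorem uubLambda_pos (hn : 2 ≤ n) (hε : ε = 0 ∨ ε = 1) (hS : LevenshteinNodes n k ε s S)
    (hh : AbsolutelyMonotoneOn h (Set.Ico (-1) 1)) (hd : 1 ≤ (uubInterp h n k ε s).natDegree) :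
    0 < uubLambda h n k ε s := by
  have h1 := hS.div_le_uubLambda hn hε hd le_rfl
  have h2 := hS.natDegree_uubInterp (h := h) hn hε
  have h3 := hS.gegenbauerCoeff_levenshteinPoly_pos hn hε (i := (uubInterp h n k ε s).natDegree)
    (by omega)
  have hlead := (isHermiteInterpolant_uubInterp h n k ε s).leadingCoeff_nonneg hh
    (count_nodeMultiset_le_two n k ε s) (hS.nodeMultiset_mem_Ico hn hε)
  have h0 : uubInterp h n k ε s ≠ 0 := by rintro h0; rw [h0] at hd; simp at hd
  have hpos : HasPosLead (uubInterp h n k ε s) (uubInterp h n k ε s).natDegree :=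
    ⟨le_rfl, lt_of_le_of_ne hlead (leadingCoeff_ne_zero.2 h0).symm⟩
  have h4 : 0 < gegenbauerCoeff n (uubInterp h n k ε s).natDegree (uubInterp h n k ε s) := by
    rw [gegenbauerCoeff_eq hn]
    exact div_pos (mean_mul_gegenbauer_pos_of_hasPosLead hn hpos) (mean_gegenbauer_sq_pos hn _)
  exact (pos_iff_pos_of_mul_pos (h4.trans_le h1)).2 h3

theorem uubLambda_nonneg (hn : 2 ≤ n) (hε : ε = 0 ∨ ε = 1) (hS : LevenshteinNodes n k ε s S)
    (hh : AbsolutelyMonotoneOn h (Set.Ico (-1) 1)) : 0 ≤ uubLambda h n k ε s := by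
  rcases Nat.eq_zero_or_pos (uubInterp h n k ε s).natDegree with h0 | h0
  -- The index set is empty here, and the supremum of the empty set of reals is 0.
  · rw [uubLambda, h0]; simp
  · exact (hS.uubLambda_pos hn hε hh h0).le

theorem gegenbauerCoeff_uubPoly_nonpos (hn : 2 ≤ n) (hε : ε = 0 ∨ ε = 1)
    (hS : LevenshteinNodes n k ε s S) (hh : AbsolutelyMonotoneOn h (Set.Ico (-1) 1)) {i : ℕ}
    (hi : 1 ≤ i) (him : i ≤ 2 * k - 1 + ε) : gegenbauerCoeff n i (uubPoly h n k ε s) ≤ 0 := by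
  rw [uubPoly, ← C_neg, gegenbauerCoeff_C_mul_add hn]
  by_cases hd : i ≤ (uubInterp h n k ε s).natDegree
  · have := hS.div_le_uubLambda (h := h) hn hε hi hd
    linarith
  · rw [gegenbauerCoeff_eq_zero hn (by omega : (uubInterp h n k ε s).natDegree < i)]
    have := mul_nonneg (hS.uubLambda_nonneg hn hε hh)
      (hS.gegenbauerCoeff_levenshteinPoly_pos hn hε him).le
    linarith

theorem natDegree_uubPoly_le (hn : 2 ≤ n) (hε : ε = 0 ∨ ε = 1) (hS : LevenshteinNodes n k ε s S) :
    (uubPoly h n k ε s).natDegree ≤ 2 * k - 1 + ε := by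
  rw [uubPoly, ← C_neg]
  exact (natDegree_add_le _ _).trans (max_le ((natDegree_C_mul_le _ _).trans
    (hS.natDegree_levenshteinPoly hn hε).le) (hS.natDegree_uubInterp hn hε).le)

theorem uubPoly_eval_node (hn : 2 ≤ n) (hε : ε = 0 ∨ ε = 1) (hS : LevenshteinNodes n k ε s S)
    (hh : AbsolutelyMonotoneOn h (Set.Ico (-1) 1)) {α : ℝ} (hα : α ∈ nodes n k ε s) :
    (uubPoly h n k ε s).eval α = h α := by
  obtain ⟨c, -, hc⟩ := hS.exists_remainder hn hε hh (hS.nodes_mem_Ico hn hε α hα)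
  rw [hc, uubPoly, eval_add, eval_mul, (hS.levenshteinPoly_eval_eq_zero_iff hn hε α).2 hα]
  ring

theorem mean_uubPoly (hn : 2 ≤ n) (hε : ε = 0 ∨ ε = 1) (hS : LevenshteinNodes n k ε s S)
    (hh : AbsolutelyMonotoneOn h (Set.Ico (-1) 1)) :
    mean hn (uubPoly h n k ε s) = (uubPoly h n k ε s).eval 1 / levenshteinBound n k ε s
      + ∑ α ∈ nodes n k ε s, quadratureWeight n k ε s α * h α := by
  rw [hS.mean_eq_add_sum hn hε (hS.natDegree_uubPoly_le hn hε), hS.mean_basis_one hn hε,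
    div_eq_inv_mul]
  congr 1
  exact Finset.sum_congr rfl fun α hα => by rw [hS.uubPoly_eval_node hn hε hh hα]

/-- The difference f - h is -(λ + c) times the Levenshtein polynomial, which is nonpositive on [-1,
s]. -/
theorem le_uubPoly_eval (hn : 2 ≤ n) (hε : ε = 0 ∨ ε = 1) (hS : LevenshteinNodes n k ε s S)
    (hh : AbsolutelyMonotoneOn h (Set.Ico (-1) 1)) {t : ℝ} (ht : t ∈ Set.Icc (-1) s) :
    h t ≤ (uubPoly h n k ε s).eval t := by
  have hs := (hS.mem_Ico s hS.mem).2
  obtain ⟨c, hc0, hc⟩ := hS.exists_remainder hn hε hh (t := t) ⟨ht.1, ht.2.trans_lt hs⟩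
  have h1 := hS.levenshteinPoly_eval_nonpos hn hε ht
  have h2 := hS.uubLambda_nonneg hn hε hh
  rw [hc, uubPoly, eval_add, eval_mul, eval_neg, eval_C]
  nlinarith [mul_nonpos_of_nonneg_of_nonpos hc0 h1, mul_nonpos_of_nonneg_of_nonpos h2 h1]

/-- Off the nodes, equality forces λ + c = 0, so g_T is constant and h takes the same value at t and
at the node s; this contradicts that h is not constant. -/
theorem mem_nodes_of_uubPoly_eval_eq (hn : 2 ≤ n) (hε : ε = 0 ∨ ε = 1)
    (hS : LevenshteinNodes n k ε s S) (hh : AbsolutelyMonotoneOn h (Set.Ico (-1) 1))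
    (hconst : ¬ ∃ c : ℝ, ∀ t ∈ Set.Ico (-1 : ℝ) 1, h t = c) {t : ℝ} (ht : t ∈ Set.Icc (-1) s)
    (heq : (uubPoly h n k ε s).eval t = h t) : t ∈ nodes n k ε s := by
  have hs := hS.mem_Ico s hS.mem
  have htI : t ∈ Set.Ico (-1 : ℝ) 1 := ⟨ht.1, ht.2.trans_lt hs.2⟩
  obtain ⟨c, hc0, hc⟩ := hS.exists_remainder hn hε hh htI
  have h2 := hS.uubLambda_nonneg hn hε hh
  have hmul : (c + uubLambda h n k ε s) * (levenshteinPoly n k ε s).eval t = 0 := by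
    rw [hc, uubPoly, eval_add, eval_mul, eval_neg, eval_C] at heq
    linear_combination -heq
  by_contra hnode
  have h0 := (mul_eq_zero.1 hmul).resolve_right fun h1 =>
    hnode ((hS.levenshteinPoly_eval_eq_zero_iff hn hε t).1 h1)
  have hlam : uubLambda h n k ε s = 0 := by linarith
  have hd : (uubInterp h n k ε s).natDegree = 0 := by
    by_contra hd
    exact (hS.uubLambda_pos hn hε hh (Nat.one_le_iff_ne_zero.2 hd)).ne' hlam
  obtain ⟨b, hb⟩ := natDegree_eq_zero.1 hd
  have hval : ∀ u ∈ Set.Ico (-1 : ℝ) 1, (uubPoly h n k ε s).eval u = b := by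
    intro u _
    rw [uubPoly, hlam, ← hb]
    simp
  have hts : h t = h s := by
    rw [← heq, ← hS.uubPoly_eval_node hn hε hh (hS.mem_nodes hn hε), hval t htI, hval s hs]
  have hlt : t < s := lt_of_le_of_ne ht.2 (by
    rintro rfl
    exact hnode (hS.mem_nodes hn hε))
  exact hconst ⟨_, eq_of_eq_of_lt hh htI hs hlt hts⟩

end LevenshteinNodes

end UniversalUpperBound

/-! ### The equality case for codes -/

section Codes

variable {n : ℕ} {K : Finset (EuclideanSpace ℝ (Fin n))}

theorem sum_filter_ne {α : Type*} (K : Finset α) {x : α} (hx : x ∈ K)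
    [DecidablePred fun y => y ≠ x] (F : α → ℝ) :
    F x + ∑ y ∈ K with y ≠ x, F y = ∑ y ∈ K, F y := by
  classical
  rw [← Finset.add_sum_erase K F hx]
  congr 1
  refine Finset.sum_congr ?_ fun _ _ => rfl
  ext y
  simp [and_comm]

theorem energy_eval_add (hK : ∀ x ∈ K, ‖x‖ = 1) (p : ℝ[X]) :
    K.card * p.eval 1 + energy (fun t => p.eval t) K = ∑ x ∈ K, ∑ y ∈ K, p.eval (inner ℝ x y) := by
  rw [energy, ← nsmul_eq_mul, ← Finset.sum_const, ← Finset.sum_add_distrib]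
  refine Finset.sum_congr rfl fun x hx => ?_
  rw [← sum_filter_ne K hx, real_inner_self_eq_norm_sq, hK x hx, one_pow]

/-- The Gegenbauer expansion turns the double sum into ∑ f_i M_i, where the M_i are nonnegative and
M_0 = |C|². -/
theorem sum_sum_eval_le (hn : 2 ≤ n) (hK : ∀ x ∈ K, ‖x‖ = 1) {p : ℝ[X]}
    (hp : ∀ i, 1 ≤ i → i ≤ p.natDegree → gegenbauerCoeff n i p ≤ 0) :
    ∑ x ∈ K, ∑ y ∈ K, p.eval (inner ℝ x y) ≤ (K.card : ℝ) ^ 2 * mean hn p := by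
  have h1 : ∑ x ∈ K, ∑ y ∈ K, p.eval (inner ℝ x y) =
      ∑ i ∈ Finset.range (p.natDegree + 1), gegenbauerCoeff n i p * moment i K := by
    conv_lhs => rw [eq_sum_gegenbauerCoeff hn (Nat.lt_succ_self p.natDegree)]
    simp only [eval_finsetSum, eval_mul, eval_C, moment, Finset.mul_sum]
    exact (Finset.sum_congr rfl fun x _ => Finset.sum_comm).trans Finset.sum_comm
  rw [h1, Finset.sum_range_succ', gegenbauerCoeff_zero hn]
  have h0 : moment 0 K = (K.card : ℝ) ^ 2 := by
    simp [moment, gegenbauer, sq]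
  rw [h0, mul_comm (mean hn p)]
  refine add_le_of_nonpos_left (Finset.sum_nonpos fun i hi => ?_)
  exact mul_nonpos_of_nonpos_of_nonneg (hp _ (by omega) (by have := Finset.mem_range.1 hi; omega))
    (moment_eq_sum_sq hn _ K hK).1

/-- The row is grouped by inner product. The diagonal term is the 1, and as 1 is not a node, no
A_α(x) counts the point x itself. -/
theorem sum_eval_inner_eq (hn : 2 ≤ n) (hK : ∀ x ∈ K, ‖x‖ = 1) {N : Finset ℝ} (hN : (1 : ℝ) ∉ N)
    {x : EuclideanSpace ℝ (Fin n)} (hx : x ∈ K) (hxN : ∀ y ∈ K, y ≠ x → inner ℝ x y ∈ N) (i : ℕ) :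
    ∑ y ∈ K, (gegenbauer n i).eval (inner ℝ x y) =
      1 + ∑ α ∈ N, (distanceDistribution K x α : ℝ) * (gegenbauer n i).eval α := by
  classical
  have hxx : inner ℝ x x = (1 : ℝ) := by rw [real_inner_self_eq_norm_sq, hK x hx, one_pow]
  rw [← sum_filter_ne K hx, hxx, gegenbauer_eval_one hn,
    ← Finset.sum_fiberwise_of_maps_to (g := fun y => inner ℝ x y) (t := N)
      (fun y hy => hxN y (Finset.mem_filter.1 hy).1 (Finset.mem_filter.1 hy).2)]
  congr 1
  refine Finset.sum_congr rfl fun α hα => ?_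
  rw [Finset.sum_congr rfl fun y hy => by rw [(Finset.mem_filter.1 hy).2], Finset.sum_const,
    nsmul_eq_mul, distanceDistribution]
  congr 3
  ext y
  simp only [Finset.mem_filter]
  constructor
  · rintro ⟨⟨h1, -⟩, h2⟩; exact ⟨h1, h2⟩
  · rintro ⟨h1, h2⟩
    refine ⟨⟨h1, ?_⟩, h2⟩
    rintro rfl
    exact hN (by rw [← hxx, h2]; exact hα)

/-- Attainment closes the chain E_h ≤ E_f ≤ UUB, so the nonnegative differences f - h sum to zero
over all pairs and vanish one by one. -/
theorem inner_mem_nodes_of_energy_eq_uub {M k ε : ℕ} (hn : 2 ≤ n) (hε : ε = 0 ∨ ε = 1) {s : ℝ}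
    {S : Finset ℝ} (hS : LevenshteinNodes n k ε s S) {h : ℝ → ℝ}
    (hh : AbsolutelyMonotoneOn h (Set.Ico (-1) 1))
    (hconst : ¬ ∃ c : ℝ, ∀ t ∈ Set.Ico (-1 : ℝ) 1, h t = c) (hK : K ∈ codes n M s)
    (hattain : energy h K = uub h n M k ε s) {x y : EuclideanSpace ℝ (Fin n)} (hx : x ∈ K)
    (hy : y ∈ K) (hyx : y ≠ x) : inner ℝ x y ∈ nodes n k ε s := by
  obtain ⟨hK1, hKM, hKs⟩ := hK
  have hmem : ∀ x ∈ K, ∀ y ∈ K, y ≠ x → inner ℝ x y ∈ Set.Icc (-1) s := by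
    intro x hx y hy hyx
    refine ⟨?_, hKs.2 ⟨x, hx, y, hy, hyx.symm, rfl⟩⟩
    have := (abs_le.1 (abs_real_inner_le_norm x y)).1
    rwa [hK1 x hx, hK1 y hy, one_mul] at this
  set p := uubPoly h n k ε s with hp
  have hle : ∀ x ∈ K, ∀ y ∈ K.filter (fun y => y ≠ x), 0 ≤ p.eval (inner ℝ x y) - h (inner ℝ x y) :=
    fun x hx y hy => sub_nonneg.2 (hS.le_uubPoly_eval hn hε hh
      (hmem x hx y (Finset.mem_filter.1 hy).1 (Finset.mem_filter.1 hy).2))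
  have hub : energy (fun t => p.eval t) K ≤ energy h K := by
    have h1 := energy_eval_add hK1 p
    have h2 := sum_sum_eval_le hn hK1 (p := p) fun i hi hi' =>
      hS.gegenbauerCoeff_uubPoly_nonpos hn hε hh hi (hi'.trans (hS.natDegree_uubPoly_le hn hε))
    rw [hS.mean_uubPoly hn hε hh, hKM] at h2
    rw [hKM] at h1
    have h3 : uub h n M k ε s = (M : ℝ) ^ 2 * (p.eval 1 / levenshteinBound n k ε s
      + ∑ α ∈ nodes n k ε s, quadratureWeight n k ε s α * h α) - M * p.eval 1 := by
      rw [uub]; ring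
    rw [hattain, h3]
    linarith
  have hdiff : ∑ x ∈ K, ∑ y ∈ K with y ≠ x, (p.eval (inner ℝ x y) - h (inner ℝ x y)) =
      energy (fun t => p.eval t) K - energy h K := by
    simp only [energy, Finset.sum_sub_distrib]
  have hzero : ∑ x ∈ K, ∑ y ∈ K with y ≠ x, (p.eval (inner ℝ x y) - h (inner ℝ x y)) = 0 :=
    le_antisymm (by rw [hdiff]; linarith)
      (Finset.sum_nonneg fun x hx => Finset.sum_nonneg (hle x hx))
  rw [Finset.sum_eq_zero_iff_of_nonneg fun x hx => Finset.sum_nonneg (hle x hx)] at hzero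
  have h4 := hzero x hx
  rw [Finset.sum_eq_zero_iff_of_nonneg (hle x hx)] at h4
  exact hS.mem_nodes_of_uubPoly_eval_eq hn hε hh hconst (hmem x hx y hy hyx)
    (sub_eq_zero.1 (h4 y (Finset.mem_filter.2 ⟨hy, hyx⟩)))

end Codes

end

end SphericalCodes

theorem mainTheorem6 (n M k ε : ℕ) (hn : 2 ≤ n) (hk : 1 ≤ k) (hε : ε = 0 ∨ ε = 1)
    (s : ℝ) (hs : s ∈ SphericalCodes.levenshteinInterval n k ε)
    (h : ℝ → ℝ) (hh : AbsolutelyMonotoneOn h (Set.Ico (-1) 1))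
    (hconst : ¬ ∃ c : ℝ, ∀ t ∈ Set.Ico (-1 : ℝ) 1, h t = c)
    (K : Finset (EuclideanSpace ℝ (Fin n))) (hK : K ∈ SphericalCodes.codes n M s)
    (hattain : SphericalCodes.energy h K = SphericalCodes.uub h n M k ε s)
    (i : ℕ) :
    SphericalCodes.moment i K = 0 ↔
      ∀ x ∈ K,
        1 + ∑ α ∈ SphericalCodes.nodes n k ε s,
          (SphericalCodes.distanceDistribution K x α : ℝ) *
            (SphericalCodes.gegenbauer n i).eval α = 0 := by
  obtain ⟨S, hS⟩ := SphericalCodes.exists_levenshteinNodes hn hk hε hs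
  have hrow : ∀ x ∈ K, ∑ y ∈ K, (SphericalCodes.gegenbauer n i).eval (inner ℝ x y) =
      1 + ∑ α ∈ SphericalCodes.nodes n k ε s,
        (SphericalCodes.distanceDistribution K x α : ℝ) *
          (SphericalCodes.gegenbauer n i).eval α := fun x hx =>
    SphericalCodes.sum_eval_inner_eq hn hK.1 (hS.one_notMem_nodes hn hε) hx
      (fun _ hy hyx => SphericalCodes.inner_mem_nodes_of_energy_eq_uub hn hε hS hh hconst hK hattain
        hx hy hyx) i
  rw [(SphericalCodes.moment_eq_sum_sq hn i K hK.1).2]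
  exact forall₂_congr fun x hx => by rw [hrow x hx]
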